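/- A polyhedron is a connected subset $P$ of $\mathbb R^3$ that is a union of finitely many closed tetrahedra and whose boundary is a (possibly disconnected, orientable) $2$-manifold. Its faces are the maximal planar polygonal pieces of its boundary with connected, non-empty relative interior. $P$ is orthogonal if there is an orthonormal basis of $\mathbb R^3$ such that each face of $P$ is orthogonal to one of the basis vectors. A set of faces of $P$, used as open face guards, guards $P$ if every point $y$ of $P$ (including its boundary) can be joined, by a straight line segment contained in $P$, to a point in the relative interior of one of these faces. Theorem. $\lfloor f/6\rfloor$ open face guards are always sufficient and sometimes necessary to guard an orthogonal polyhedron with $f$ faces. That is: (1) every orthogonal polyhedron with exactly $f$ faces can be guarded by at most $\lfloor f/6\rfloor$ open face guards; (2) for $f=6$ and for every integer $f\ge 8$ there is an orthogonal polyhedron with exactly $f$ faces that cannot be guarded by fewer than $\lfloor f/6\rfloor$ open face guards. -/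

import Mathlib

namespace FaceGuards

/-- Euclidean three-dimensional space. -/
abbrev E3 : Type := EuclideanSpace ℝ (Fin 3)

/-- A closed (non-degenerate) tetrahedron: the convex hull of four affinely independent points. -/
def IsTetrahedron (T : Set E3) : Prop :=
  ∃ v : Fin 4 → E3, AffineIndependent ℝ v ∧ T = convexHull ℝ (Set.range v)

/-- A polyhedron: a connected (in particular non-empty) union of finitely many closed tetrahedra,
whose boundary, with the subspace topology, is a 2-manifold (without boundary, possibly
disconnected). Orientability of the boundary need not be required separately: every compact
2-manifold in three-dimensional space is orientable. -/
structure IsPolyhedron (P : Set E3) : Prop where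
  isConnected : IsConnected P
  tetrahedra : ∃ 𝒯 : Set (Set E3), 𝒯.Finite ∧ (∀ T ∈ 𝒯, IsTetrahedron T) ∧ P = ⋃₀ 𝒯
  manifold : Nonempty (ChartedSpace (EuclideanSpace ℝ (Fin 2)) (frontier P))

/-- `F` is a two-dimensional planar piece of the boundary of `P` with connected and non-empty
relative interior. The last clause excludes lower-dimensional whiskers, so that the maximal such
pieces are plane polygons. -/
structure IsPlanarPiece (P F : Set E3) : Prop where
  subset_frontier : F ⊆ frontier P
  planar : Module.finrank ℝ (vectorSpan ℝ F) = 2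
  isConnected_interior : IsConnected (intrinsicInterior ℝ F)
  subset_closure : F ⊆ closure (intrinsicInterior ℝ F)

/-- The (closed) faces of `P`: the maximal planar pieces of its boundary. -/
def faces (P : Set E3) : Set (Set E3) :=
  {F | Maximal (IsPlanarPiece P) F}

/-- A polyhedron is orthogonal if, for some orthonormal basis of space, each of its faces is
orthogonal to one of the basis vectors. -/
structure IsOrthogonalPolyhedron (P : Set E3) : Prop extends IsPolyhedron P where
  orthogonal : ∃ b : OrthonormalBasis (Fin 3) ℝ E3,
    ∀ F ∈ faces P, ∃ i : Fin 3, ∀ x ∈ F, ∀ y ∈ F, inner ℝ (b i) (y - x) = 0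

/-- The visible region of a set `S` in `P`: the points that can be joined to a point of `S` by a
segment none of whose points lies outside `P`. -/
def visibleRegion (P S : Set E3) : Set E3 :=
  {y | ∃ x ∈ S, segment ℝ x y ⊆ P}

/-- `𝒢` is a set of faces of `P` which, used as open face guards (faces without their relative
boundary), guards all of `P`. -/
structure IsOpenFaceGuarding (P : Set E3) (𝒢 : Finset (Set E3)) : Prop where
  subset_faces : (𝒢 : Set (Set E3)) ⊆ faces P
  guards : visibleRegion P (⋃ F ∈ 𝒢, intrinsicInterior ℝ F) = P

end FaceGuards

/-!
Both halves of the theorem are about *flat points*: boundary points near which the polyhedron `P` is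
a half-space, necessarily bounded by a coordinate plane of the given orthonormal basis.

**Sufficiency.** Each of the six directions `(i, ±)` has its own set of faces, `facing b P i a`:
those with a relative interior point near which `P` lies on the corresponding side of the face.

* The faces of one direction guard everything (`facing_guards`). Let `y ∈ P`. Near `y`, the
  polyhedron is a union of closed octants (`exists_octants`). A ray in the given direction from the
  centre of a small one of them leaves `P` at a flat point of the opposite side, and the column
  swept by the octant until then is contained in `P`, so that `y` sees the exit point
  (`exists_visible_halfSpaceAt`).
* The six sets are pairwise disjoint (`facing_unique`), so the smallest of them has at most
  `⌊f/6⌋` members. For a face in two sets, `P` would change sides somewhere in its relative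
  interior, which is connected. At the change, the planar boundary on one side and the opposite one on the
  other would make `P`, at some nearby point, two opposite quadrants times a line
  (`halfSpaceAt_of_flat`). Its boundary is then a cross times a line, which has no planar chart
  (`false_of_opposite_quadrants`): around the centre, there are two loops and two functions with an
  isolated zero there whose winding numbers along the loops form the identity matrix, whereas in a
  planar chart they would be products of an integer for the function and one for the loop
  (`false_of_planar_chart`).

**Necessity.** `tube n` is a tube with square cross-section, whose `n + 1` segments run in the
directions `x`, `y`, `z`, `x`, … in turn, so that each segment prepended at its start adds two
faces: it has `6 + 2 n` faces. Prepending to it a segment of height `1 / 2` instead of `1` adds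
three faces, and hence gives the odd values from `9` on. Every third segment contains a `witness`,
and a tube is monotone in all three coordinates (`StaircaseBounds`), which bounds the part of it
that can be seen from a witness (`StaircaseBounds.visible`). The planes of the faces that can be
seen from different witnesses are different (`IsStaircaseSolid.witness_unique`), so that each
witness requires a guard of its own. That the tubes are polyhedra follows from local monotonicity:
near each boundary point the solid is an upper set for some orthant order, hence its boundary is a
Lipschitz graph (`LocallyMonotoneAt.exists_chart`). The faces are counted by induction on the number
of segments (`IsStaircase.planes_step`): no coordinate plane carries two faces
(`IsStaircase.isPreconnected_flatFrom_step`), so that the planes can be counted instead.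
-/

namespace FaceGuards

open Set Metric Module Filter Topology

/-! ### Planar pieces of the boundary -/

/-- The plane with normal vector `n` (meant to be non-zero) and offset `c`. -/
def plane (n : E3) (c : ℝ) : Set E3 := {x | inner ℝ n x = c}

/-- The interior of `F ∩ plane n c` relative to the plane. -/
def planeInterior (n : E3) (c : ℝ) (F : Set E3) : Set E3 :=
  {p | p ∈ plane n c ∧ ∃ ε > 0, ∀ q ∈ plane n c, dist q p < ε → q ∈ F}

theorem mem_plane {n : E3} {c : ℝ} {x : E3} : x ∈ plane n c ↔ inner ℝ n x = c := Iff.rfl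

theorem isClosed_plane (n : E3) (c : ℝ) : IsClosed (plane n c) :=
  isClosed_eq (by fun_prop) continuous_const

theorem convex_plane (n : E3) (c : ℝ) : Convex ℝ (plane n c) := by
  intro x hx y hy a b _ _ hab
  simp only [mem_plane] at *
  rw [inner_add_right, inner_smul_right, inner_smul_right, hx, hy, ← add_mul, hab, one_mul]

theorem planeInterior_subset (n : E3) (c : ℝ) (F : Set E3) : planeInterior n c F ⊆ F := by
  rintro p ⟨hp, ε, hε, h⟩
  exact h p hp (by simpa using hε)

theorem planeInterior_subset_plane (n : E3) (c : ℝ) (F : Set E3) :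
    planeInterior n c F ⊆ plane n c := fun _ hp => hp.1

theorem planeInterior_mono {n : E3} {c : ℝ} {F G : Set E3} (h : F ⊆ G) :
    planeInterior n c F ⊆ planeInterior n c G := by
  rintro p ⟨hp, ε, hε, h'⟩
  exact ⟨hp, ε, hε, fun q hq hd => h (h' q hq hd)⟩

theorem planeInterior_ball {n : E3} {c : ℝ} {F : Set E3} {p : E3} {ε : ℝ}
    (h : ∀ q ∈ plane n c, dist q p < ε → q ∈ F) :
    ball p ε ∩ plane n c ⊆ planeInterior n c F := by
  rintro q ⟨hq, hqn⟩
  refine ⟨hqn, ε - dist q p, by simpa using hq, fun r hr hd => h r hr ?_⟩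
  have := dist_triangle r q p
  linarith

theorem vectorSpan_le_orthogonal {n : E3} {c : ℝ} {F : Set E3} (hF : F ⊆ plane n c) :
    vectorSpan ℝ F ≤ (ℝ ∙ n)ᗮ := by
  rw [vectorSpan_def, Submodule.span_le]
  rintro _ ⟨x, hx, y, hy, rfl⟩
  have h1 := hF hx
  have h2 := hF hy
  simp only [mem_plane] at h1 h2
  simp only [SetLike.mem_coe, Submodule.mem_orthogonal_singleton_iff_inner_right, vsub_eq_sub,
    inner_sub_right, h1, h2, sub_self]

theorem finrank_orthogonal {n : E3} (hn : n ≠ 0) : finrank ℝ (ℝ ∙ n)ᗮ = 2 := by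
  have : Fact (finrank ℝ E3 = 2 + 1) := ⟨by simp⟩
  exact Submodule.finrank_orthogonal_span_singleton hn

/-- A subset of a plane with a relative interior point spans the plane. -/
theorem vectorSpan_eq_orthogonal {n : E3} {c : ℝ} {F : Set E3} (hF : F ⊆ plane n c)
    (h : (planeInterior n c F).Nonempty) : vectorSpan ℝ F = (ℝ ∙ n)ᗮ := by
  refine le_antisymm (vectorSpan_le_orthogonal hF) fun v hv => ?_
  obtain ⟨p, hp, ε, hε, h⟩ := h
  have hpF := h p hp (by simpa using hε)
  have hnv : inner ℝ n v = 0 := by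
    rwa [Submodule.mem_orthogonal_singleton_iff_inner_right] at hv
  have ht : 0 < ε / (2 * (‖v‖ + 1)) := by positivity
  set t := ε / (2 * (‖v‖ + 1)) with htdef
  have hmem : p + t • v ∈ F := by
    refine h _ ?_ ?_
    · rw [mem_plane] at *
      rw [inner_add_right, inner_smul_right, hnv, hp]; ring
    · rw [dist_eq_norm, add_sub_cancel_left, norm_smul, Real.norm_eq_abs, abs_of_pos ht, htdef,
        div_mul_eq_mul_div, div_lt_iff₀ (by positivity)]
      nlinarith [norm_nonneg v]
  have h2 := vsub_mem_vectorSpan ℝ hmem hpF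
  rw [vsub_eq_sub, add_sub_cancel_left] at h2
  simpa [smul_smul, inv_mul_cancel₀ ht.ne'] using Submodule.smul_mem _ t⁻¹ h2

theorem intrinsicInterior_eq {n : E3} {c : ℝ} {F : Set E3} (hF : F ⊆ plane n c)
    (hv : vectorSpan ℝ F = (ℝ ∙ n)ᗮ) : intrinsicInterior ℝ F = planeInterior n c F := by
  have key : ∀ p ∈ F, ∀ x, x ∈ affineSpan ℝ F ↔ x ∈ plane n c := by
    intro p hp x
    have hpn := hF hp
    rw [← AffineSubspace.vsub_right_mem_direction_iff_mem (subset_affineSpan ℝ F hp),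
      direction_affineSpan, hv, Submodule.mem_orthogonal_singleton_iff_inner_right, vsub_eq_sub,
      inner_sub_right, mem_plane]
    rw [mem_plane] at hpn
    rw [hpn, sub_eq_zero]
  ext x
  rw [mem_intrinsicInterior]
  constructor
  · rintro ⟨y, hy, rfl⟩
    have hyF : y ∈ ((↑) ⁻¹' F : Set (affineSpan ℝ F)) := interior_subset hy
    refine ⟨hF hyF, ?_⟩
    rw [mem_interior_iff_mem_nhds, Metric.mem_nhds_iff] at hy
    obtain ⟨ε, hε, h⟩ := hy
    refine ⟨ε, hε, fun q hq hd => ?_⟩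
    exact @h ⟨q, (key _ hyF q).2 hq⟩ (by simpa [Subtype.dist_eq] using hd)
  · rintro ⟨hx, ε, hε, h⟩
    have hxF : x ∈ F := h x hx (by simpa using hε)
    refine ⟨⟨x, subset_affineSpan ℝ F hxF⟩, ?_, rfl⟩
    rw [mem_interior_iff_mem_nhds, Metric.mem_nhds_iff]
    refine ⟨ε, hε, fun q hq => h q ((key _ hxF _).1 q.2) ?_⟩
    simpa [Subtype.dist_eq] using hq

theorem exists_plane {F : Set E3} (h : finrank ℝ (vectorSpan ℝ F) = 2) :
    ∃ n : E3, n ≠ 0 ∧ ∃ c : ℝ, F ⊆ plane n c ∧ vectorSpan ℝ F = (ℝ ∙ n)ᗮ := by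
  have h1 : finrank ℝ (vectorSpan ℝ F)ᗮ = 1 := by
    have := Submodule.finrank_add_finrank_orthogonal (vectorSpan ℝ F)
    have h3 : finrank ℝ E3 = 3 := by simp
    omega
  obtain ⟨n, hn, hspan⟩ := finrank_eq_one_iff'.1 h1
  have hn0 : (n : E3) ≠ 0 := by simpa using hn
  have hle : vectorSpan ℝ F ≤ (ℝ ∙ (n : E3))ᗮ := by
    intro v hv
    rw [Submodule.mem_orthogonal_singleton_iff_inner_left]
    exact n.2 v hv
  have heq := Submodule.eq_of_le_of_finrank_eq hle (by rw [h, finrank_orthogonal hn0])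
  have hne : F.Nonempty := by
    rw [nonempty_iff_ne_empty]
    rintro rfl
    rw [vectorSpan_empty, finrank_bot] at h; omega
  obtain ⟨p, hp⟩ := hne
  refine ⟨n, hn0, inner ℝ (n : E3) p, fun x hx => ?_, heq⟩
  have := hle (vsub_mem_vectorSpan ℝ hx hp)
  rw [Submodule.mem_orthogonal_singleton_iff_inner_right, vsub_eq_sub, inner_sub_right,
    sub_eq_zero] at this
  exact this

/-- The points of a plane near which the whole plane belongs to the boundary of `P`. -/
def flatPart (P : Set E3) (n : E3) (c : ℝ) : Set E3 := planeInterior n c (frontier P)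

theorem flatPart_subset_plane (P : Set E3) (n : E3) (c : ℝ) : flatPart P n c ⊆ plane n c :=
  planeInterior_subset_plane n c _

/-- The components of the flat part are relatively open in the plane. -/
theorem component_subset_planeInterior (P : Set E3) (n : E3) (c : ℝ) (p : E3) :
    connectedComponentIn (flatPart P n c) p ⊆
      planeInterior n c (connectedComponentIn (flatPart P n c) p) := by
  intro q hq
  have hq' := connectedComponentIn_subset _ _ hq
  obtain ⟨hqn, ε, hε, h⟩ := hq'
  refine ⟨hqn, ε, hε, fun r hr hd => ?_⟩
  rw [connectedComponentIn_eq hq]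
  exact IsPreconnected.subset_connectedComponentIn
    (((convex_ball q ε).inter (convex_plane n c)).isPreconnected)
    ⟨mem_ball_self hε, hqn⟩ (planeInterior_ball h) ⟨hd, hr⟩

theorem planeInterior_closure_component {P : Set E3} {n : E3} {c : ℝ} {p : E3}
    (hp : p ∈ flatPart P n c) :
    planeInterior n c (closure (connectedComponentIn (flatPart P n c) p)) =
      connectedComponentIn (flatPart P n c) p := by
  set C := connectedComponentIn (flatPart P n c) p with hC
  have h1 : C ⊆ planeInterior n c (closure C) :=
    (component_subset_planeInterior P n c p).trans (planeInterior_mono subset_closure)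
  refine subset_antisymm ?_ h1
  have hconn : IsPreconnected (planeInterior n c (closure C)) :=
    isPreconnected_connectedComponentIn.subset_closure h1 (planeInterior_subset _ _ _)
  have hsub : closure C ⊆ frontier P := closure_minimal
    ((connectedComponentIn_subset _ _).trans (planeInterior_subset _ _ _)) isClosed_frontier
  exact hconn.subset_connectedComponentIn (h1 (mem_connectedComponentIn hp))
    (planeInterior_mono hsub)

theorem isPlanarPiece_closure_component {P : Set E3} {n : E3} (hn : n ≠ 0) {c : ℝ} {p : E3}
    (hp : p ∈ flatPart P n c) :
    intrinsicInterior ℝ (closure (connectedComponentIn (flatPart P n c) p)) =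
      connectedComponentIn (flatPart P n c) p ∧
    IsPlanarPiece P (closure (connectedComponentIn (flatPart P n c) p)) := by
  have hint := planeInterior_closure_component hp
  set C := connectedComponentIn (flatPart P n c) p with hC
  have hpC : p ∈ C := mem_connectedComponentIn hp
  have hCR : C ⊆ flatPart P n c := connectedComponentIn_subset _ _
  have hpl : closure C ⊆ plane n c :=
    closure_minimal (hCR.trans (flatPart_subset_plane P n c)) (isClosed_plane n c)
  have hv := vectorSpan_eq_orthogonal hpl (by rw [hint]; exact ⟨p, hpC⟩)
  have hii : intrinsicInterior ℝ (closure C) = C := by rw [intrinsicInterior_eq hpl hv, hint]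
  refine ⟨hii, closure_minimal (hCR.trans (planeInterior_subset _ _ _)) isClosed_frontier, ?_, ?_,
    ?_⟩
  · rw [hv, finrank_orthogonal hn]
  · rw [hii]; exact isConnected_connectedComponentIn_iff.2 hp
  · rw [hii]

/-- Every planar piece lies in the closure of a component of the flat part of some plane. -/
theorem IsPlanarPiece.exists_component {P F : Set E3} (hF : IsPlanarPiece P F) :
    ∃ n : E3, n ≠ 0 ∧ ∃ c : ℝ, F ⊆ plane n c ∧ ∃ p ∈ flatPart P n c,
      F ⊆ closure (connectedComponentIn (flatPart P n c) p) := by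
  obtain ⟨n, hn, c, hFn, hv⟩ := exists_plane hF.planar
  have hii := intrinsicInterior_eq hFn hv
  obtain ⟨p, hp⟩ := hF.isConnected_interior.nonempty
  have hsub : intrinsicInterior ℝ F ⊆ flatPart P n c := by
    rw [hii]; exact planeInterior_mono hF.subset_frontier
  exact ⟨n, hn, c, hFn, p, hsub hp, hF.subset_closure.trans (closure_mono
    (hF.isConnected_interior.isPreconnected.subset_connectedComponentIn hp hsub))⟩

theorem IsPlanarPiece.mem_of_component_subset {P F : Set E3} (hF : IsPlanarPiece P F)
    {n : E3} (hn : n ≠ 0) {c : ℝ} {p : E3} (hp : p ∈ flatPart P n c)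
    (h : closure (connectedComponentIn (flatPart P n c) p) ⊆ F) :
    F = closure (connectedComponentIn (flatPart P n c) p) := by
  refine subset_antisymm ?_ h
  have hint := planeInterior_closure_component hp
  obtain ⟨-, hpiece⟩ := isPlanarPiece_closure_component hn hp
  obtain ⟨m, hm, d, hFm, hv⟩ := exists_plane hF.planar
  set C := connectedComponentIn (flatPart P n c) p with hC
  have hpC : p ∈ C := mem_connectedComponentIn hp
  have hCR : C ⊆ flatPart P n c := connectedComponentIn_subset _ _
  have hpl : closure C ⊆ plane n c :=
    closure_minimal (hCR.trans (flatPart_subset_plane P n c)) (isClosed_plane n c)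
  have hvC := vectorSpan_eq_orthogonal hpl (by rw [hint]; exact ⟨p, hpC⟩)
  have hvF : vectorSpan ℝ F = (ℝ ∙ n)ᗮ := by
    symm
    refine Submodule.eq_of_le_of_finrank_eq ?_ (by rw [hF.planar, finrank_orthogonal hn])
    rw [← hvC]; exact vectorSpan_mono ℝ h
  have hFn : F ⊆ plane n c := by
    intro x hx
    have h1 : x - p ∈ vectorSpan ℝ F := vsub_mem_vectorSpan ℝ hx (h (_root_.subset_closure hpC))
    rw [hvF, Submodule.mem_orthogonal_singleton_iff_inner_right, inner_sub_right, sub_eq_zero] at h1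
    rw [mem_plane, h1]; exact hp.1
  have hii := intrinsicInterior_eq hFn hvF
  have hsub : intrinsicInterior ℝ F ⊆ flatPart P n c := by
    rw [hii]; exact planeInterior_mono hF.subset_frontier
  have hpF : p ∈ intrinsicInterior ℝ F := by
    rw [hii]
    exact planeInterior_mono h (planeInterior_mono _root_.subset_closure
      (component_subset_planeInterior P n c p hpC))
  exact hF.subset_closure.trans (closure_mono
    (hF.isConnected_interior.isPreconnected.subset_connectedComponentIn hpF hsub))

theorem closure_component_mem_faces {P : Set E3} {n : E3} (hn : n ≠ 0) {c : ℝ} {p : E3}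
    (hp : p ∈ flatPart P n c) : closure (connectedComponentIn (flatPart P n c) p) ∈ faces P :=
  ⟨(isPlanarPiece_closure_component hn hp).2,
    fun _ hG hle => (hG.mem_of_component_subset hn hp hle).le⟩

theorem exists_component_of_mem_faces {P F : Set E3} (hF : F ∈ faces P) :
    ∃ n : E3, n ≠ 0 ∧ ∃ c : ℝ, ∃ p ∈ flatPart P n c,
      F = closure (connectedComponentIn (flatPart P n c) p) := by
  obtain ⟨n, hn, c, -, p, hp, hsub⟩ := hF.1.exists_component
  exact ⟨n, hn, c, p, hp,
    subset_antisymm hsub (hF.2 (isPlanarPiece_closure_component hn hp).2 hsub)⟩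

/-! ### Winding numbers and the cross times a line -/

/-- Two continuous logarithms of the same function on a connected space differ by a constant. -/
theorem sub_eq_sub_of_exp_eq {A : Type*} [TopologicalSpace A] [PreconnectedSpace A] {F G : A → ℂ}
    (hF : Continuous F) (hG : Continuous G) (h : ∀ a, Complex.exp (F a) = Complex.exp (G a))
    (a b : A) : F a - G a = F b - G b := by
  have h1 : F = fun x => G x + (F a - G a) := by
    refine Complex.isCoveringMap_exp.eq_of_comp_eq hF (by fun_prop) ?_ a (by ring)
    funext x
    simp only [Function.comp_apply, Subtype.mk.injEq]
    rw [Complex.exp_add, Complex.exp_sub, h a, div_self (Complex.exp_ne_zero _), mul_one, h x]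
  linear_combination -congrFun h1 b

theorem exists_log_of_convex {E : Type*} [NormedAddCommGroup E] [NormedSpace ℝ E] {S : Set E}
    (hS : Convex ℝ S) (hne : S.Nonempty) (ho : IsOpen S) {f : E → ℂ} (hf : ContinuousOn f S)
    (h0 : ∀ x ∈ S, f x ≠ 0) :
    ∃ H : E → ℂ, ContinuousOn H S ∧ ∀ x ∈ S, Complex.exp (H x) = f x := by
  have hsc : IsSimplyConnected S := by
    have := hS.contractibleSpace hne
    exact SimplyConnectedSpace.ofContractible S
  obtain ⟨H, hH, he⟩ := Complex.exists_continuousOn_eqOn_exp_comp hsc ho hf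
    (by rintro ⟨x, hx, h⟩; exact h0 x hx h)
  exact ⟨H, hH, fun x hx => he hx⟩

/-- A non-vanishing map on a punctured disc multiplies winding numbers by an integer. -/
theorem exists_winding_factor {h : ℂ → ℂ} {δ : ℝ} (hδ : 0 < δ)
    (hc : ContinuousOn h (ball 0 δ \ {0})) (h0 : ∀ z ∈ ball (0 : ℂ) δ \ {0}, h z ≠ 0) :
    ∃ k : ℤ, ∀ (g : ℝ → ℂ) (a : ℤ), Continuous g → (∀ t, Complex.exp (g t) ∈ ball (0 : ℂ) δ) →
      g (2 * Real.pi) = g 0 + 2 * Real.pi * Complex.I * a →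
      ∃ G : ℝ → ℂ, Continuous G ∧ (∀ t, Complex.exp (G t) = h (Complex.exp (g t))) ∧
        G (2 * Real.pi) = G 0 + 2 * Real.pi * Complex.I * (k * a : ℤ) := by
  set S : Set ℂ := {w | w.re < Real.log δ} with hSdef
  have hSmem : ∀ w, w ∈ S ↔ Complex.exp w ∈ ball (0 : ℂ) δ := by
    intro w
    rw [mem_ball_zero_iff, Complex.norm_exp, ← Real.lt_log_iff_exp_lt hδ]; rfl
  have hS : Convex ℝ S := convex_halfSpace_re_lt _
  have hSo : IsOpen S := isOpen_lt Complex.continuous_re continuous_const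
  have hexp : MapsTo Complex.exp S (ball (0 : ℂ) δ \ {0}) := fun w hw =>
    ⟨(hSmem w).1 hw, Complex.exp_ne_zero w⟩
  have hSne : S.Nonempty := ⟨((Real.log δ - 1 : ℝ) : ℂ), by simp [hSdef]⟩
  obtain ⟨H, hH, hHe⟩ := exists_log_of_convex hS hSne hSo
    (f := h ∘ Complex.exp) (hc.comp Complex.continuous_exp.continuousOn hexp)
    (fun w hw => h0 _ (hexp hw))
  have hshift : ∀ w ∈ S, ∀ n : ℤ, w + 2 * Real.pi * Complex.I * n ∈ S := by
    intro w hw n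
    rw [hSmem, mul_comm, Complex.exp_periodic.int_mul n w]
    exact (hSmem w).1 hw
  obtain ⟨w₀, hw₀⟩ := hSne
  have hw₀' := hshift w₀ hw₀ 1
  have hper : ∀ w ∈ S, ∀ n : ℤ, Complex.exp (H (w + 2 * Real.pi * Complex.I * n)) =
      Complex.exp (H w) := by
    intro w hw n
    rw [hHe _ (hshift w hw n), hHe _ hw]
    simp only [Function.comp_apply]
    rw [mul_comm (2 * Real.pi * Complex.I), Complex.exp_periodic.int_mul n w]
  obtain ⟨k, hk⟩ := Complex.exp_eq_exp_iff_exists_int.1 (hper w₀ hw₀ 1)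
  have hstep : ∀ w ∈ S, H (w + 2 * Real.pi * Complex.I) = H w + 2 * Real.pi * Complex.I * k := by
    intro w hw
    have : PreconnectedSpace S := Subtype.preconnectedSpace hS.isPreconnected
    have hHr : Continuous fun x : S => H x := continuousOn_iff_continuous_domRestrict.1 hH
    have h1 := sub_eq_sub_of_exp_eq (A := S)
      (F := fun x => H (x + 2 * Real.pi * Complex.I * (1 : ℤ)))
      (G := fun x => H x)
      (hH.comp_continuous (by fun_prop) fun x => hshift x x.2 1) hHr
      (fun x => hper x x.2 1) ⟨w, hw⟩ ⟨w₀, hw₀⟩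
    simp only [hk] at h1
    push_cast at h1
    rw [mul_one] at h1
    linear_combination h1
  have hnat : ∀ n : ℕ, ∀ w ∈ S, H (w + 2 * Real.pi * Complex.I * n) =
      H w + 2 * Real.pi * Complex.I * (k * n) := by
    intro n
    induction n with
    | zero => intro w _; simp
    | succ n ih =>
      intro w hw
      have h1 := hstep _ (hshift w hw n)
      have h2 := ih w hw
      push_cast at h1 ⊢
      rw [h2] at h1
      rw [mul_add, mul_one, ← add_assoc, h1]; ring
  have hint : ∀ n : ℤ, ∀ w ∈ S, H (w + 2 * Real.pi * Complex.I * n) =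
      H w + 2 * Real.pi * Complex.I * (k * n) := by
    intro n w hw
    obtain ⟨m, rfl | rfl⟩ := n.eq_nat_or_neg
    · exact_mod_cast hnat m w hw
    · have h1 := hnat m _ (hshift w hw (-m))
      push_cast at h1 ⊢
      rw [show w + 2 * Real.pi * Complex.I * -(m : ℂ) + 2 * Real.pi * Complex.I * m = w by ring]
        at h1
      rw [h1]; ring
  refine ⟨k, fun g a hg hball hga => ⟨fun t => H (g t), ?_, ?_, ?_⟩⟩
  · exact hH.comp_continuous hg fun t => (hSmem _).2 (hball t)
  · exact fun t => hHe _ ((hSmem _).2 (hball t))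
  · simp only
    rw [hga, hint a _ ((hSmem _).2 (hball 0))]
    push_cast; ring

/-- The local obstruction at a point of the cross times a line: if two functions `r₁`, `r₂` with
an isolated common zero `y₀` wind once around arbitrarily small loops `γ₁`, `γ₂` respectively, but
have null-homotopic values on `γ₂`, `γ₁` respectively, then the space has no planar chart at
`y₀`. -/
theorem false_of_planar_chart {Y : Type*} [TopologicalSpace Y] (e : OpenPartialHomeomorph Y ℂ)
    {y₀ : Y} (hy₀ : y₀ ∈ e.source) {r₁ r₂ : Y → ℂ} (hr₁ : Continuous r₁) (hr₂ : Continuous r₂)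
    {N : Set Y} (hN : N ∈ nhds y₀) (h₁ : ∀ y ∈ N, y ≠ y₀ → r₁ y ≠ 0)
    (h₂ : ∀ y ∈ N, y ≠ y₀ → r₂ y ≠ 0)
    (hγ : ∀ M ∈ nhds y₀, ∃ r : ℝ, 0 < r ∧ ∃ γ₁ γ₂ : ℝ → Y, Continuous γ₁ ∧ Continuous γ₂ ∧
      γ₁ (2 * Real.pi) = γ₁ 0 ∧ γ₂ (2 * Real.pi) = γ₂ 0 ∧
      ∀ t, γ₁ t ∈ M ∧ γ₁ t ≠ y₀ ∧ γ₂ t ∈ M ∧ γ₂ t ≠ y₀ ∧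
        r₁ (γ₁ t) = r * Complex.exp (t * Complex.I) ∧
        r₂ (γ₁ t) = r * (Real.cos t - Complex.I * |Real.sin t|) ∧
        r₁ (γ₂ t) = r * (Real.cos t - Complex.I * |Real.sin t|) ∧
        r₂ (γ₂ t) = r * Complex.exp (t * Complex.I)) : False := by
  -- a small disc around the image of `y₀`, inside the image of `N`
  have hN' : e.symm ⁻¹' N ∈ nhds (e y₀) := by
    have := e.symm.continuousAt (e.map_source hy₀)
    rw [ContinuousAt, e.left_inv hy₀] at this
    exact this hN
  obtain ⟨δ, hδ, hball⟩ := Metric.mem_nhds_iff.1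
    (Filter.inter_mem hN' (e.open_target.mem_nhds (e.map_source hy₀)))
  have hz : ∀ z ∈ ball (0 : ℂ) δ \ {0}, e y₀ + z ∈ e.target ∧ e.symm (e y₀ + z) ∈ N ∧
      e.symm (e y₀ + z) ≠ y₀ := by
    rintro z ⟨hz, hz0⟩
    have h1 : e y₀ + z ∈ ball (e y₀) δ := by
      simpa [mem_ball, dist_eq_norm] using hz
    refine ⟨(hball h1).2, (hball h1).1, fun h => hz0 ?_⟩
    have h2 := e.right_inv (hball h1).2
    rw [h] at h2
    simpa using h2
  have key : ∀ r : Y → ℂ, Continuous r → (∀ y ∈ N, y ≠ y₀ → r y ≠ 0) → ∃ k : ℤ,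
      ∀ (g : ℝ → ℂ) (a : ℤ), Continuous g → (∀ t, Complex.exp (g t) ∈ ball (0 : ℂ) δ) →
      g (2 * Real.pi) = g 0 + 2 * Real.pi * Complex.I * a →
      ∃ G : ℝ → ℂ, Continuous G ∧
        (∀ t, Complex.exp (G t) = r (e.symm (e y₀ + Complex.exp (g t)))) ∧
        G (2 * Real.pi) = G 0 + 2 * Real.pi * Complex.I * (k * a : ℤ) := by
    intro r hr hr0
    refine exists_winding_factor (h := fun z => r (e.symm (e y₀ + z))) hδ ?_ ?_
    · refine hr.comp_continuousOn (e.symm.continuousOn.comp (by fun_prop) fun z hz' => (hz z hz').1)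
    · exact fun z hz' => hr0 _ (hz z hz').2.1 (hz z hz').2.2
  obtain ⟨k₁, hk₁⟩ := key r₁ hr₁ h₁
  obtain ⟨k₂, hk₂⟩ := key r₂ hr₂ h₂
  have hM : e.source ∩ e ⁻¹' ball (e y₀) δ ∈ nhds y₀ :=
    Filter.inter_mem (e.open_source.mem_nhds hy₀)
      ((e.continuousAt hy₀) (ball_mem_nhds _ hδ))
  obtain ⟨r, hr, γ₁, γ₂, hγ₁, hγ₂, hp₁, hp₂, hγ⟩ := hγ _ hM
  -- logarithms of the two loops in the chart
  have lift : ∀ γ : ℝ → Y, Continuous γ → γ (2 * Real.pi) = γ 0 →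
      (∀ t, γ t ∈ e.source ∩ e ⁻¹' ball (e y₀) δ ∧ γ t ≠ y₀) →
      ∃ (g : ℝ → ℂ) (a : ℤ), Continuous g ∧ (∀ t, Complex.exp (g t) ∈ ball (0 : ℂ) δ) ∧
      g (2 * Real.pi) = g 0 + 2 * Real.pi * Complex.I * a ∧
      ∀ t, e.symm (e y₀ + Complex.exp (g t)) = γ t := by
    intro γ hγc hγp hγM
    have hcont : Continuous fun t => e (γ t) - e y₀ :=
      (e.continuousOn.comp_continuous hγc fun t => (hγM t).1.1).sub continuous_const
    obtain ⟨g, hg, hge⟩ := exists_log_of_convex (E := ℝ) convex_univ univ_nonempty isOpen_univ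
      hcont.continuousOn (fun t _ => sub_ne_zero.2 fun h =>
        (hγM t).2 (e.injOn (hγM t).1.1 hy₀ h))
    have hge' : ∀ t, Complex.exp (g t) = e (γ t) - e y₀ := fun t => hge t (mem_univ t)
    obtain ⟨a, ha⟩ := Complex.exp_eq_exp_iff_exists_int.1
      (show Complex.exp (g (2 * Real.pi)) = Complex.exp (g 0) by rw [hge', hge', hγp])
    refine ⟨g, a, continuousOn_univ.1 hg, fun t => ?_, by rw [ha]; ring, fun t => ?_⟩
    · rw [hge', mem_ball_zero_iff, ← dist_eq_norm]; exact (hγM t).1.2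
    · rw [hge', add_sub_cancel, e.left_inv (hγM t).1.1]
  obtain ⟨g₁, a, hg₁, hb₁, ha, hs₁⟩ := lift γ₁ hγ₁ hp₁ fun t => ⟨(hγ t).1, (hγ t).2.1⟩
  obtain ⟨g₂, b, hg₂, hb₂, hb, hs₂⟩ := lift γ₂ hγ₂ hp₂ fun t => ⟨(hγ t).2.2.1, (hγ t).2.2.2.1⟩
  have hπ : (2 * Real.pi * Complex.I : ℂ) ≠ 0 := Complex.two_pi_I_ne_zero
  have hr' : (r : ℂ) ≠ 0 := by exact_mod_cast hr.ne'
  -- a function winding once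
  have one : ∀ (G : ℝ → ℂ) (m : ℤ), Continuous G →
      (∀ t : ℝ, Complex.exp (G t) = r * Complex.exp (t * Complex.I)) →
      G (2 * Real.pi) = G 0 + 2 * Real.pi * Complex.I * m → m = 1 := by
    intro G m hG hGe hGm
    have h1 := sub_eq_sub_of_exp_eq hG
      (G := fun t : ℝ => Complex.log r + t * Complex.I) (by fun_prop)
      (fun t => by rw [hGe, Complex.exp_add, Complex.exp_log hr']) (2 * Real.pi) 0
    simp only [hGm] at h1
    push_cast at h1
    have h2 : (2 * Real.pi * Complex.I : ℂ) * m = 2 * Real.pi * Complex.I * 1 := by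
      linear_combination h1
    exact_mod_cast mul_left_cancel₀ hπ h2
  -- a function with values in a half-plane
  have zero : ∀ (G : ℝ → ℂ) (m : ℤ), Continuous G →
      (∀ t : ℝ, Complex.exp (G t) = r * (Real.cos t - Complex.I * |Real.sin t|)) →
      G (2 * Real.pi) = G 0 + 2 * Real.pi * Complex.I * m → m = 0 := by
    intro G m hG hGe hGm
    have hsl : ∀ t : ℝ, (|Real.sin t| + Complex.I * Real.cos t : ℂ) ∈ Complex.slitPlane := by
      intro t
      rw [Complex.mem_slitPlane_iff]
      by_cases h : Real.sin t = 0
      · right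
        have := Real.sin_sq_add_cos_sq t
        rw [h] at this
        simp only [Complex.add_im, Complex.ofReal_im, Complex.mul_im, Complex.I_re, Complex.I_im,
          Complex.ofReal_re]
        intro h'
        have h3 : Real.cos t = 0 := by linarith
        rw [h3] at this; norm_num at this
      · left
        simp [h]
    have hne : ∀ t : ℝ, (|Real.sin t| + Complex.I * Real.cos t : ℂ) ≠ 0 := fun t =>
      Complex.slitPlane_ne_zero (hsl t)
    have hcont : Continuous fun t : ℝ =>
        Complex.log (-Complex.I * r) + Complex.log (|Real.sin t| + Complex.I * Real.cos t) := by
      refine continuous_const.add (Continuous.clog ?_ hsl)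
      have h1 : Continuous fun t : ℝ => |Real.sin t| := by fun_prop
      have h2 : Continuous fun t : ℝ => Real.cos t := by fun_prop
      fun_prop
    have h1 := sub_eq_sub_of_exp_eq hG hcont
      (fun t => by
        rw [hGe, Complex.exp_add, Complex.exp_log (by simp [hr.ne']), Complex.exp_log (hne t)]
        linear_combination (r * Real.cos t : ℂ) * Complex.I_sq) (2 * Real.pi) 0
    simp only [hGm, Real.sin_two_pi, Real.cos_two_pi, Real.sin_zero, Real.cos_zero] at h1
    have h2 : (2 * Real.pi * Complex.I : ℂ) * m = 2 * Real.pi * Complex.I * 0 := by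
      linear_combination h1
    exact_mod_cast mul_left_cancel₀ hπ h2
  obtain ⟨G, hG, hGe, hGm⟩ := hk₁ g₁ a hg₁ hb₁ ha
  have e1 := one G _ hG (fun t => by rw [hGe, hs₁, (hγ t).2.2.2.2.1]) hGm
  obtain ⟨G, hG, hGe, hGm⟩ := hk₁ g₂ b hg₂ hb₂ hb
  have e2 := zero G _ hG (fun t => by rw [hGe, hs₂, (hγ t).2.2.2.2.2.2.1]) hGm
  obtain ⟨G, hG, hGe, hGm⟩ := hk₂ g₂ b hg₂ hb₂ hb
  have e3 := one G _ hG (fun t => by rw [hGe, hs₂, (hγ t).2.2.2.2.2.2.2]) hGm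
  rcases mul_eq_zero.1 e2 with h | h
  · rw [h, zero_mul] at e1; exact zero_ne_one e1
  · rw [h, mul_zero] at e3; exact zero_ne_one e3

/-! ### Topology of polyhedra -/

theorem subset_or_disjoint_of_disjoint_frontier {S P : Set E3} (hS : IsPreconnected S)
    (h : ∀ x ∈ S, x ∉ frontier P) : S ⊆ P ∨ ∀ x ∈ S, x ∉ P := by
  by_contra hcon
  push Not at hcon
  obtain ⟨h1, x, hxS, hxP⟩ := hcon
  obtain ⟨y, hyS, hyP⟩ := not_subset.1 h1
  have hmem : ∀ z ∈ S, z ∈ P → z ∈ interior P := fun z hz hzP => by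
    by_contra hi
    exact h z hz ⟨subset_closure hzP, hi⟩
  have hmem' : ∀ z ∈ S, z ∉ P → z ∈ (closure P)ᶜ := fun z hz hzP hc =>
    h z hz ⟨hc, fun hi => hzP (interior_subset hi)⟩
  obtain ⟨z, -, hz1, hz2⟩ := hS _ _ isOpen_interior isClosed_closure.isOpen_compl
    (fun z hz => by
      by_cases hzP : z ∈ P
      · exact Or.inl (hmem z hz hzP)
      · exact Or.inr (hmem' z hz hzP))
    ⟨x, hxS, hmem x hxS hxP⟩ ⟨y, hyS, hmem' y hyS hyP⟩
  exact hz2 (subset_closure (interior_subset hz1))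

theorem exists_isOpen_subset_of_cover {ι : Type*} (J : Finset ι) (Z : ι → Set E3)
    (hZ : ∀ j ∈ J, IsClosed (Z j)) (S U : Set E3) (hU : IsOpen U) (hne : (S ∩ U).Nonempty)
    (hcov : S ∩ U ⊆ ⋃ j ∈ J, Z j) :
    ∃ j ∈ J, ∃ V ⊆ U, IsOpen V ∧ (S ∩ V).Nonempty ∧ S ∩ V ⊆ Z j := by
  classical
  induction J using Finset.induction_on generalizing U with
  | empty =>
    obtain ⟨x, hx⟩ := hne
    simpa using hcov hx
  | insert j J hj ih =>
    by_cases h : (S ∩ (U \ Z j)).Nonempty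
    · obtain ⟨j', hj', V, hVU, hV, hne', hsub⟩ := ih (fun j' hj' => hZ j' (by simp [hj'])) (U \ Z j)
        (hU.sdiff (hZ j (by simp))) h (fun x hx => by
          have h1 := hcov ⟨hx.1, hx.2.1⟩
          simp only [Finset.mem_insert, iUnion_iUnion_eq_or_left, mem_union] at h1
          exact h1.resolve_left hx.2.2)
      exact ⟨j', by simp [hj'], V, hVU.trans sdiff_subset, hV, hne', hsub⟩
    · refine ⟨j, by simp, U, subset_rfl, hU, hne, fun x hx => ?_⟩
      by_contra hxj
      exact h ⟨x, hx.1, hx.2, hxj⟩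

/-- If the boundary of a regular closed set is contained in a plane near a boundary point, then the
set is a half-space there. -/
theorem half_ball {P : Set E3} (hc : IsClosed P) (hr : P ⊆ closure (interior P)) {n : E3}
    (hn : n ≠ 0) {c : ℝ} {q : E3} (hq : q ∈ frontier P) {ρ : ℝ} (hρ : 0 < ρ)
    (h : ∀ x ∈ ball q ρ, x ∈ frontier P → x ∈ plane n c) :
    ∃ s : ℝ, (s = 1 ∨ s = -1) ∧ ∀ x ∈ ball q ρ, (x ∈ P ↔ 0 ≤ s * (inner ℝ n x - c)) := by
  have side : ∀ s : ℝ, (s = 1 ∨ s = -1) →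
      (∀ x ∈ ball q ρ, 0 < s * (inner ℝ n x - c) → x ∈ P) ∨
      (∀ x ∈ ball q ρ, 0 < s * (inner ℝ n x - c) → x ∉ P) := by
    intro s hs
    have hconv : Convex ℝ (ball q ρ ∩ {x | 0 < s * (inner ℝ n x - c)}) := by
      refine (convex_ball q ρ).inter ?_
      intro x hx y hy a b ha hb hab
      simp only [mem_ofPred_eq, inner_add_right, inner_smul_right] at *
      rcases ha.eq_or_lt with rfl | ha
      · obtain rfl : b = 1 := by linarith
        simpa using hy
      · have : s * (a * inner ℝ n x + b * inner ℝ n y - c) =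
            a * (s * (inner ℝ n x - c)) + b * (s * (inner ℝ n y - c)) := by
          rw [show c = (a + b) * c by rw [hab, one_mul]]
          linear_combination (s * c * (a + b)) * hab
        rw [this]
        have := mul_pos ha hx
        have := mul_nonneg hb hy.le
        linarith
    rcases subset_or_disjoint_of_disjoint_frontier (P := P) hconv.isPreconnected
      (fun x hx hxf => by
        have h1 := h x hx.1 hxf
        have h2 := hx.2
        rw [mem_plane] at h1
        simp [h1] at h2) with h1 | h1
    · exact Or.inl fun x hx hx' => h1 ⟨hx, hx'⟩
    · exact Or.inr fun x hx hx' => h1 x ⟨hx, hx'⟩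
  -- points of the plane inside the ball are approximated from either side
  have move : ∀ x ∈ ball q ρ, ∀ U ∈ 𝓝 x, ∀ s : ℝ, (s = 1 ∨ s = -1) → 0 ≤ s * (inner ℝ n x - c) →
      ∃ y ∈ U, y ∈ ball q ρ ∧ 0 < s * (inner ℝ n y - c) := by
    intro x hx U hU s hs hxs
    have hcont : ContinuousAt (fun t : ℝ => x + (t * s) • n) 0 := by fun_prop
    have hU' : U ∩ ball q ρ ∈ 𝓝 (x + ((0 : ℝ) * s) • n) := by
      simpa using inter_mem hU (isOpen_ball.mem_nhds hx)
    have h1 := hcont hU'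
    rw [mem_map, Metric.mem_nhds_iff] at h1
    obtain ⟨t, ht, h1⟩ := h1
    have h2 := h1 (show t / 2 ∈ ball (0 : ℝ) t by
      rw [mem_ball_zero_iff, Real.norm_eq_abs, abs_of_pos (by positivity)]; linarith)
    refine ⟨_, h2.1, h2.2, ?_⟩
    have h3 : 0 < inner ℝ n n := real_inner_self_pos.2 hn
    have hs2 : s * s = 1 := by rcases hs with rfl | rfl <;> norm_num
    rw [inner_add_right, inner_smul_right]
    have : s * (inner ℝ n x + t / 2 * s * inner ℝ n n - c) =
      s * (inner ℝ n x - c) + t / 2 * inner ℝ n n * (s * s) := by ring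
    rw [this, hs2]
    have : 0 < t / 2 * inner ℝ n n := by positivity
    linarith
  have out : ∀ s : ℝ, (s = 1 ∨ s = -1) →
      (∀ x ∈ ball q ρ, 0 < s * (inner ℝ n x - c) → x ∉ P) →
      (∀ x ∈ ball q ρ, 0 < -s * (inner ℝ n x - c) → x ∈ P) →
      ∀ x ∈ ball q ρ, (x ∈ P ↔ 0 ≤ -s * (inner ℝ n x - c)) := by
    intro s hs h1 h2 x hx
    constructor
    · intro hxP
      by_contra hneg
      exact h1 x hx (by linarith) hxP
    · intro hxs
      by_contra hxP
      obtain ⟨y, hyU, hy, hys⟩ := move x hx Pᶜ (hc.isOpen_compl.mem_nhds hxP) (-s)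
        (by rcases hs with rfl | rfl <;> simp) hxs
      exact hyU (h2 y hy hys)
  have hqb : q ∈ ball q ρ := mem_ball_self hρ
  have hqn : inner ℝ n q = c := h q hqb hq
  rcases side 1 (Or.inl rfl) with h1 | h1 <;> rcases side (-1) (Or.inr rfl) with h2 | h2
  · exfalso
    refine hq.2 (mem_interior.2 ⟨ball q ρ, fun x hx => ?_, isOpen_ball, hqb⟩)
    by_contra hxP
    rcases le_total 0 (inner ℝ n x - c) with h3 | h3
    · obtain ⟨y, hyU, hy, hys⟩ := move x hx Pᶜ (hc.isOpen_compl.mem_nhds hxP) 1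
        (Or.inl rfl) (by linarith)
      exact hyU (h1 y hy hys)
    · obtain ⟨y, hyU, hy, hys⟩ := move x hx Pᶜ (hc.isOpen_compl.mem_nhds hxP) (-1)
        (Or.inr rfl) (by linarith)
      exact hyU (h2 y hy hys)
  · exact ⟨1, Or.inl rfl, fun x hx => by
      simpa using out (-1) (Or.inr rfl) h2 (by simpa using h1) x hx⟩
  · exact ⟨-1, Or.inr rfl, out 1 (Or.inl rfl) h1 h2⟩
  · exfalso
    have hqP : q ∈ P := by rw [← hc.closure_eq]; exact hq.1
    obtain ⟨x, hx, hxi⟩ := mem_closure_iff.1 (hr hqP) _ isOpen_ball hqb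
    have h3 : inner ℝ n x - c = 0 := by
      by_contra hne
      rcases lt_or_gt_of_ne hne with h3 | h3
      · exact h2 x hx (by linarith) (interior_subset hxi)
      · exact h1 x hx (by linarith) (interior_subset hxi)
    obtain ⟨y, hyU, hy, hys⟩ := move x hx (interior P) (isOpen_interior.mem_nhds hxi) 1
      (Or.inl rfl) (by linarith)
    exact h1 y hy hys (interior_subset hyU)

theorem exists_flat_point {P : Set E3} (hc : IsClosed P) (hr : P ⊆ closure (interior P))
    (J : Finset (E3 × ℝ)) (hJ : ∀ j ∈ J, j.1 ≠ 0) {U : Set E3} (hU : IsOpen U)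
    (hne : (frontier P ∩ U).Nonempty) (hcov : frontier P ∩ U ⊆ ⋃ j ∈ J, plane j.1 j.2) :
    ∃ j ∈ J, ∃ q ∈ U, q ∈ flatPart P j.1 j.2 := by
  obtain ⟨j, hj, V, hVU, hV, ⟨q, hqf, hqV⟩, hsub⟩ := exists_isOpen_subset_of_cover J
    (fun j => plane j.1 j.2) (fun j _ => isClosed_plane _ _) _ _ hU hne hcov
  obtain ⟨ρ, hρ, hball⟩ := Metric.isOpen_iff.1 hV q hqV
  obtain ⟨s, hs, hP⟩ := half_ball hc hr (hJ j hj) hqf hρ fun x hx hxf => hsub ⟨hxf, hball hx⟩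
  refine ⟨j, hj, q, hVU hqV, hsub ⟨hqf, hqV⟩, ρ, hρ, fun x hx hd => ?_⟩
  rw [mem_plane] at hx
  refine ⟨subset_closure ((hP x hd).2 (by simp [hx])), fun hxi => ?_⟩
  -- a point of the ball just beyond the plane
  have hcont : ContinuousAt (fun t : ℝ => x - (t * s) • j.1) 0 := by fun_prop
  have hU' : interior P ∩ ball q ρ ∈ 𝓝 (x - ((0 : ℝ) * s) • j.1) := by
    simpa using inter_mem (isOpen_interior.mem_nhds hxi) (isOpen_ball.mem_nhds hd)
  have h1 := hcont hU'
  rw [mem_map, Metric.mem_nhds_iff] at h1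
  obtain ⟨t, ht, h1⟩ := h1
  have h2 := h1 (show t / 2 ∈ ball (0 : ℝ) t by
    rw [mem_ball_zero_iff, Real.norm_eq_abs, abs_of_pos (by positivity)]; linarith)
  have h4 := (hP _ h2.2).1 (interior_subset h2.1)
  have h3 : 0 < inner ℝ j.1 j.1 := real_inner_self_pos.2 (hJ j hj)
  have hs2 : s * s = 1 := by rcases hs with rfl | rfl <;> norm_num
  rw [inner_sub_right, inner_smul_right, hx] at h4
  have : s * (j.2 - t / 2 * s * inner ℝ j.1 j.1 - j.2) = -(t / 2 * inner ℝ j.1 j.1) * (s * s) := by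
    ring
  rw [this, hs2] at h4
  have : 0 < t / 2 * inner ℝ j.1 j.1 := by positivity
  linarith

/-- A non-constant affine functional vanishes on a plane. -/
theorem exists_plane_of_affineMap (l : E3 →ᵃ[ℝ] ℝ) {x y : E3} (hxy : l x ≠ l y) :
    ∃ n : E3, n ≠ 0 ∧ ∃ c : ℝ, ∀ z, l z = 0 → z ∈ plane n c := by
  set f : E3 →L[ℝ] ℝ := LinearMap.toContinuousLinearMap l.linear with hf
  set n := (InnerProductSpace.toDual ℝ E3).symm f with hn
  have hnf : ∀ z, inner ℝ n z = l.linear z := fun z => by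
    rw [hn, InnerProductSpace.toDual_symm_apply]; rfl
  refine ⟨n, ?_, -l 0, fun z hz => ?_⟩
  · intro h0
    have h1 := hnf (x - y)
    rw [h0, inner_zero_left] at h1
    have h2 := l.linearMap_vsub x y
    rw [vsub_eq_sub, vsub_eq_sub] at h2
    exact hxy (by linarith)
  · rw [mem_plane, hnf]
    have h2 := l.linearMap_vsub z 0
    rw [vsub_eq_sub, vsub_eq_sub, sub_zero, hz] at h2
    linarith

theorem IsTetrahedron.properties {T : Set E3} (hT : IsTetrahedron T) :
    IsCompact T ∧ T ⊆ closure (interior T) ∧ ∃ J : Finset (E3 × ℝ), (∀ j ∈ J, j.1 ≠ 0) ∧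
      frontier T ⊆ ⋃ j ∈ J, plane j.1 j.2 := by
  classical
  obtain ⟨v, hv, rfl⟩ := hT
  have hcomp : IsCompact (convexHull ℝ (range v)) := (finite_range v).isCompact_convexHull ℝ
  have htop : affineSpan ℝ (range v) = ⊤ := by
    rw [hv.affineSpan_eq_top_iff_card_eq_finrank_add_one]; simp
  let B : AffineBasis (Fin 4) ℝ E3 := ⟨v, hv, htop⟩
  have hint := B.interior_convexHull
  have hnn := B.convexHull_eq_nonneg_coord
  have hne : (interior (convexHull ℝ (range v))).Nonempty :=
    interior_convexHull_nonempty_iff_affineSpan_eq_top.2 htop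
  refine ⟨hcomp, ?_, ?_⟩
  · rw [(convex_convexHull ℝ _).closure_interior_eq_closure_of_nonempty_interior hne]
    exact subset_closure
  · have hp : ∀ i : Fin 4, ∃ n : E3, n ≠ 0 ∧ ∃ c : ℝ, ∀ z, B.coord i z = 0 → z ∈ plane n c := by
      intro i
      refine exists_plane_of_affineMap _ (x := B i) (y := B (i + 1)) ?_
      rw [B.coord_apply_eq, B.coord_apply_ne (by fin_cases i <;> decide)]
      exact one_ne_zero
    choose n hn c hc using hp
    refine ⟨Finset.univ.image fun i => (n i, c i), ?_, ?_⟩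
    · intro j hj
      obtain ⟨i, -, rfl⟩ := Finset.mem_image.1 hj
      exact hn i
    · intro x hx
      have hxT : x ∈ convexHull ℝ (range v) := by
        rw [← hcomp.isClosed.closure_eq]; exact hx.1
      have h1 : ∀ i, 0 ≤ B.coord i x := by
        have : x ∈ convexHull ℝ (range B) := hxT
        rw [hnn] at this; exact this
      have h2 : ¬ ∀ i, 0 < B.coord i x := by
        intro h
        have : x ∈ interior (convexHull ℝ (range B)) := by rw [hint]; exact h
        exact hx.2 this
      push Not at h2
      obtain ⟨i, hi⟩ := h2
      simp only [mem_iUnion]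
      exact ⟨(n i, c i), Finset.mem_image_of_mem _ (Finset.mem_univ i),
        hc i x (le_antisymm hi (h1 i))⟩

theorem IsPolyhedron.isCompact {P : Set E3} (hP : IsPolyhedron P) : IsCompact P := by
  obtain ⟨𝒯, hfin, hT, rfl⟩ := hP.tetrahedra
  exact hfin.isCompact_sUnion fun T h => (hT T h).properties.1

theorem IsPolyhedron.subset_closure_interior {P : Set E3} (hP : IsPolyhedron P) :
    P ⊆ closure (interior P) := by
  obtain ⟨𝒯, hfin, hT, rfl⟩ := hP.tetrahedra
  rintro x ⟨T, hTm, hx⟩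
  exact closure_mono (interior_mono (subset_sUnion_of_mem hTm)) ((hT T hTm).properties.2.1 hx)

theorem IsPolyhedron.exists_planes {P : Set E3} (hP : IsPolyhedron P) :
    ∃ J : Finset (E3 × ℝ), (∀ j ∈ J, j.1 ≠ 0) ∧ frontier P ⊆ ⋃ j ∈ J, plane j.1 j.2 := by
  classical
  have hcl := hP.isCompact.isClosed
  obtain ⟨𝒯, hfin, hT, rfl⟩ := hP.tetrahedra
  choose! J hJ0 hJ using fun T h => (hT T h).properties.2.2
  refine ⟨hfin.toFinset.biUnion J, ?_, ?_⟩
  · intro j hj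
    obtain ⟨T, hTm, hj⟩ := Finset.mem_biUnion.1 hj
    exact hJ0 T (hfin.mem_toFinset.1 hTm) j hj
  · intro x hx
    have hxP := hx.1
    rw [hcl.closure_eq] at hxP
    obtain ⟨T, hTm, hxT⟩ := hxP
    have hxf : x ∈ frontier T := ⟨subset_closure hxT, fun hi =>
      hx.2 (interior_mono (subset_sUnion_of_mem hTm) hi)⟩
    have h1 := hJ T hTm hxf
    simp only [mem_iUnion] at h1 ⊢
    obtain ⟨j, hj, hxj⟩ := h1
    exact ⟨j, Finset.mem_biUnion.2 ⟨T, hfin.mem_toFinset.2 hTm, hj⟩, hxj⟩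

theorem plane_eq_of_le {n m : E3} (hn : n ≠ 0) (hm : m ≠ 0) {c d : ℝ} {p : E3}
    (hp : p ∈ plane n c) (hp' : p ∈ plane m d) (h : (ℝ ∙ n)ᗮ ≤ (ℝ ∙ m)ᗮ) :
    plane n c = plane m d := by
  have heq := Submodule.eq_of_le_of_finrank_eq h
    (by rw [finrank_orthogonal hn, finrank_orthogonal hm])
  ext x
  have h1 : x - p ∈ (ℝ ∙ n)ᗮ ↔ x - p ∈ (ℝ ∙ m)ᗮ := by rw [heq]
  rw [Submodule.mem_orthogonal_singleton_iff_inner_right,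
    Submodule.mem_orthogonal_singleton_iff_inner_right, inner_sub_right, inner_sub_right,
    sub_eq_zero, sub_eq_zero] at h1
  rw [mem_plane] at *
  rw [hp, hp'] at h1
  exact h1

/-- If near some point a plane is contained in another one, the two planes coincide. -/
theorem plane_eq_of_local {n m : E3} (hn : n ≠ 0) (hm : m ≠ 0) {c d : ℝ} {p : E3}
    (hp : p ∈ planeInterior n c (plane m d)) : plane n c = plane m d := by
  have hpm := planeInterior_subset _ _ _ hp
  refine plane_eq_of_le hn hm hp.1 hpm ?_
  have h1 : (planeInterior n c (plane m d ∩ plane n c)).Nonempty := by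
    obtain ⟨hpn, ε, hε, h⟩ := hp
    exact ⟨p, hpn, ε, hε, fun q hq hd => ⟨h q hq hd, hq⟩⟩
  rw [← vectorSpan_eq_orthogonal inter_subset_right h1]
  exact vectorSpan_le_orthogonal inter_subset_left

theorem flatPart_congr {n m : E3} {c d : ℝ} (h : plane n c = plane m d) (P : Set E3) :
    flatPart P n c = flatPart P m d := by
  unfold flatPart planeInterior
  rw [h]

/-- In an orthogonal polyhedron only coordinate planes have flat points. -/
theorem exists_axis_of_flat {P : Set E3} {b : OrthonormalBasis (Fin 3) ℝ E3}
    (hb : ∀ F ∈ faces P, ∃ i : Fin 3, ∀ x ∈ F, ∀ y ∈ F, inner ℝ (b i) (y - x) = 0)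
    {n : E3} (hn : n ≠ 0) {c : ℝ} {p : E3} (hp : p ∈ flatPart P n c) :
    ∃ i, plane n c = plane (b i) (inner ℝ (b i) p) := by
  obtain ⟨i, hi⟩ := hb _ (closure_component_mem_faces hn hp)
  have hpC : p ∈ connectedComponentIn (flatPart P n c) p := mem_connectedComponentIn hp
  refine ⟨i, plane_eq_of_local (p := p) hn (b.toBasis.ne_zero i |> fun h => by simpa using h) ?_⟩
  refine planeInterior_mono ?_ (component_subset_planeInterior P n c p hpC)
  intro x hx
  have := hi p (subset_closure hpC) x (subset_closure hx)
  rw [inner_sub_right, sub_eq_zero] at this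
  exact this

/-- The boundary of an orthogonal polyhedron lies in finitely many coordinate planes. -/
theorem IsPolyhedron.exists_grid {P : Set E3} (hP : IsPolyhedron P)
    {b : OrthonormalBasis (Fin 3) ℝ E3}
    (hb : ∀ F ∈ faces P, ∃ i : Fin 3, ∀ x ∈ F, ∀ y ∈ F, inner ℝ (b i) (y - x) = 0) :
    ∃ C : Finset ℝ, ∀ p ∈ frontier P, ∃ i, b.repr p i ∈ C := by
  classical
  obtain ⟨J, hJ0, hJ⟩ := hP.exists_planes
  set A : Finset (E3 × ℝ) := J.filter fun j => ∃ i d, plane j.1 j.2 = plane (b i) d with hA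
  have hcov : frontier P ⊆ ⋃ j ∈ A, plane j.1 j.2 := by
    by_contra hcon
    obtain ⟨p, hpf, hpA⟩ := not_subset.1 hcon
    have hcl : IsClosed (⋃ j ∈ A, plane j.1 j.2) :=
      A.finite_toSet.isClosed_biUnion fun j _ => isClosed_plane _ _
    obtain ⟨j, hj, q, hqU, hq⟩ := exists_flat_point hP.isCompact.isClosed
      hP.subset_closure_interior J hJ0 hcl.isOpen_compl ⟨p, hpf, hpA⟩
      (inter_subset_left.trans hJ)
    obtain ⟨i, hi⟩ := exists_axis_of_flat hb (hJ0 j hj) hq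
    refine hqU ?_
    simp only [mem_iUnion]
    exact ⟨j, by simpa [hA, hj] using ⟨i, _, hi⟩, hq.1⟩
  have hch : ∀ j : E3 × ℝ, ∃ d : ℝ, j ∈ A → ∃ i, plane j.1 j.2 = plane (b i) d := by
    intro j
    by_cases hj : j ∈ A
    · obtain ⟨i, d, h⟩ := (Finset.mem_filter.1 hj).2
      exact ⟨d, fun _ => ⟨i, h⟩⟩
    · exact ⟨0, fun h => absurd h hj⟩
  choose d hd using hch
  refine ⟨A.image d, fun p hp => ?_⟩
  have h1 := hcov hp
  simp only [mem_iUnion] at h1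
  obtain ⟨j, hj, hpj⟩ := h1
  obtain ⟨i, hi⟩ := hd j hj
  rw [hi, mem_plane] at hpj
  refine ⟨i, ?_⟩
  rw [b.repr_apply_apply, hpj]
  exact Finset.mem_image_of_mem d hj

/-! ### Local structure of grid polyhedra -/

/-- The point with coordinates `v` in the orthonormal basis `b`. -/
noncomputable def ofCoords (b : OrthonormalBasis (Fin 3) ℝ E3) (v : Fin 3 → ℝ) : E3 :=
  b.repr.symm (WithLp.toLp 2 v)

@[simp] theorem repr_ofCoords (b : OrthonormalBasis (Fin 3) ℝ E3) (v : Fin 3 → ℝ) (i : Fin 3) :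
    b.repr (ofCoords b v) i = v i := by simp [ofCoords]

theorem ext_coords (b : OrthonormalBasis (Fin 3) ℝ E3) {p q : E3}
    (h : ∀ i, b.repr p i = b.repr q i) : p = q :=
  b.repr.injective (PiLp.ext h)

theorem continuous_repr (b : OrthonormalBasis (Fin 3) ℝ E3) (i : Fin 3) :
    Continuous fun q => b.repr q i := by
  have : Continuous fun q => b.repr q := b.repr.continuous
  fun_prop

theorem continuous_ofCoords (b : OrthonormalBasis (Fin 3) ℝ E3) : Continuous (ofCoords b) :=
  b.repr.symm.continuous.comp (PiLp.continuous_toLp 2 _)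

/-- Coordinate boxes form a neighbourhood basis. -/
theorem eventually_nhds_iff_box (b : OrthonormalBasis (Fin 3) ℝ E3) {p : E3} {φ : E3 → Prop} :
    (∀ᶠ q in 𝓝 p, φ q) ↔ ∃ ε > 0, ∀ q, (∀ j, |b.repr q j - b.repr p j| < ε) → φ q := by
  constructor
  · intro h
    obtain ⟨r, hr, h⟩ := Metric.eventually_nhds_iff.1 h
    refine ⟨r / 2, by positivity, fun q hq => h ?_⟩
    rw [← b.repr.dist_map, EuclideanSpace.dist_eq, Real.sqrt_lt' hr, Fin.sum_univ_three]
    have hj : ∀ j, dist (b.repr q j) (b.repr p j) ^ 2 ≤ (r / 2) ^ 2 := fun j => by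
      rw [Real.dist_eq]
      exact pow_le_pow_left₀ (abs_nonneg _) (hq j).le 2
    nlinarith [hj 0, hj 1, hj 2]
  · rintro ⟨ε, hε, h⟩
    have : ∀ᶠ q in 𝓝 p, ∀ j, |b.repr q j - b.repr p j| < ε := by
      rw [eventually_all]
      intro j
      have hc : Continuous fun q => |b.repr q j - b.repr p j| :=
        ((continuous_repr b j).sub continuous_const).abs
      have := hc.tendsto p
      simp only [sub_self, abs_zero] at this
      exact this.eventually_lt_const hε
    exact this.mono h

/-- `P` is, near `p`, the half-space of the points whose `i`-th coordinate is at least `c`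
(if `s = 1`) or at most `c` (if `s = -1`). -/
def HalfSpaceAt (b : OrthonormalBasis (Fin 3) ℝ E3) (P : Set E3) (i : Fin 3) (s c : ℝ) (p : E3) :
    Prop := ∀ᶠ q in 𝓝 p, (q ∈ P ↔ 0 ≤ s * (b.repr q i - c))

/-- The sign encoded by a truth value. -/
def sgn (a : Bool) : ℝ := if a then 1 else -1

@[simp] theorem sgn_true : sgn true = 1 := rfl
@[simp] theorem sgn_false : sgn false = -1 := rfl

theorem sgn_mul_self (a : Bool) : sgn a * sgn a = 1 := by cases a <;> norm_num

/-- A point can be moved slightly in the direction of any octant. -/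
theorem exists_move (b : OrthonormalBasis (Fin 3) ℝ E3) {q : E3} {φ : E3 → Prop}
    (h : ∀ᶠ q' in 𝓝 q, φ q') (v : Fin 3 → ℝ) :
    ∃ t₀ > 0, ∀ t, 0 < t → t < t₀ → φ (ofCoords b fun l => b.repr q l + t * v l) := by
  have hc : Continuous fun t : ℝ => ofCoords b fun l => b.repr q l + t * v l :=
    (continuous_ofCoords b).comp (by fun_prop)
  have h0 : (ofCoords b fun l => b.repr q l + 0 * v l) = q := ext_coords b fun i => by simp
  have h1 := hc.tendsto 0
  rw [h0] at h1
  obtain ⟨r, hr, h2⟩ := Metric.eventually_nhds_iff.1 (h1 h)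
  exact ⟨r, hr, fun t ht htr => h2 (by rwa [Real.dist_eq, sub_zero, abs_of_pos ht])⟩

/-- Boxes that avoid the grid are inside or outside. -/
theorem box_subset_or_disjoint {b : OrthonormalBasis (Fin 3) ℝ E3} {P : Set E3} {C : Finset ℝ}
    (hC : ∀ p ∈ frontier P, ∃ i, b.repr p i ∈ C) {J : Fin 3 → Set ℝ} (hJ : ∀ l, Convex ℝ (J l))
    (hJC : ∀ l, ∀ t ∈ J l, t ∉ C) :
    (∀ q, (∀ l, b.repr q l ∈ J l) → q ∈ P) ∨ (∀ q, (∀ l, b.repr q l ∈ J l) → q ∉ P) := by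
  have hconv : Convex ℝ {q : E3 | ∀ l, b.repr q l ∈ J l} := by
    intro x hx y hy α β hα hβ hαβ l
    have := hJ l (hx l) (hy l) hα hβ hαβ
    simpa using this
  exact subset_or_disjoint_of_disjoint_frontier hconv.isPreconnected fun x hx hxf => by
    obtain ⟨i, hi⟩ := hC x hxf
    exact hJC i _ (hx i) hi

theorem exists_gap (C : Finset ℝ) (a : ℝ) :
    ∃ ε > 0, ∀ t, |t - a| < ε → t ≠ a → t ∉ C := by
  have h : ((C.erase a : Finset ℝ) : Set ℝ)ᶜ ∈ 𝓝 a :=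
    (C.erase a).finite_toSet.isClosed.isOpen_compl.mem_nhds (by simp)
  obtain ⟨ε, hε, h⟩ := Metric.mem_nhds_iff.1 h
  refine ⟨ε, hε, fun t ht hta htC => ?_⟩
  exact h (show t ∈ ball a ε by rwa [mem_ball, Real.dist_eq]) (by simp [hta, htC])

theorem exists_gaps (C : Finset ℝ) (a : Fin 3 → ℝ) :
    ∃ ε > 0, ∀ j t, |t - a j| < ε → t ≠ a j → t ∉ C := by
  choose ε hε h using fun j => exists_gap C (a j)
  refine ⟨min (ε 0) (min (ε 1) (ε 2)), by simp [hε], fun j t ht => h j t (ht.trans_le ?_)⟩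
  fin_cases j <;> simp

/-- Near each point a grid polyhedron is a union of closed octants. -/
theorem exists_octants {b : OrthonormalBasis (Fin 3) ℝ E3} {P : Set E3} (hc : IsClosed P)
    (hr : P ⊆ closure (interior P)) {C : Finset ℝ}
    (hC : ∀ p ∈ frontier P, ∃ i, b.repr p i ∈ C) (p : E3) :
    ∃ ε > 0, (∀ j t, |t - b.repr p j| < ε → t ≠ b.repr p j → t ∉ C) ∧
      ∃ I : Set (Fin 3 → Bool), ∀ q, (∀ j, |b.repr q j - b.repr p j| < ε) →
        (q ∈ P ↔ ∃ σ ∈ I, ∀ l, 0 ≤ sgn (σ l) * (b.repr q l - b.repr p l)) := by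
  obtain ⟨ε, hε, hgap⟩ := exists_gaps C (b.repr p)
  refine ⟨ε, hε, hgap, ?_⟩
  set J : (Fin 3 → Bool) → Fin 3 → Set ℝ := fun σ l =>
    {t | 0 < sgn (σ l) * (t - b.repr p l)} ∩ {t | |t - b.repr p l| < ε} with hJdef
  have hJ : ∀ σ l, Convex ℝ (J σ l) := by
    refine fun σ l => OrdConnected.convex ⟨fun x hx y hy z hz => ?_⟩
    simp only [hJdef, mem_inter_iff, mem_ofPred_eq, abs_lt, mem_Icc] at hx hy hz ⊢
    cases h : σ l <;> simp only [h, sgn_true, sgn_false] at hx hy ⊢ <;>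
      refine ⟨?_, ?_, ?_⟩ <;> linarith
  have hJC : ∀ σ l, ∀ t ∈ J σ l, t ∉ C := by
    rintro σ l t ⟨h1, h2⟩
    refine hgap l t h2 ?_
    rintro rfl
    simp at h1
  set I : Set (Fin 3 → Bool) := {σ | ∀ q, (∀ l, b.repr q l ∈ J σ l) → q ∈ P} with hI
  have hbox : ∀ q, (∀ j, |b.repr q j - b.repr p j| < ε) →
      ∀ᶠ q' in 𝓝 q, ∀ j, |b.repr q' j - b.repr p j| < ε := by
    intro q hq
    rw [eventually_all]
    intro j
    have hcont : Continuous fun q => |b.repr q j - b.repr p j| :=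
      ((continuous_repr b j).sub continuous_const).abs
    exact (hcont.tendsto q).eventually_lt_const (hq j)
  refine ⟨I, fun q hq => ⟨fun hqP => ?_, ?_⟩⟩
  · -- approximate `q` by a generic interior point on the same sides as `q`
    have hside : ∀ᶠ q' in 𝓝 q, ∀ l, (b.repr p l < b.repr q l → b.repr p l < b.repr q' l) ∧
        (b.repr q l < b.repr p l → b.repr q' l < b.repr p l) := by
      rw [eventually_all]
      intro l
      refine ((eventually_imp_distrib_left).2 fun h => ?_).and
        ((eventually_imp_distrib_left).2 fun h => ?_)
      · exact ((continuous_repr b l).tendsto q).eventually_const_lt h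
      · exact ((continuous_repr b l).tendsto q).eventually_lt_const h
    obtain ⟨q', ⟨hq'side, hq'box⟩, hq'int⟩ := mem_closure_iff_nhds.1 (hr hqP) _
      (hside.and (hbox q hq))
    set τ : Fin 3 → Bool := fun l => decide (b.repr p l ≤ b.repr q' l) with hτ
    obtain ⟨t, ht, hmove⟩ := exists_move b
      ((isOpen_interior.eventually_mem hq'int).and (hbox q' hq'box))
      (fun l => sgn (τ l))
    obtain ⟨h1, h2⟩ := hmove (t / 2) (by positivity) (by linarith)
    refine ⟨τ, ?_, fun l => ?_⟩
    · refine (box_subset_or_disjoint hC (hJ τ) (hJC τ)).resolve_right fun hno => ?_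
      refine hno _ (fun l => ⟨?_, h2 l⟩) (interior_subset h1)
      simp only [repr_ofCoords, hτ, mem_ofPred_eq]
      by_cases hle : b.repr p l ≤ b.repr q' l
      · simp only [hle, decide_true, sgn_true]; linarith
      · simp only [hle, decide_false, sgn_false]; linarith
    · simp only [hτ]
      by_cases hle : b.repr p l ≤ b.repr q' l
      · simp only [hle, decide_true, sgn_true]
        by_contra hcon
        have := (hq'side l).2 (by linarith)
        linarith
      · simp only [hle, decide_false, sgn_false]
        by_contra hcon
        have := (hq'side l).1 (by linarith)
        linarith
  · rintro ⟨σ, hσ, hcomp⟩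
    by_contra hqP
    obtain ⟨t, ht, hmove⟩ := exists_move b
      ((hc.isOpen_compl.eventually_mem hqP).and (hbox q hq))
      (fun l => sgn (σ l))
    obtain ⟨h1, h2⟩ := hmove (t / 2) (by positivity) (by linarith)
    refine h1 (hσ _ fun l => ⟨?_, h2 l⟩)
    simp only [repr_ofCoords, mem_ofPred_eq]
    have := hcomp l
    nlinarith [sgn_mul_self (σ l)]

/-! ### Visible boundary points in a given direction -/

/-- Every point of a bounded grid polyhedron sees, in each of the six coordinate directions, a
boundary point near which the polyhedron is a half-space facing that direction. The ray that leaves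
from the centre of a small octant at the point leaves the polyhedron at such a boundary point, and
the column swept by the octant up to that moment belongs to the polyhedron. -/
theorem exists_visible_halfSpaceAt {b : OrthonormalBasis (Fin 3) ℝ E3} {P : Set E3}
    (hcomp : IsCompact P) (hr : P ⊆ closure (interior P)) {C : Finset ℝ}
    (hC : ∀ p ∈ frontier P, ∃ i, b.repr p i ∈ C) {y : E3} (hy : y ∈ P) (i : Fin 3) {s : ℝ}
    (hs : s = 1 ∨ s = -1) :
    ∃ q, HalfSpaceAt b P i (-s) (b.repr q i) q ∧ segment ℝ q y ⊆ P := by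
  have hc := hcomp.isClosed
  have hss : s * s = 1 := by rcases hs with rfl | rfl <;> norm_num
  obtain ⟨ε, hε, hgap, I, hI⟩ := exists_octants hc hr hC y
  obtain ⟨σ, hσ, -⟩ := (hI y (by simpa using hε)).1 hy
  set x := b.repr y with hx
  -- the octant as a product of intervals; the `i`-th one in the coordinate `s * q i`
  obtain ⟨a, ha, haoct⟩ : ∃ a : ℝ, (a = s * x i ∨ a = s * x i - ε) ∧
      ∀ t, a < t → t < a + ε → 0 < sgn (σ i) * (s * t - x i) ∧ |s * t - x i| < ε := by
    rcases hs with rfl | rfl <;> cases h : σ i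
    · exact ⟨_, Or.inr rfl, fun t h1 h2 => ⟨by simp; linarith, abs_lt.2 ⟨by linarith, by linarith⟩⟩⟩
    · exact ⟨_, Or.inl rfl, fun t h1 h2 => ⟨by simp; linarith, abs_lt.2 ⟨by linarith, by linarith⟩⟩⟩
    · exact ⟨_, Or.inl rfl, fun t h1 h2 => ⟨by simp; linarith, abs_lt.2 ⟨by linarith, by linarith⟩⟩⟩
    · exact ⟨_, Or.inr rfl, fun t h1 h2 => ⟨by simp; linarith, abs_lt.2 ⟨by linarith, by linarith⟩⟩⟩
  set K : Fin 3 → Set ℝ := fun l => {t | 0 < sgn (σ l) * (t - x l) ∧ |t - x l| < ε} with hK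
  have hKconv : ∀ l, Convex ℝ (K l) := by
    refine fun l => OrdConnected.convex ⟨fun u hu v hv z hz => ?_⟩
    simp only [hK, mem_ofPred_eq, abs_lt, mem_Icc] at hu hv hz ⊢
    cases h : σ l <;> simp only [h, sgn_true, sgn_false] at hu hv ⊢ <;>
      refine ⟨?_, ?_, ?_⟩ <;> linarith
  have hKC : ∀ l, ∀ t ∈ K l, t ∉ C := by
    rintro l t ⟨h1, h2⟩
    refine hgap l t h2 ?_
    rintro rfl
    simp at h1
  have hKopen : ∀ l, IsOpen (K l) := fun l =>
    (isOpen_lt (g := fun t : ℝ => sgn (σ l) * (t - x l)) continuous_const (by fun_prop)).inter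
      (isOpen_lt (f := fun t : ℝ => |t - x l|) (by fun_prop) continuous_const)
  set m : Fin 3 → ℝ := fun l => x l + sgn (σ l) * (ε / 2) with hm
  have hmK : ∀ l, m l ∈ K l := by
    intro l
    simp only [hK, hm, mem_ofPred_eq, add_sub_cancel_left]
    cases σ l
    · simp only [sgn_false]
      refine ⟨by linarith, ?_⟩
      rw [abs_lt]; constructor <;> linarith
    · simp only [sgn_true]
      refine ⟨by linarith, ?_⟩
      rw [abs_lt]; constructor <;> linarith
  have hoct : ∀ q, (∀ l, l ≠ i → b.repr q l ∈ K l) → a < s * b.repr q i → s * b.repr q i < a + ε →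
      q ∈ P := by
    intro q hq h1 h2
    have h3 := haoct _ h1 h2
    rw [← mul_assoc, hss, one_mul] at h3
    have hall : ∀ l, b.repr q l ∈ K l := by
      intro l
      by_cases hl : l = i
      · subst hl; exact h3
      · exact hq l hl
    exact (hI q fun l => (hall l).2).2 ⟨σ, hσ, fun l => (hall l).1.le⟩
  -- the ray through the centre of the octant
  set L : ℝ → E3 := fun t => ofCoords b fun l => if l = i then s * t else m l with hL
  have hLi : ∀ t, b.repr (L t) i = s * t := fun t => by simp [hL]
  have hLi' : ∀ t, s * b.repr (L t) i = t := fun t => by rw [hLi, ← mul_assoc, hss, one_mul]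
  have hLl : ∀ t l, l ≠ i → b.repr (L t) l = m l := fun t l hl => by simp [hL, hl]
  have hLc : Continuous L := by
    refine (continuous_ofCoords b).comp (continuous_pi fun l => ?_)
    by_cases hl : l = i <;> simp only [hl, if_true, if_false] <;> fun_prop
  have hLK : ∀ t l, l ≠ i → b.repr (L t) l ∈ K l := fun t l hl => by rw [hLl t l hl]; exact hmK l
  set T : Set ℝ := {t | a + ε / 2 ≤ t ∧ L t ∉ P} with hT
  have hTbdd : BddBelow T := ⟨a + ε / 2, fun t ht => ht.1⟩
  have hTne : T.Nonempty := by
    obtain ⟨R, hR⟩ := hcomp.isBounded.exists_norm_le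
    refine ⟨max (a + ε / 2) (R + 1), le_max_left _ _, fun hP => ?_⟩
    have h1 := hR _ hP
    have h2 : ‖b.repr (L (max (a + ε / 2) (R + 1))) i‖ ≤ ‖L (max (a + ε / 2) (R + 1))‖ := by
      rw [← b.repr.norm_map]; exact PiLp.norm_apply_le _ i
    rw [hLi, norm_mul] at h2
    have h3 : ‖s‖ = 1 := by rcases hs with rfl | rfl <;> norm_num
    rw [h3, one_mul, Real.norm_eq_abs] at h2
    have h4 := le_abs_self (max (a + ε / 2) (R + 1))
    have h5 := le_max_right (a + ε / 2) (R + 1)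
    linarith
  set τ := sInf T with hτ
  have hτa : a + ε ≤ τ := by
    refine le_csInf hTne fun t ht => ?_
    by_contra hlt
    exact ht.2 (hoct _ (hLK t) (by rw [hLi']; linarith [ht.1]) (by rw [hLi']; linarith))
  have hbefore : ∀ t, a < t → t < τ → L t ∈ P := by
    intro t h1 h2
    by_contra hP
    rcases lt_or_ge t (a + ε / 2) with h3 | h3
    · exact hP (hoct _ (hLK t) (by rw [hLi']; exact h1) (by rw [hLi']; linarith))
    · exact absurd (csInf_le hTbdd (show t ∈ T from ⟨h3, hP⟩)) (not_le.2 h2)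
  -- the column up to the exit point belongs to `P`
  have hcol : ∀ q, (∀ l, l ≠ i → b.repr q l ∈ K l) → a < s * b.repr q i → s * b.repr q i ≤ τ →
      q ∈ P := by
    have hlt : ∀ q, (∀ l, l ≠ i → b.repr q l ∈ K l) → a < s * b.repr q i → s * b.repr q i < τ →
        b.repr q i ∉ C → q ∈ P := by
      intro q hq h1 h2 h3
      rcases box_subset_or_disjoint hC (J := fun l => if l = i then {b.repr q i} else K l)
        (fun l => by by_cases hl : l = i <;> simp [hl, hKconv])
        (fun l t ht => by
          by_cases hl : l = i
          · simp only [hl, if_true, mem_singleton_iff] at ht; rw [ht]; exact h3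
          · simp only [hl, if_false] at ht; exact hKC l t ht) with h | h
      · refine h q fun l => ?_
        by_cases hl : l = i
        · simp [hl]
        · simp only [hl, if_false]; exact hq l hl
      · refine absurd (hbefore _ h1 h2) (h _ fun l => ?_)
        by_cases hl : l = i
        · simp only [hl, if_true, mem_singleton_iff]
          rw [hLi, ← mul_assoc, hss, one_mul]
        · simp only [hl, if_false]; exact hLK _ l hl
    intro q hq h1 h2
    by_contra hP
    obtain ⟨t₀, ht₀, hmove⟩ := exists_move b (hc.isOpen_compl.eventually_mem hP)
      (fun l => if l = i then -s else 0)
    have hinf : (Ioo 0 (min t₀ (s * b.repr q i - a)) \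
        ((fun t => s * (b.repr q i - t)) '' (C : Set ℝ))).Nonempty :=
      ((Ioo_infinite (lt_min ht₀ (by linarith))).sdiff
        (C.finite_toSet.image _)).nonempty
    obtain ⟨t, ⟨ht1, ht2⟩, ht3⟩ := hinf
    have hi : (b.repr q i + t * -s) = b.repr q i - s * t := by ring
    have hi' : s * (b.repr q i + t * -s) = s * b.repr q i - t := by
      linear_combination -t * hss
    refine hmove t ht1 (ht2.trans_le (min_le_left _ _)) (hlt _ (fun l hl => ?_) ?_ ?_ ?_)
    · simpa [hl] using hq l hl
    · simp only [repr_ofCoords, if_true, hi']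
      linarith [ht2.trans_le (min_le_right _ _)]
    · simp only [repr_ofCoords, if_true, hi']
      linarith
    · simp only [repr_ofCoords, if_true]
      intro hmem
      refine ht3 ⟨_, hmem, ?_⟩
      linear_combination t * hss
  have hτP : L τ ∈ P := hcol _ (hLK τ) (by rw [hLi']; linarith) (by rw [hLi'])
  have hafter' : ∀ η > 0, ∃ t, τ < t ∧ t < τ + η ∧ L t ∉ P := by
    intro η hη
    obtain ⟨t, ht, htη⟩ := exists_lt_of_csInf_lt hTne (show sInf T < τ + η by linarith)
    refine ⟨t, lt_of_le_of_ne (csInf_le hTbdd ht) ?_, htη, ht.2⟩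
    rintro h
    exact ht.2 (h ▸ hτP)
  have hafter : ∃ η > 0, ∀ q, (∀ l, l ≠ i → b.repr q l ∈ K l) → τ < s * b.repr q i →
      s * b.repr q i < τ + η → q ∉ P := by
    obtain ⟨η, hη, hgapη⟩ := exists_gap C (s * τ)
    refine ⟨η, hη, ?_⟩
    obtain ⟨t, ht1, ht2, ht3⟩ := hafter' η hη
    rcases box_subset_or_disjoint hC
      (J := fun l => if l = i then {u | τ < s * u ∧ s * u < τ + η} else K l)
      (fun l => by
        by_cases hl : l = i
        · simp only [hl, if_true]
          refine OrdConnected.convex ⟨fun u hu v hv z hz => ?_⟩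
          simp only [mem_ofPred_eq, mem_Icc] at hu hv hz ⊢
          rcases hs with rfl | rfl <;> constructor <;> linarith
        · simp [hl, hKconv])
      (fun l u hu => by
        by_cases hl : l = i
        · simp only [hl, if_true, mem_ofPred_eq] at hu
          refine hgapη u ?_ ?_
          · rw [abs_lt]
            rcases hs with rfl | rfl <;> constructor <;> linarith
          · rintro rfl
            rw [← mul_assoc, hss, one_mul] at hu
            exact lt_irrefl _ hu.1
        · simp only [hl, if_false] at hu; exact hKC l u hu) with h | h
    · refine absurd (h (L t) fun l => ?_) ht3
      by_cases hl : l = i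
      · simp only [hl, if_true, mem_ofPred_eq, hLi']; exact ⟨ht1, ht2⟩
      · simp only [hl, if_false]; exact hLK _ l hl
    · intro q hq h1 h2
      refine h q fun l => ?_
      by_cases hl : l = i
      · simp only [hl, if_true, mem_ofPred_eq]; exact ⟨h1, h2⟩
      · simp only [hl, if_false]; exact hq l hl
  obtain ⟨η, hη, hafter⟩ := hafter
  refine ⟨L τ, ?_, ?_⟩
  · have e1 : ∀ᶠ q in 𝓝 (L τ), ∀ l, l ≠ i → b.repr q l ∈ K l := by
      rw [eventually_all]
      intro l
      rw [eventually_imp_distrib_left]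
      exact fun hl => ((continuous_repr b l).tendsto _).eventually_mem
        ((hKopen l).mem_nhds (hLK τ l hl))
    have hcs : Continuous fun q => s * b.repr q i := continuous_const.mul (continuous_repr b i)
    have e2 : ∀ᶠ q in 𝓝 (L τ), a < s * b.repr q i :=
      (hcs.tendsto _).eventually_const_lt (by rw [hLi']; linarith)
    have e3 : ∀ᶠ q in 𝓝 (L τ), s * b.repr q i < τ + η :=
      (hcs.tendsto _).eventually_lt_const (by rw [hLi']; linarith)
    filter_upwards [e1, e2, e3] with q h1 h2 h3
    have heq : -s * (b.repr q i - b.repr (L τ) i) = τ - s * b.repr q i := by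
      rw [hLi]; linear_combination τ * hss
    rw [heq]
    constructor
    · intro hq
      by_contra hcon
      exact hafter q h1 (by linarith) h3 hq
    · intro hq
      exact hcol q h1 h2 (by linarith)
  · rintro z ⟨α, β, hα, hβ, hαβ, rfl⟩
    rcases hα.eq_or_lt with rfl | hα
    · obtain rfl : β = 1 := by linarith
      simpa using hy
    · have hz : ∀ l, b.repr (α • L τ + β • y) l = α * b.repr (L τ) l + β * x l := fun l => by
        simp [hx]
      refine hcol _ (fun l hl => ?_) ?_ ?_
      · rw [hz, hLl τ l hl]
        obtain rfl : β = 1 - α := by linarith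
        simp only [hK, hm, mem_ofPred_eq]
        have e : α * (x l + sgn (σ l) * (ε / 2)) + (1 - α) * x l - x l =
          α * (sgn (σ l) * (ε / 2)) := by ring
        rw [e]
        have h1 : α * ε ≤ ε := by nlinarith
        have h2 : 0 < α * ε := by positivity
        cases σ l <;> simp only [sgn_true, sgn_false, abs_lt] <;>
          refine ⟨?_, ?_, ?_⟩ <;> linarith
      · rw [hz, mul_add, mul_left_comm, hLi', mul_left_comm]
        obtain rfl : β = 1 - α := by linarith
        rcases ha with ha | ha <;> nlinarith
      · rw [hz, mul_add, mul_left_comm, hLi', mul_left_comm]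
        obtain rfl : β = 1 - α := by linarith
        rcases ha with ha | ha <;> nlinarith

/-! ### The boundary at a change of sides -/

theorem exists_third_index : ∀ i k : Fin 3, i ≠ k →
    ∃ j, j ≠ i ∧ j ≠ k ∧ ∀ l, l = i ∨ l = j ∨ l = k := by
  decide

theorem abs_real_eq_max (x : ℝ) : |x| = max x 0 - min x 0 := by
  rcases le_total x 0 with h | h
  · rw [abs_of_nonpos h, max_eq_right h, min_eq_left h]; ring
  · rw [abs_of_nonneg h, max_eq_left h, min_eq_right h]; ring

/-- The boundary of a polyhedron which near `p` consists of two opposite quadrants times a line is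
not a 2-manifold at `p`. -/
theorem false_of_opposite_quadrants {b : OrthonormalBasis (Fin 3) ℝ E3} {P : Set E3}
    (hman : Nonempty (ChartedSpace (EuclideanSpace ℝ (Fin 2)) (frontier P))) {p : E3}
    {i k : Fin 3} (hik : i ≠ k) {s : ℝ} (hs : s = 1 ∨ s = -1)
    (h : ∀ᶠ q in 𝓝 p, (q ∈ P ↔
      0 ≤ s * ((b.repr q i - b.repr p i) * (b.repr q k - b.repr p k)))) : False := by
  obtain ⟨j, hji, hjk, hcov⟩ : ∃ j, j ≠ i ∧ j ≠ k ∧ ∀ l, l = i ∨ l = j ∨ l = k :=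
    exists_third_index i k hik
  set u : E3 → ℝ := fun q => b.repr q i - b.repr p i with hu
  set v : E3 → ℝ := fun q => b.repr q k - b.repr p k with hv
  set w : E3 → ℝ := fun q => b.repr q j - b.repr p j with hw
  have huc : Continuous u := (continuous_repr b i).sub continuous_const
  have hvc : Continuous v := (continuous_repr b k).sub continuous_const
  have hwc : Continuous w := (continuous_repr b j).sub continuous_const
  -- the boundary near `p` is the union of two planes
  have hfr : ∀ᶠ q in 𝓝 p, (q ∈ frontier P ↔ u q * v q = 0) := by
    filter_upwards [eventually_eventually_nhds.2 h] with q hq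
    constructor
    · intro hqf
      by_contra hne
      have hc : Continuous fun q => s * (u q * v q) := by fun_prop
      rcases lt_or_ge (s * (u q * v q)) 0 with hlt | hge
      · have h1 : ∀ᶠ x in 𝓝 q, x ∉ P := by
          filter_upwards [hq, (hc.tendsto q).eventually_lt_const hlt] with x hx hx'
          rw [hx]; exact not_le.2 hx'
        exact (mem_closure_iff_frequently.1 hqf.1) h1
      · have hgt : 0 < s * (u q * v q) := by
          refine lt_of_le_of_ne hge fun h0 => hne ?_
          rcases hs with rfl | rfl <;> linarith
        have h1 : ∀ᶠ x in 𝓝 q, x ∈ P := by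
          filter_upwards [hq, (hc.tendsto q).eventually_const_lt hgt] with x hx hx'
          rw [hx]; exact hx'.le
        exact hqf.2 (mem_interior_iff_mem_nhds.2 h1)
    · intro h0
      have hqP : q ∈ P := by rw [hq.self_of_nhds]; simp only [hu, hv] at h0; rw [h0, mul_zero]
      refine ⟨subset_closure hqP, fun hint => ?_⟩
      -- directions in which the point leaves the two quadrants
      set α : ℝ := if 0 ≤ u q then 1 else -1 with hα
      set β : ℝ := if 0 ≤ v q then 1 else -1 with hβ
      have hev := hq.and (mem_interior_iff_mem_nhds.1 hint)
      have hux : ∀ t a c, u (ofCoords b fun l => b.repr q l +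
          t * (if l = i then a else if l = k then c else 0)) = u q + t * a := fun t a c => by
        simp [hu]; ring
      have hvx : ∀ t a c, v (ofCoords b fun l => b.repr q l +
          t * (if l = i then a else if l = k then c else 0)) = v q + t * c := fun t a c => by
        simp [hv, hik.symm]; ring
      have fin : ∀ a c : ℝ, (∀ t > 0, s * ((u q + t * a) * (v q + t * c)) < 0) → False := by
        intro a c hac
        obtain ⟨t, ht, hmove⟩ := exists_move b hev
          (fun l => if l = i then a else if l = k then c else 0)
        obtain ⟨h1, h2⟩ := hmove (t / 2) (by positivity) (by linarith)
        have h3 := h1.1 h2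
        have h4 := hac (t / 2) (by positivity)
        rw [← hux _ a c, ← hvx _ a c] at h4
        exact absurd h3 (not_le.2 h4)
      rcases eq_or_ne (u q) 0 with h1 | h1
      · rcases lt_or_ge (v q) 0 with h2 | h2
        · refine fin s (-1) fun t ht => ?_
          have : 0 < t * (t - v q) := by nlinarith
          rw [h1]
          rcases hs with rfl | rfl <;> nlinarith
        · refine fin (-s) 1 fun t ht => ?_
          have : 0 < t * (t + v q) := by positivity
          rw [h1]
          rcases hs with rfl | rfl <;> nlinarith
      · have h2 : v q = 0 := (mul_eq_zero.1 h0).resolve_left h1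
        rcases lt_or_ge (u q) 0 with h3 | h3
        · refine fin (-1) s fun t ht => ?_
          have : 0 < t * (t - u q) := by nlinarith
          rw [h2]
          rcases hs with rfl | rfl <;> nlinarith
        · refine fin 1 (-s) fun t ht => ?_
          have : 0 < t * (t + u q) := by positivity
          rw [h2]
          rcases hs with rfl | rfl <;> nlinarith
  have hpf : p ∈ frontier P := by rw [hfr.self_of_nhds]; simp [hu]
  obtain ⟨hcharted⟩ := hman
  set y₀ : frontier P := ⟨p, hpf⟩ with hy₀
  set e : OpenPartialHomeomorph (frontier P) ℂ :=
    (chartAt (EuclideanSpace ℝ (Fin 2)) y₀).trans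
      Complex.orthonormalBasisOneI.repr.symm.toHomeomorph.toOpenPartialHomeomorph with he
  have hmem : y₀ ∈ e.source := by simp [he]
  have hne0 : ∀ q : frontier P, u q * v q = 0 → q ≠ y₀ →
      ¬ (w q = 0 ∧ u q = 0 ∧ v q = 0) := by
    rintro q - hq ⟨h1, h2, h3⟩
    refine hq (Subtype.ext (ext_coords b fun l => ?_))
    simp only [hu, hv, hw] at h1 h2 h3
    rcases hcov l with rfl | rfl | rfl <;> simp only [hy₀] <;> linarith
  have hr : ∀ f g : E3 → ℝ, Continuous f → Continuous g →
      Continuous fun q : frontier P => ((f q : ℂ) + Complex.I * (g q : ℂ)) := by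
    intro f g hf hg
    have h1 : Continuous fun q : frontier P => f q := hf.comp continuous_subtype_val
    have h2 : Continuous fun q : frontier P => g q := hg.comp continuous_subtype_val
    fun_prop
  have hzero : ∀ x y : ℝ, (x : ℂ) + Complex.I * (y : ℂ) = 0 → x = 0 ∧ y = 0 := by
    intro x y hxy
    have h1 := congrArg Complex.re hxy
    have h2 := congrArg Complex.im hxy
    simp at h1 h2
    exact ⟨h1, h2⟩
  -- on the cross times a line, `u - |v|` is minus the distance to the line, except on the half-plane
  -- `0 < u`; hence along a loop through two half-planes `r₁` can wind only if one of them is `0 < u`,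
  -- and `r₂` only if one of them is `0 < v`
  refine false_of_planar_chart e hmem
    (r₁ := fun q => (w q : ℂ) + Complex.I * ((u q - |v q| : ℝ) : ℂ))
    (r₂ := fun q => (w q : ℂ) + Complex.I * ((v q - |u q| : ℝ) : ℂ))
    (hr w (fun q => u q - |v q|) hwc (by fun_prop)) (hr w (fun q => v q - |u q|) hwc (by fun_prop))
    (N := {q : frontier P | u q * v q = 0})
    ?_ ?_ ?_ ?_
  · have h1 := (continuous_subtype_val.tendsto y₀).eventually hfr
    filter_upwards [h1] with q hq
    exact hq.1 q.2
  · intro q hq hqy h0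
    obtain ⟨h1, h2⟩ := hzero _ _ h0
    refine hne0 q hq hqy ⟨h1, ?_⟩
    rcases mul_eq_zero.1 hq with h3 | h3
    · rw [h3, zero_sub, neg_eq_zero, abs_eq_zero] at h2; exact ⟨h3, h2⟩
    · rw [h3, abs_zero, sub_zero] at h2; exact ⟨h2, h3⟩
  · intro q hq hqy h0
    obtain ⟨h1, h2⟩ := hzero _ _ h0
    refine hne0 q hq hqy ⟨h1, ?_⟩
    rcases mul_eq_zero.1 hq with h3 | h3
    · rw [h3, abs_zero, sub_zero] at h2; exact ⟨h3, h2⟩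
    · rw [h3, zero_sub, neg_eq_zero, abs_eq_zero] at h2; exact ⟨h2, h3⟩
  · intro M hM
    obtain ⟨U, hU, hUM⟩ := mem_nhds_subtype _ _ _ |>.1 hM
    obtain ⟨ε, hε, hbox⟩ := (eventually_nhds_iff_box b).1
      (hfr.and (show ∀ᶠ q in 𝓝 p, q ∈ U from hU))
    have hr0 : 0 < ε / 2 := by positivity
    -- a loop with prescribed coordinates
    have loop : ∀ A B : ℝ → ℝ, Continuous A → Continuous B → (∀ t, A t * B t = 0) →
        (∀ t, |A t| ≤ 1) → (∀ t, |B t| ≤ 1) → A (2 * Real.pi) = A 0 → B (2 * Real.pi) = B 0 →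
        (∀ t, A t = 0 → B t = 0 → Real.cos t ≠ 0) →
        ∃ γ : ℝ → frontier P, Continuous γ ∧ γ (2 * Real.pi) = γ 0 ∧ ∀ t, γ t ∈ M ∧ γ t ≠ y₀ ∧
          u (γ t) = ε / 2 * A t ∧ v (γ t) = ε / 2 * B t ∧ w (γ t) = ε / 2 * Real.cos t := by
      intro A B hA hB hAB hA1 hB1 hAp hBp hAB0
      set f : ℝ → E3 := fun t => ofCoords b fun l => b.repr p l +
        ε / 2 * (if l = j then Real.cos t else if l = i then A t else B t) with hf
      have hfu : ∀ t, u (f t) = ε / 2 * A t := fun t => by simp [hu, hf, hji.symm]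
      have hfv : ∀ t, v (f t) = ε / 2 * B t := fun t => by simp [hv, hf, hjk.symm, hik.symm]
      have hfw : ∀ t, w (f t) = ε / 2 * Real.cos t := fun t => by simp [hw, hf]
      have hfbox : ∀ t l, |b.repr (f t) l - b.repr p l| < ε := by
        intro t l
        simp only [hf, repr_ofCoords, add_sub_cancel_left]
        have h1 : |if l = j then Real.cos t else if l = i then A t else B t| ≤ 1 := by
          split_ifs
          exacts [Real.abs_cos_le_one t, hA1 t, hB1 t]
        rw [abs_mul, abs_of_pos hr0]
        nlinarith
      have hfF : ∀ t, f t ∈ frontier P := fun t => by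
        rw [(hbox _ (hfbox t)).1, hfu, hfv]
        linear_combination (ε / 2) ^ 2 * hAB t
      have hfc : Continuous f := by
        refine (continuous_ofCoords b).comp (continuous_pi fun l => ?_)
        have : Continuous fun t => if l = j then Real.cos t else if l = i then A t else B t := by
          split_ifs
          exacts [Real.continuous_cos, hA, hB]
        fun_prop
      refine ⟨fun t => ⟨f t, hfF t⟩, hfc.subtype_mk _, ?_, fun t => ⟨?_, ?_, hfu t, hfv t, hfw t⟩⟩
      · refine Subtype.ext ?_
        simp only [hf, hAp, hBp, Real.cos_two_pi, Real.cos_zero]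
      · exact hUM (hbox _ (hfbox t)).2
      · intro heq
        have heq' : f t = p := congrArg Subtype.val heq
        have h1 := hfu t
        have h2 := hfv t
        have h3 := hfw t
        rw [heq'] at h1 h2 h3
        simp only [hu, hv, hw, sub_self, zero_eq_mul, hr0.ne', false_or] at h1 h2 h3
        exact hAB0 t h1 h2 h3
    have hsc : ∀ t, Real.sin t = 0 → Real.cos t ≠ 0 := fun t h1 h2 => by
      have := Real.sin_sq_add_cos_sq t
      rw [h1, h2] at this; norm_num at this
    have hmm : ∀ t : ℝ, min (Real.sin t) 0 * max (Real.sin t) 0 = 0 := fun t => by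
      rcases le_total (Real.sin t) 0 with h | h <;> simp [h]
    obtain ⟨γ₁, hγ₁, hp₁, H₁⟩ := loop Real.sin 0 Real.continuous_sin continuous_const (by simp)
      Real.abs_sin_le_one (by simp) (by simp) rfl (fun t h1 _ => hsc t h1)
    obtain ⟨γ₂, hγ₂, hp₂, H₂⟩ := loop (fun t => min (Real.sin t) 0) (fun t => max (Real.sin t) 0)
      (by fun_prop) (by fun_prop) hmm
      (fun t => abs_le.2 ⟨le_min (Real.neg_one_le_sin t) (by norm_num),
        (min_le_right _ _).trans zero_le_one⟩)
      (fun t => abs_le.2 ⟨le_trans (by norm_num) (le_max_right _ _),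
        max_le (Real.sin_le_one t) zero_le_one⟩)
      (by simp) (by simp)
      (fun t h1 h2 => hsc t (le_antisymm (max_eq_right_iff.1 h2) (min_eq_right_iff.1 h1)))
    refine ⟨ε / 2, hr0, γ₁, γ₂, hγ₁, hγ₂, hp₁, hp₂, fun t => ?_⟩
    obtain ⟨hM1, hn1, hu1, hv1, hw1⟩ := H₁ t
    obtain ⟨hM2, hn2, hu2, hv2, hw2⟩ := H₂ t
    have hexp : (ε / 2 : ℝ) * Complex.exp (t * Complex.I) =
        ((ε / 2 * Real.cos t : ℝ) : ℂ) + Complex.I * ((ε / 2 * Real.sin t : ℝ) : ℂ) := by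
      rw [Complex.exp_mul_I, ← Complex.ofReal_cos, ← Complex.ofReal_sin]
      push_cast; ring
    have habs : (ε / 2 : ℝ) * ((Real.cos t : ℂ) - Complex.I * (|Real.sin t| : ℝ)) =
        ((ε / 2 * Real.cos t : ℝ) : ℂ) + Complex.I * ((-(ε / 2 * |Real.sin t|) : ℝ) : ℂ) := by
      push_cast; ring
    have hmax : |Real.sin t| = max (Real.sin t) 0 - min (Real.sin t) 0 := abs_real_eq_max _
    have hsum : Real.sin t = max (Real.sin t) 0 + min (Real.sin t) 0 := by
      rw [max_add_min, add_zero]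
    refine ⟨hM1, hn1, hM2, hn2, ?_, ?_, ?_, ?_⟩
    · simp only [hexp, hu1, hv1, hw1]; simp
    · simp only [habs, hu1, hv1, hw1, Pi.zero_apply, mul_zero, zero_sub, abs_mul, abs_of_pos hr0]
    · simp only [habs, hu2, hv2, hw2]
      rw [abs_mul, abs_of_pos hr0, abs_of_nonneg (le_max_right (Real.sin t) 0), hmax]
      congr 3; ring
    · simp only [hexp, hu2, hv2, hw2]
      rw [abs_mul, abs_of_pos hr0, abs_of_nonpos (min_le_right (Real.sin t) 0)]
      congr 3; nth_rewrite 3 [hsum]; ring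

theorem eq_of_sgn_mul_nonneg {a a' : Bool} {t : ℝ} (ht : 0 < sgn a * t) (h : 0 ≤ sgn a' * t) :
    a' = a := by
  cases a <;> cases a' <;> simp only [sgn_true, sgn_false] at * <;> first | rfl | linarith

theorem sgn_not (a : Bool) : sgn (!a) = -sgn a := by cases a <;> norm_num

theorem exists_sgn_mul_nonneg (t : ℝ) : ∃ a, 0 ≤ sgn a * t := by
  rcases le_total 0 t with h | h
  · exact ⟨true, by simpa using h⟩
  · exact ⟨false, by simpa using h⟩

/-- At a flat boundary point, a grid polyhedron with manifold boundary is a half-space: the two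
sides of the boundary cannot be exchanged across a grid line. -/
theorem halfSpaceAt_of_flat {b : OrthonormalBasis (Fin 3) ℝ E3} {P : Set E3} (hc : IsClosed P)
    (hr : P ⊆ closure (interior P)) {C : Finset ℝ}
    (hC : ∀ p ∈ frontier P, ∃ i, b.repr p i ∈ C)
    (hman : Nonempty (ChartedSpace (EuclideanSpace ℝ (Fin 2)) (frontier P)))
    {i : Fin 3} {c : ℝ} {p : E3} (hp : p ∈ flatPart P (b i) c) :
    ∃ s : ℝ, (s = 1 ∨ s = -1) ∧ HalfSpaceAt b P i s c p := by
  obtain ⟨ε, hε, -, I, hI⟩ := exists_octants hc hr hC p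
  have hpc : b.repr p i = c := by rw [b.repr_apply_apply]; exact hp.1
  have hflat : ∀ᶠ q in 𝓝 p, b.repr q i = c → q ∈ frontier P := by
    obtain ⟨-, δ, hδ, h⟩ := hp
    filter_upwards [ball_mem_nhds p hδ] with q hq hqc
    refine h q ?_ hq
    rw [b.repr_apply_apply] at hqc; exact hqc
  have hbox : ∀ᶠ q in 𝓝 p, ∀ j, |b.repr q j - b.repr p j| < ε :=
    (eventually_nhds_iff_box b).2 ⟨ε, hε, fun q hq => hq⟩
  -- exactly one of two octants on either side of the plane belongs to `P`
  have hX : ∀ σ : Fin 3 → Bool, σ ∈ I ↔ Function.update σ i (!σ i) ∉ I := by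
    intro σ
    obtain ⟨t, ht, hmove⟩ := exists_move b (hflat.and (eventually_eventually_nhds.2 hbox))
      (fun l => if l = i then 0 else sgn (σ l))
    obtain ⟨h1, h2⟩ := hmove (t / 2) (by positivity) (by linarith)
    set z := ofCoords b fun l => b.repr p l + t / 2 * (if l = i then 0 else sgn (σ l)) with hz
    have hzi : b.repr z i = c := by simp [hz, hpc]
    have hzl : ∀ l, l ≠ i → 0 < sgn (σ l) * (b.repr z l - b.repr p l) := fun l hl => by
      simp only [hz, repr_ofCoords, hl, if_false, add_sub_cancel_left]
      nlinarith [sgn_mul_self (σ l)]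
    have hzf := h1 hzi
    have hzP : z ∈ P := by rw [← hc.closure_eq]; exact hzf.1
    constructor
    · intro hσ hσ'
      refine hzf.2 (mem_interior_iff_mem_nhds.2 ?_)
      have h3 : ∀ᶠ x in 𝓝 z, ∀ l, l ≠ i → 0 < sgn (σ l) * (b.repr x l - b.repr p l) := by
        rw [eventually_all]
        intro l
        rw [eventually_imp_distrib_left]
        intro hl
        have hcont : Continuous fun x => sgn (σ l) * (b.repr x l - b.repr p l) :=
          continuous_const.mul ((continuous_repr b l).sub continuous_const)
        exact (hcont.tendsto z).eventually_const_lt (hzl l hl)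
      filter_upwards [h2, h3] with x hx1 hx2
      rw [hI x hx1]
      obtain ⟨a, ha⟩ := exists_sgn_mul_nonneg (b.repr x i - b.repr p i)
      by_cases haσ : a = σ i
      · refine ⟨σ, hσ, fun l => ?_⟩
        by_cases hl : l = i
        · subst hl; rw [← haσ]; exact ha
        · exact (hx2 l hl).le
      · refine ⟨_, hσ', fun l => ?_⟩
        by_cases hl : l = i
        · subst hl
          rw [Function.update_self, ← Bool.eq_not.2 haσ]; exact ha
        · rw [Function.update_of_ne hl]; exact (hx2 l hl).le
    · intro hσ'
      obtain ⟨σ', hσI, hcomp⟩ := (hI z h2.self_of_nhds).1 hzP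
      by_cases h : σ' i = σ i
      · convert! hσI using 1
        funext l
        by_cases hl : l = i
        · rw [hl, h]
        · exact (eq_of_sgn_mul_nonneg (hzl l hl) (hcomp l)).symm
      · refine absurd ?_ hσ'
        convert! hσI using 1
        funext l
        by_cases hl : l = i
        · subst hl; rw [Function.update_self, Bool.eq_not.2 h]
        · rw [Function.update_of_ne hl]
          exact (eq_of_sgn_mul_nonneg (hzl l hl) (hcomp l)).symm
  -- the side does not change across a grid line of the plane
  have hE : ∀ σ ∈ I, ∀ k, k ≠ i → Function.update σ k (!σ k) ∈ I := by
    intro σ hσ k hki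
    by_contra hσk
    obtain ⟨j, hji, hjk, hcov⟩ := exists_third_index i k hki.symm
    set σ' := Function.update (Function.update σ k (!σ k)) i (!σ i) with hσ'
    have hσ'I : σ' ∈ I := by
      have h1 := hX (Function.update σ k (!σ k))
      rw [Function.update_of_ne hki.symm] at h1
      by_contra h2
      exact hσk (h1.2 h2)
    have hσi : Function.update σ i (!σ i) ∉ I := (hX σ).1 hσ
    obtain ⟨t, ht, hmove⟩ := exists_move b (eventually_eventually_nhds.2 hbox)
      (fun l => if l = j then sgn (σ j) else 0)
    have h2 := hmove (t / 2) (by positivity) (by linarith)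
    set z := ofCoords b fun l => b.repr p l + t / 2 * (if l = j then sgn (σ j) else 0) with hz
    have hzi : b.repr z i = b.repr p i := by simp [hz, hji.symm]
    have hzk : b.repr z k = b.repr p k := by simp [hz, hjk.symm]
    have hzj : 0 < sgn (σ j) * (b.repr z j - b.repr p j) := by
      simp only [hz, repr_ofCoords, if_true, add_sub_cancel_left]
      nlinarith [sgn_mul_self (σ j)]
    have hcont : Continuous fun x => sgn (σ j) * (b.repr x j - b.repr p j) :=
      continuous_const.mul ((continuous_repr b j).sub continuous_const)
    refine false_of_opposite_quadrants (b := b) (p := z) hman hki.symm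
      (s := sgn (σ i) * sgn (σ k))
      (by cases σ i <;> cases σ k <;> simp) ?_
    filter_upwards [h2, (hcont.tendsto z).eventually_const_lt hzj] with q hq1 hq2
    rw [hI q hq1, hzi, hzk]
    set u := b.repr q i - b.repr p i with hu
    set v := b.repr q k - b.repr p k with hv
    have e1 : sgn (σ i) * sgn (σ k) * (u * v) = (sgn (σ i) * u) * (sgn (σ k) * v) := by ring
    rw [e1]
    constructor
    · rintro ⟨τ, hτ, hcomp⟩
      have hτj : τ j = σ j := eq_of_sgn_mul_nonneg hq2 (hcomp j)
      have hui := hcomp i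
      have hvk := hcomp k
      by_cases h1 : τ i = σ i <;> by_cases h3 : τ k = σ k
      · rw [h1] at hui; rw [h3] at hvk
        exact mul_nonneg hui hvk
      · refine absurd ?_ hσk
        convert! hτ using 1
        funext l
        rcases hcov l with rfl | rfl | rfl
        · rw [Function.update_of_ne hki.symm, h1]
        · rw [Function.update_of_ne hjk, hτj]
        · rw [Function.update_self, Bool.eq_not.2 h3]
      · refine absurd ?_ hσi
        convert! hτ using 1
        funext l
        rcases hcov l with rfl | rfl | rfl
        · rw [Function.update_self, Bool.eq_not.2 h1]
        · rw [Function.update_of_ne hji, hτj]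
        · rw [Function.update_of_ne hki, h3]
      · rw [Bool.eq_not.2 h1, sgn_not] at hui
        rw [Bool.eq_not.2 h3, sgn_not] at hvk
        nlinarith
    · intro huv
      by_cases h1 : 0 ≤ sgn (σ i) * u ∧ 0 ≤ sgn (σ k) * v
      · refine ⟨σ, hσ, fun l => ?_⟩
        rcases hcov l with rfl | rfl | rfl
        exacts [h1.1, hq2.le, h1.2]
      · have h3 : sgn (σ i) * u ≤ 0 ∧ sgn (σ k) * v ≤ 0 := by
          rcases mul_nonneg_iff.1 huv with h | h
          · exact absurd h h1
          · exact h
        refine ⟨σ', hσ'I, fun l => ?_⟩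
        rcases hcov l with rfl | rfl | rfl
        · rw [hσ', Function.update_self, sgn_not]; linarith [h3.1]
        · rw [hσ', Function.update_of_ne hji, Function.update_of_ne hjk]; exact hq2.le
        · rw [hσ', Function.update_of_ne hki, Function.update_self, sgn_not]; linarith [h3.2]
  have hall : ∀ σ ∈ I, ∀ τ : Fin 3 → Bool, τ i = σ i → τ ∈ I := by
    intro σ hσ τ hτ
    obtain ⟨k, hki⟩ : ∃ k, k ≠ i := exists_ne i
    obtain ⟨j, hji, hjk, hcov⟩ := exists_third_index i k hki.symm
    have h1 : ∃ σ₁ ∈ I, σ₁ i = τ i ∧ σ₁ k = τ k := by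
      by_cases h : σ k = τ k
      · exact ⟨σ, hσ, hτ.symm, h⟩
      · refine ⟨_, hE σ hσ k hki, ?_, ?_⟩
        · rw [Function.update_of_ne hki.symm, hτ]
        · rw [Function.update_self, Bool.not_eq.2 h]
    obtain ⟨σ₁, hσ₁, hi, hk⟩ := h1
    by_cases h : σ₁ j = τ j
    · convert! hσ₁ using 1
      funext l
      rcases hcov l with rfl | rfl | rfl
      exacts [hi.symm, h.symm, hk.symm]
    · convert! hE σ₁ hσ₁ j hji using 1
      funext l
      rcases hcov l with rfl | rfl | rfl
      · rw [Function.update_of_ne hji.symm, hi]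
      · rw [Function.update_self, Bool.not_eq.2 h]
      · rw [Function.update_of_ne hjk.symm, hk]
  obtain ⟨σ, hσ⟩ : ∃ σ, σ ∈ I := by
    by_cases h : (fun _ => true) ∈ I
    · exact ⟨_, h⟩
    · by_contra hno
      push Not at hno
      exact h ((hX _).2 (hno _))
  refine ⟨sgn (σ i), by cases σ i <;> simp, ?_⟩
  filter_upwards [hbox] with q hq
  rw [hI q hq, ← hpc]
  constructor
  · rintro ⟨τ, hτ, hcomp⟩
    have : τ i = σ i := by
      by_contra hne
      refine (hX τ).1 hτ (hall σ hσ _ ?_)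
      rw [Function.update_self, Bool.not_eq.2 hne]
    rw [← this]; exact hcomp i
  · intro h
    choose a ha using fun l => exists_sgn_mul_nonneg (b.repr q l - b.repr p l)
    refine ⟨Function.update a i (σ i), hall σ hσ _ (by simp), fun l => ?_⟩
    by_cases hl : l = i
    · subst hl; rw [Function.update_self]; exact h
    · rw [Function.update_of_ne hl]; exact ha l

/-! ### Sufficiency -/

/-- Near a point where `P` is a half-space, the boundary of `P` is the bounding plane. -/
theorem HalfSpaceAt.frontier {b : OrthonormalBasis (Fin 3) ℝ E3} {P : Set E3} {i : Fin 3}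
    {s c : ℝ} {p : E3} (hs : s = 1 ∨ s = -1) (h : HalfSpaceAt b P i s c p) :
    ∀ᶠ q in 𝓝 p, (q ∈ frontier P ↔ b.repr q i = c) := by
  filter_upwards [eventually_eventually_nhds.2 h] with q hq
  have hcont : Continuous fun q => s * (b.repr q i - c) :=
    continuous_const.mul ((continuous_repr b i).sub continuous_const)
  constructor
  · intro hqf
    by_contra hne
    rcases lt_or_ge (s * (b.repr q i - c)) 0 with hlt | hge
    · have h1 : ∀ᶠ x in 𝓝 q, x ∉ P := by
        filter_upwards [hq, (hcont.tendsto q).eventually_lt_const hlt] with x hx hx'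
        rw [hx]; exact not_le.2 hx'
      exact (mem_closure_iff_frequently.1 hqf.1) h1
    · have hgt : 0 < s * (b.repr q i - c) := by
        refine lt_of_le_of_ne hge fun h0 => hne ?_
        rcases hs with rfl | rfl <;> linarith
      have h1 : ∀ᶠ x in 𝓝 q, x ∈ P := by
        filter_upwards [hq, (hcont.tendsto q).eventually_const_lt hgt] with x hx hx'
        rw [hx]; exact hx'.le
      exact hqf.2 (mem_interior_iff_mem_nhds.2 h1)
  · intro hqc
    refine ⟨subset_closure (hq.self_of_nhds.2 (by simp [hqc])), fun hint => ?_⟩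
    obtain ⟨t, ht, hmove⟩ := exists_move b (hq.and (mem_interior_iff_mem_nhds.1 hint))
      (fun _ => -s)
    obtain ⟨h1, h2⟩ := hmove (t / 2) (by positivity) (by linarith)
    have h3 := h1.1 h2
    rw [repr_ofCoords, hqc] at h3
    rcases hs with rfl | rfl <;> linarith

theorem HalfSpaceAt.mem_flatPart {b : OrthonormalBasis (Fin 3) ℝ E3} {P : Set E3} {i : Fin 3}
    {s c : ℝ} {p : E3} (hs : s = 1 ∨ s = -1) (h : HalfSpaceAt b P i s c p)
    (hp : b.repr p i = c) : p ∈ flatPart P (b i) c := by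
  obtain ⟨ε, hε, hfr⟩ := Metric.eventually_nhds_iff.1 (h.frontier hs)
  rw [b.repr_apply_apply] at hp
  refine ⟨hp, ε, hε, fun q hq hd => (hfr hd).2 ?_⟩
  rw [b.repr_apply_apply]; exact hq

theorem basis_ne_zero (b : OrthonormalBasis (Fin 3) ℝ E3) (i : Fin 3) : b i ≠ 0 := by
  have := b.orthonormal.ne_zero i
  exact this

/-- A face with a relative interior point where `P` is a half-space is a component of the flat part
of the corresponding coordinate plane. -/
theorem exists_component_of_halfSpaceAt {b : OrthonormalBasis (Fin 3) ℝ E3} {P F : Set E3}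
    (hF : F ∈ faces P) {i : Fin 3} {s c : ℝ} {q : E3} (hs : s = 1 ∨ s = -1)
    (hq : q ∈ intrinsicInterior ℝ F) (h : HalfSpaceAt b P i s c q) :
    intrinsicInterior ℝ F = connectedComponentIn (flatPart P (b i) c) q := by
  obtain ⟨n, hn, d, p, hp, rfl⟩ := exists_component_of_mem_faces hF
  rw [(isPlanarPiece_closure_component hn hp).1] at hq ⊢
  have hqflat : q ∈ flatPart P n d := connectedComponentIn_subset _ _ hq
  have hpl : plane n d = plane (b i) c := by
    refine plane_eq_of_local (p := q) hn (basis_ne_zero b i) ?_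
    obtain ⟨hqn, ε, hε, hf⟩ := hqflat
    obtain ⟨ε', hε', hfr⟩ := Metric.eventually_nhds_iff.1 (h.frontier hs)
    refine ⟨hqn, min ε ε', lt_min hε hε', fun x hx hd => ?_⟩
    have h1 := (hfr (hd.trans_le (min_le_right _ _))).1
      (hf x hx (hd.trans_le (min_le_left _ _)))
    rw [b.repr_apply_apply] at h1; exact h1
  rw [← flatPart_congr hpl P]
  exact connectedComponentIn_eq hq

/-- The faces of `P` that bound it from below (`a = true`) or above (`a = false`) in the `i`-th
coordinate direction, at some relative interior point. -/
def facing (b : OrthonormalBasis (Fin 3) ℝ E3) (P : Set E3) (i : Fin 3) (a : Bool) :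
    Set (Set E3) :=
  {F ∈ faces P | ∃ q ∈ intrinsicInterior ℝ F, HalfSpaceAt b P i (sgn a) (b.repr q i) q}

theorem sgn_eq (a : Bool) : sgn a = 1 ∨ sgn a = -1 := by cases a <;> simp

/-- A face bounds `P` from one side only: two directions would come from two coordinate planes, or
from both sides of one of them, and then the relative interior of the face, all of whose points are
of one of the two kinds by `halfSpaceAt_of_flat`, would be disconnected. -/
theorem facing_unique {b : OrthonormalBasis (Fin 3) ℝ E3} {P F : Set E3} (hc : IsClosed P)
    (hr : P ⊆ closure (interior P)) {C : Finset ℝ}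
    (hC : ∀ p ∈ frontier P, ∃ i, b.repr p i ∈ C)
    (hman : Nonempty (ChartedSpace (EuclideanSpace ℝ (Fin 2)) (frontier P)))
    {i j : Fin 3} {a a' : Bool} (h : F ∈ facing b P i a) (h' : F ∈ facing b P j a') :
    i = j ∧ a = a' := by
  obtain ⟨hF, q, hq, hH⟩ := h
  obtain ⟨-, q', hq', hH'⟩ := h'
  have e := exists_component_of_halfSpaceAt hF (sgn_eq a) hq hH
  have e' := exists_component_of_halfSpaceAt hF (sgn_eq a') hq' hH'
  have hqR : q ∈ connectedComponentIn (flatPart P (b j) (b.repr q' j)) q' := e' ▸ hq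
  have hqR' : q' ∈ connectedComponentIn (flatPart P (b i) (b.repr q i)) q := e ▸ hq'
  have hij : i = j := by
    by_contra hij
    have h1 := (component_subset_planeInterior _ _ _ _ hqR)
    have h2 : plane (b j) (b.repr q' j) = plane (b i) (b.repr q i) := by
      refine plane_eq_of_local (basis_ne_zero b j) (basis_ne_zero b i) (p := q)
        (planeInterior_mono ?_ h1)
      rw [← e', e]
      exact (connectedComponentIn_subset _ _).trans (flatPart_subset_plane _ _ _)
    have h3 : q + b j ∈ plane (b i) (b.repr q i) := by
      rw [mem_plane, inner_add_right, b.inner_eq_zero hij, add_zero, b.repr_apply_apply]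
    rw [← h2, mem_plane, inner_add_right, ← b.repr_apply_apply, ← b.repr_apply_apply] at h3
    have h4 : b.repr q j = b.repr q' j := by
      rw [b.repr_apply_apply q]; exact h1.1
    rw [h4] at h3
    simp at h3
  subst hij
  refine ⟨rfl, ?_⟩
  have hcc : b.repr q' i = b.repr q i := by
    have := connectedComponentIn_subset _ _ hqR'
    rw [b.repr_apply_apply q']; exact this.1
  rw [hcc] at hH'
  set c := b.repr q i with hcdef
  by_contra hne
  have hopen : ∀ s, IsOpen {x | HalfSpaceAt b P i s c x} := fun s => by
    rw [isOpen_iff_mem_nhds]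
    exact fun x hx => eventually_eventually_nhds.2 hx
  have hqC : q ∈ connectedComponentIn (flatPart P (b i) c) q :=
    mem_connectedComponentIn (hH.mem_flatPart (sgn_eq a) rfl)
  obtain ⟨x, hx, h1, h2⟩ := isPreconnected_connectedComponentIn _ _ (hopen 1) (hopen (-1))
    (fun x hx => by
      obtain ⟨s, rfl | rfl, hs⟩ := halfSpaceAt_of_flat hc hr hC hman
        (connectedComponentIn_subset _ _ hx)
      exacts [Or.inl hs, Or.inr hs])
    (by
      cases a
      · cases a'
        · exact absurd rfl hne
        · exact ⟨q', hqR', hH'⟩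
      · exact ⟨q, hqC, hH⟩)
    (by
      cases a
      · exact ⟨q, hqC, hH⟩
      · cases a'
        · exact ⟨q', hqR', hH'⟩
        · exact absurd rfl hne)
  have hxc : b.repr x i = c := by
    rw [b.repr_apply_apply]; exact (connectedComponentIn_subset _ _ hx).1
  obtain ⟨t, ht, hmove⟩ := exists_move b (Filter.Eventually.and h1 h2) (fun _ => 1)
  obtain ⟨h3, h4⟩ := hmove (t / 2) (by positivity) (by linarith)
  rw [repr_ofCoords, hxc] at h3 h4
  have h5 := h4.1 (h3.2 (by linarith))
  linarith

/-- The faces of one direction guard everything. -/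
theorem facing_guards {b : OrthonormalBasis (Fin 3) ℝ E3} {P : Set E3} (hcomp : IsCompact P)
    (hr : P ⊆ closure (interior P)) {C : Finset ℝ}
    (hC : ∀ p ∈ frontier P, ∃ i, b.repr p i ∈ C) (i : Fin 3) (a : Bool) {y : E3} (hy : y ∈ P) :
    ∃ F ∈ facing b P i a, ∃ q ∈ intrinsicInterior ℝ F, segment ℝ q y ⊆ P := by
  obtain ⟨q, hq, hseg⟩ := exists_visible_halfSpaceAt hcomp hr hC hy i (s := -sgn a)
    (by cases a <;> simp)
  rw [neg_neg] at hq
  have hflat := hq.mem_flatPart (sgn_eq a) rfl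
  have hri := (isPlanarPiece_closure_component (basis_ne_zero b i) hflat).1
  have hqF := mem_connectedComponentIn hflat
  rw [← hri] at hqF
  exact ⟨_, ⟨closure_component_mem_faces (basis_ne_zero b i) hflat, q, hqF, hq⟩, q, hqF, hseg⟩

/-- The smallest of the six pairwise disjoint sets `facing b P i a` is a guard set. -/
theorem exists_guarding_card_le {f : ℕ} {P : Set E3} (hP : IsOrthogonalPolyhedron P)
    (hf : (faces P).encard = f) :
    ∃ 𝒢 : Finset (Set E3), IsOpenFaceGuarding P 𝒢 ∧ 𝒢.card ≤ f / 6 := by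
  classical
  obtain ⟨b, hb⟩ := hP.orthogonal
  have hcomp := hP.toIsPolyhedron.isCompact
  have hr := hP.toIsPolyhedron.subset_closure_interior
  obtain ⟨C, hC⟩ := hP.toIsPolyhedron.exists_grid hb
  have hfin : (faces P).Finite := finite_of_encard_eq_coe hf
  have hcard : hfin.toFinset.card = f := by
    rw [hfin.encard_eq_coe_toFinset_card] at hf
    exact_mod_cast hf
  set 𝒢 : Fin 3 × Bool → Finset (Set E3) := fun d =>
    hfin.toFinset.filter fun F => F ∈ facing b P d.1 d.2 with h𝒢
  have hmem : ∀ d F, F ∈ 𝒢 d ↔ F ∈ facing b P d.1 d.2 := fun d F => by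
    simp only [h𝒢, Finset.mem_filter, hfin.mem_toFinset]
    exact ⟨fun h => h.2, fun h => ⟨h.1, h⟩⟩
  have hsum : ∑ d, (𝒢 d).card ≤ f := by
    rw [← hcard, ← Finset.card_biUnion]
    · refine Finset.card_le_card fun F hF => ?_
      obtain ⟨d, -, hF⟩ := Finset.mem_biUnion.1 hF
      exact (Finset.mem_filter.1 hF).1
    · intro d _ d' _ hne
      rw [Function.onFun, Finset.disjoint_left]
      intro F hF hF'
      have := facing_unique hcomp.isClosed hr hC hP.manifold ((hmem d F).1 hF) ((hmem d' F).1 hF')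
      exact hne (Prod.ext this.1 this.2)
  obtain ⟨d, hd⟩ : ∃ d, (𝒢 d).card ≤ f / 6 := by
    by_contra hcon
    push Not at hcon
    have h1 : ∑ _d : Fin 3 × Bool, (f / 6 + 1) ≤ ∑ d, (𝒢 d).card :=
      Finset.sum_le_sum fun d _ => hcon d
    simp at h1
    omega
  refine ⟨𝒢 d, ⟨fun F hF => ((hmem d F).1 hF).1, subset_antisymm ?_ fun y hy => ?_⟩, hd⟩
  · rintro y ⟨x, -, hseg⟩
    exact hseg (right_mem_segment ℝ x y)
  · obtain ⟨F, hF, q, hq, hseg⟩ := facing_guards hcomp hr hC d.1 d.2 hy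
    refine ⟨q, ?_, hseg⟩
    simp only [mem_iUnion]
    exact ⟨F, (hmem d F).2 hF, hq⟩

/-! ### Locally monotone sets -/

/-- Near `p`, the set `P` is an upper set with respect to some orthant order on space: it is closed
under moving each coordinate in a fixed direction. -/
def LocallyMonotoneAt (P : Set E3) (p : E3) : Prop :=
  ∃ σ : Fin 3 → Bool, ∃ ρ > 0, ∀ q r : E3, (∀ l, |q l - p l| < ρ) → (∀ l, |r l - p l| < ρ) →
    q ∈ P → (∀ l, 0 ≤ sgn (σ l) * (r l - q l)) → r ∈ P

/-- The standard basis of space. -/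
noncomputable abbrev stdBasis : OrthonormalBasis (Fin 3) ℝ E3 := EuclideanSpace.basisFun (Fin 3) ℝ

theorem stdBasis_repr (q : E3) (i : Fin 3) : stdBasis.repr q i = q i := by
  simp

theorem mem_plane_std {i : Fin 3} {c : ℝ} {x : E3} : x ∈ plane (stdBasis i) c ↔ x i = c := by
  rw [mem_plane, ← stdBasis.repr_apply_apply, stdBasis_repr]

theorem eventually_nhds_iff_coord {p : E3} {φ : E3 → Prop} :
    (∀ᶠ q in 𝓝 p, φ q) ↔ ∃ ε > 0, ∀ q : E3, (∀ j, |q j - p j| < ε) → φ q := by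
  rw [eventually_nhds_iff_box stdBasis]
  simp only [stdBasis_repr]

theorem halfSpaceAt_std {P : Set E3} {i : Fin 3} {s c : ℝ} {p : E3} :
    HalfSpaceAt stdBasis P i s c p ↔ ∀ᶠ q in 𝓝 p, (q ∈ P ↔ 0 ≤ s * (q i - c)) := by
  simp only [HalfSpaceAt, stdBasis_repr]

/-- The points with given coordinates. -/
noncomputable def pt (v : Fin 3 → ℝ) : E3 := WithLp.toLp 2 v

@[simp] theorem pt_apply (v : Fin 3 → ℝ) (i : Fin 3) : pt v i = v i := rfl

theorem continuous_pt : Continuous pt := PiLp.continuous_toLp 2 _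

theorem continuous_coord (i : Fin 3) : Continuous fun q : E3 => q i := by fun_prop

theorem LocallyMonotoneAt.halfSpaceAt {P : Set E3} (hc : IsClosed P) {p : E3}
    (h : LocallyMonotoneAt P p) {i : Fin 3} {c : ℝ} (hp : p ∈ flatPart P (stdBasis i) c) :
    ∃ s : ℝ, (s = 1 ∨ s = -1) ∧ HalfSpaceAt stdBasis P i s c p := by
  obtain ⟨σ, ρ, hρ, hmono⟩ := h
  have hpc : p i = c := mem_plane_std.1 hp.1
  have hflat : ∀ᶠ q in 𝓝 p, q i = c → q ∈ frontier P := by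
    obtain ⟨-, δ, hδ, h⟩ := hp
    filter_upwards [ball_mem_nhds p hδ] with q hq hqc
    exact h q (mem_plane_std.2 hqc) hq
  obtain ⟨ε, hε, hflat⟩ := eventually_nhds_iff_coord.1 hflat
  refine ⟨sgn (σ i), sgn_eq _, ?_⟩
  rw [halfSpaceAt_std, eventually_nhds_iff_coord]
  have hm : 0 < min ε ρ / 2 := by positivity
  refine ⟨min ε ρ / 2, hm, fun q hq => ?_⟩
  have hmε : min ε ρ ≤ ε := min_le_left _ _
  have hmρ : min ε ρ ≤ ρ := min_le_right _ _
  constructor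
  · intro hqP
    by_contra hcon
    -- a point of the plane strictly above `q`
    set δ := min ε ρ / 2 with hδ
    set r : E3 := pt fun l => if l = i then c else q l + δ * sgn (σ l) with hr
    have hrp : ∀ l, |r l - p l| < 2 * δ := by
      intro l
      by_cases hl : l = i
      · subst hl; simp [hr, hpc]; exact hm
      · simp only [hr, pt_apply, hl, if_false]
        have := abs_lt.1 (hq l)
        rw [abs_lt]
        cases σ l <;> simp only [sgn_true, sgn_false] <;> constructor <;> linarith
    have hrf : r ∈ frontier P := hflat r (fun l => by linarith [hrp l]) (by simp [hr])
    have hrl : ∀ l, 0 < sgn (σ l) * (r l - q l) := by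
      intro l
      by_cases hl : l = i
      · subst hl
        simp only [hr, pt_apply, if_true]
        linarith
      · simp only [hr, pt_apply, hl, if_false, add_sub_cancel_left]
        nlinarith [sgn_mul_self (σ l)]
    refine hrf.2 (mem_interior_iff_mem_nhds.2 ?_)
    have h1 : ∀ᶠ x : E3 in 𝓝 r, ∀ l, 0 < sgn (σ l) * (x l - q l) ∧ |x l - p l| < ρ := by
      rw [eventually_all]
      intro l
      have c1 : Continuous fun x : E3 => sgn (σ l) * (x l - q l) := by fun_prop
      have c2 : Continuous fun x : E3 => |x l - p l| := by fun_prop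
      exact ((c1.tendsto r).eventually_const_lt (hrl l)).and
        ((c2.tendsto r).eventually_lt_const (by linarith [hrp l]))
    filter_upwards [h1] with x hx
    exact hmono q x (fun l => by linarith [hq l]) (fun l => (hx l).2) hqP fun l => (hx l).1.le
  · intro hqs
    set r : E3 := pt fun l => if l = i then c else q l with hr
    have hrp : ∀ l, |r l - p l| < min ε ρ / 2 := by
      intro l
      by_cases hl : l = i
      · subst hl; simp [hr, hpc, hε, hρ]
      · simp only [hr, pt_apply, hl, if_false]; exact hq l
    have hrf : r ∈ frontier P := hflat r (fun l => by linarith [hrp l]) (by simp [hr])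
    have hrP : r ∈ P := by rw [← hc.closure_eq]; exact hrf.1
    refine hmono r q (fun l => by linarith [hrp l]) (fun l => by linarith [hq l]) hrP fun l => ?_
    by_cases hl : l = i
    · subst hl; simpa [hr] using hqs
    · simp [hr, hl]

/-- The boundary of a closed set that is locally monotone at a boundary point is, near that point, a
Lipschitz graph over a plane transverse to the diagonal of the orthant. -/
theorem LocallyMonotoneAt.exists_chart {P : Set E3} (hc : IsClosed P) {p : E3}
    (hp : p ∈ frontier P) (h : LocallyMonotoneAt P p) :
    ∃ e : OpenPartialHomeomorph (frontier P) (EuclideanSpace ℝ (Fin 2)),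
      (⟨p, hp⟩ : frontier P) ∈ e.source := by
  classical
  obtain ⟨σ, ρ, hρ, hmono⟩ := h
  set U : Set E3 := {q | ∀ l, |q l - p l| < ρ} with hU
  have hUo : IsOpen U := by
    rw [isOpen_iff_mem_nhds]
    intro q hq
    have : ∀ᶠ x : E3 in 𝓝 q, ∀ l, |x l - p l| < ρ := by
      rw [eventually_all]
      intro l
      have c2 : Continuous fun x : E3 => |x l - p l| := by fun_prop
      exact (c2.tendsto q).eventually_lt_const (hq l)
    exact this
  have hpU : p ∈ U := by simpa [hU] using hρ
  have hpP : p ∈ P := by rw [← hc.closure_eq]; exact hp.1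
  -- `point w t` has coordinates `w 0 + t`, `w 1 + t`, `t`, up to the signs of the orthant
  set ext : EuclideanSpace ℝ (Fin 2) → Fin 3 → ℝ := fun w => ![w 0, w 1, 0] with hext
  set point : EuclideanSpace ℝ (Fin 2) → ℝ → E3 :=
    fun w t => pt fun l => sgn (σ l) * (ext w l + t) with hpoint
  have hpt : ∀ w t l, sgn (σ l) * point w t l = ext w l + t := fun w t l => by
    simp only [hpoint, pt_apply]; rw [← mul_assoc, sgn_mul_self, one_mul]
  have hextd : ∀ w w' l, |ext w l - ext w' l| ≤ dist w w' := by
    intro w w' l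
    have h2 : ∀ j : Fin 2, |w j - w' j| ≤ dist w w' := fun j => by
      rw [dist_eq_norm, ← Real.norm_eq_abs]
      exact PiLp.norm_apply_le (w - w') j
    fin_cases l
    · exact h2 0
    · exact h2 1
    · simp [hext]
  have hextc : ∀ l, Continuous fun w => ext w l := by
    intro l
    fin_cases l <;> simp only [hext] <;> simp <;> fun_prop
  set proj : E3 → EuclideanSpace ℝ (Fin 2) := fun q =>
    WithLp.toLp 2 ![sgn (σ 0) * q 0 - sgn (σ 2) * q 2, sgn (σ 1) * q 1 - sgn (σ 2) * q 2] with hproj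
  have hprojc : Continuous proj := by
    refine (PiLp.continuous_toLp 2 _).comp (continuous_pi fun j => ?_)
    fin_cases j <;> simp <;> fun_prop
  have hsgn : ∀ l (x : ℝ), sgn (σ l) * (sgn (σ l) * x) = x := fun l x => by
    rw [← mul_assoc, sgn_mul_self, one_mul]
  have hpp : ∀ q, point (proj q) (sgn (σ 2) * q 2) = q := by
    intro q
    refine PiLp.ext fun l => ?_
    fin_cases l <;> simp [hpoint, hext, hproj, hsgn]
  have hproj_point : ∀ w t, proj (point w t) = w := by
    intro w t
    refine PiLp.ext fun j => ?_
    fin_cases j <;> simp [hpoint, hext, hproj, hsgn]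
  set D : Set E3 := {x | ∃ u ∈ P ∩ U, ∀ l, 0 ≤ sgn (σ l) * (x l - u l)} with hD
  have hDU : ∀ x ∈ D, x ∈ U → x ∈ P := by
    rintro x ⟨u, ⟨huP, huU⟩, hux⟩ hxU
    exact hmono u x huU hxU huP hux
  have hDup : ∀ x ∈ D, ∀ x' : E3, (∀ l, sgn (σ l) * x l ≤ sgn (σ l) * x' l) → x' ∈ D := by
    rintro x ⟨u, hu, hux⟩ x' hx
    exact ⟨u, hu, fun l => by linarith [hux l, hx l]⟩
  set T : EuclideanSpace ℝ (Fin 2) → ℝ := fun w => sInf {t | point w t ∈ D} with hT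
  have hSne : ∀ w, {t | point w t ∈ D}.Nonempty := by
    intro w
    refine ⟨∑ l, |sgn (σ l) * p l - ext w l|, hDup p ⟨p, ⟨hpP, hpU⟩, by simp⟩ _ fun l => ?_⟩
    rw [hpt]
    have h1 : |sgn (σ l) * p l - ext w l| ≤ ∑ l, |sgn (σ l) * p l - ext w l| :=
      Finset.single_le_sum (f := fun l => |sgn (σ l) * p l - ext w l|)
        (fun _ _ => abs_nonneg _) (Finset.mem_univ l)
    linarith [le_abs_self (sgn (σ l) * p l - ext w l)]
  have hSbdd : ∀ w, BddBelow {t | point w t ∈ D} := by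
    intro w
    refine ⟨sgn (σ 2) * p 2 - ρ, ?_⟩
    rintro t ⟨u, ⟨-, huU⟩, hu⟩
    have h1 := hu 2
    rw [mul_sub, hpt] at h1
    have h2 := abs_lt.1 (huU 2)
    simp only [hext] at h1
    simp at h1
    cases h : σ 2 <;> simp only [h, sgn_true, sgn_false] at h1 ⊢ <;> linarith
  have hSup : ∀ w w' t t', (∀ l, ext w l + t ≤ ext w' l + t') → point w t ∈ D →
      point w' t' ∈ D := by
    intro w w' t t' hle hD
    exact hDup _ hD _ fun l => by rw [hpt, hpt]; exact hle l
  have hTlip : LipschitzWith 1 T := by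
    refine LipschitzWith.of_le_add fun w w' => ?_
    rw [← sub_le_iff_le_add]
    refine le_csInf (hSne w') fun t ht => ?_
    rw [sub_le_iff_le_add]
    refine csInf_le (hSbdd w) (hSup w' w t _ (fun l => ?_) ht)
    have := abs_le.1 (hextd w w' l)
    linarith
  have habove : ∀ w t, T w < t → point w t ∈ D := by
    intro w t ht
    obtain ⟨t', ht', hlt⟩ := exists_lt_of_csInf_lt (hSne w) ht
    exact hSup w w t' t (fun l => by linarith) ht'
  have hbelow : ∀ w t, t < T w → point w t ∉ D := fun w t ht hD =>
    absurd (csInf_le (hSbdd w) hD) (not_le.2 ht)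
  set Ψ : EuclideanSpace ℝ (Fin 2) → E3 := fun w => point w (T w) with hΨ
  have hpointc : Continuous fun z : EuclideanSpace ℝ (Fin 2) × ℝ => point z.1 z.2 := by
    refine continuous_pt.comp (continuous_pi fun l => ?_)
    have := (hextc l).comp (continuous_fst (X := EuclideanSpace ℝ (Fin 2)) (Y := ℝ))
    exact continuous_const.mul (this.add continuous_snd)
  have hΨc : Continuous Ψ := hpointc.comp (continuous_id.prodMk hTlip.continuous)
  have hline : ∀ w, Continuous fun t => point w t := fun w =>
    hpointc.comp (continuous_const.prodMk continuous_id)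
  have hΨfr : ∀ w, Ψ w ∈ U → Ψ w ∈ frontier P := by
    intro w hw
    have hev : ∀ᶠ t in 𝓝 (T w), point w t ∈ U := ((hline w).tendsto (T w)).eventually_mem
      (hUo.mem_nhds hw)
    constructor
    · rw [mem_closure_iff_frequently]
      have h1 : ∃ᶠ t in 𝓝 (T w), point w t ∈ P := by
        have h2 : ∃ᶠ t in 𝓝[>] (T w), point w t ∈ P := by
          refine Eventually.frequently ?_
          filter_upwards [self_mem_nhdsWithin, nhdsWithin_le_nhds hev] with t ht htU
          exact hDU _ (habove w t ht) htU
        exact h2.filter_mono nhdsWithin_le_nhds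
      exact ((hline w).tendsto (T w)).frequently h1
    · intro hint
      have h1 : ∀ᶠ t in 𝓝 (T w), point w t ∈ P := ((hline w).tendsto (T w)).eventually
        (mem_interior_iff_mem_nhds.1 hint)
      have h2 : ∃ᶠ t in 𝓝[<] (T w), ¬ (point w t ∈ P ∧ point w t ∈ U) := by
        refine Eventually.frequently ?_
        filter_upwards [self_mem_nhdsWithin] with t ht hPU
        exact hbelow w t ht ⟨_, hPU, by simp⟩
      exact (h2.filter_mono nhdsWithin_le_nhds) ((h1.and hev).mono fun t ht hn => hn ht)
  have hΨproj : ∀ q ∈ frontier P, q ∈ U → Ψ (proj q) = q := by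
    intro q hq hqU
    have hqP : q ∈ P := by rw [← hc.closure_eq]; exact hq.1
    have hTq : T (proj q) = sgn (σ 2) * q 2 := by
      refine IsLeast.csInf_eq ⟨?_, fun t ht => ?_⟩
      · change point (proj q) _ ∈ D
        rw [hpp]; exact ⟨q, ⟨hqP, hqU⟩, by simp⟩
      · by_contra hlt
        push Not at hlt
        obtain ⟨u, ⟨huP, huU⟩, hu⟩ := ht
        refine hq.2 (mem_interior_iff_mem_nhds.2 ?_)
        have h0 : ∀ l, 0 < sgn (σ l) * (q l - u l) := by
          intro l
          have h1 := hu l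
          have h2 := hpt (proj q) (sgn (σ 2) * q 2) l
          rw [hpp] at h2
          rw [mul_sub, hpt] at h1
          rw [mul_sub, h2]
          linarith
        have h1 : ∀ᶠ x : E3 in 𝓝 q, ∀ l, 0 < sgn (σ l) * (x l - u l) := by
          rw [eventually_all]
          intro l
          have c1 : Continuous fun x : E3 => sgn (σ l) * (x l - u l) := by fun_prop
          exact (c1.tendsto q).eventually_const_lt (h0 l)
        filter_upwards [h1, hUo.mem_nhds hqU] with x hx hxU
        exact hmono u x huU hxU huP fun l => (hx l).le
    simp only [hΨ]
    rw [hTq, hpp]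
  set inv : EuclideanSpace ℝ (Fin 2) → frontier P := fun w =>
    if h : Ψ w ∈ frontier P then ⟨Ψ w, h⟩ else ⟨p, hp⟩ with hinv
  have hinvU : ∀ w, Ψ w ∈ U → (inv w : E3) = Ψ w := fun w hw => by
    simp only [hinv, dif_pos (hΨfr w hw)]
  refine ⟨OpenPartialHomeomorph.mk (PartialHomeomorph.mk
    { toFun := fun x => proj x
      invFun := inv
      source := {x | (x : E3) ∈ U}
      target := {w | Ψ w ∈ U}
      map_source' := ?_
      map_target' := ?_
      left_inv' := ?_
      right_inv' := ?_ } ?_ ?_) ?_ ?_, ?_⟩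
  · intro x hx
    simp only [mem_ofPred_eq] at hx ⊢
    rw [hΨproj x x.2 hx]; exact hx
  · intro w hw
    simp only [mem_ofPred_eq] at hw ⊢
    rw [hinvU w hw]; exact hw
  · intro x hx
    simp only [mem_ofPred_eq] at hx
    have h1 := hΨproj x x.2 hx
    exact Subtype.ext (by rw [hinvU _ (by rw [h1]; exact hx), h1])
  · intro w hw
    simp only [mem_ofPred_eq] at hw
    rw [hinvU w hw]
    exact hproj_point _ _
  · exact (hprojc.comp continuous_subtype_val).continuousOn
  · change ContinuousOn inv {w | Ψ w ∈ U}
    rw [IsInducing.subtypeVal.continuousOn_iff]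
    exact hΨc.continuousOn.congr fun w hw => hinvU w hw
  · exact hUo.preimage continuous_subtype_val
  · exact hUo.preimage hΨc
  · exact hpU

theorem nonempty_chartedSpace {P : Set E3} (hc : IsClosed P)
    (h : ∀ p ∈ frontier P, LocallyMonotoneAt P p) :
    Nonempty (ChartedSpace (EuclideanSpace ℝ (Fin 2)) (frontier P)) := by
  choose e he using fun p : frontier P => (h p p.2).exists_chart hc p.2
  exact ⟨{ atlas := range e
           chartAt := e
           mem_chart_source := he
           chart_mem_atlas := mem_range_self }⟩

/-! ### Boxes -/

/-- The closed box with opposite corners `a` and `b`. -/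
def box (a b : Fin 3 → ℝ) : Set E3 := {q | ∀ i, a i ≤ q i ∧ q i ≤ b i}

/-- The vertices of the tetrahedron of the points of a box whose normalized coordinates are ordered
by the permutation `σ`: a monotone path along edges of the box. -/
noncomputable def kuhnVertex (a b : Fin 3 → ℝ) (σ : Equiv.Perm (Fin 3)) (k : Fin 4) : E3 :=
  pt fun l => if (σ.symm l : ℕ) < k then b l else a l

theorem kuhn_affineIndependent {a b : Fin 3 → ℝ} (h : ∀ i, a i < b i) (σ : Equiv.Perm (Fin 3)) :
    AffineIndependent ℝ (kuhnVertex a b σ) := by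
  rw [affineIndependent_iff_of_fintype]
  intro w hw hv
  rw [Finset.weightedVSub_eq_linear_combination _ hw] at hv
  have hl : ∀ m : Fin 3, (∑ k, w k * (if (m : ℕ) < k then b (σ m) else a (σ m))) = 0 := by
    intro m
    have := congrArg (fun q : E3 => q (σ m)) hv
    simpa [kuhnVertex] using this
  have key : ∀ m : Fin 3, (∑ k, w k * (if (m : ℕ) < k then 1 else 0)) = 0 := by
    intro m
    have h1 := hl m
    have h2 : ∀ k : Fin 4, w k * (if (m : ℕ) < k then b (σ m) else a (σ m)) =
        (b (σ m) - a (σ m)) * (w k * (if (m : ℕ) < k then 1 else 0)) + a (σ m) * w k := by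
      intro k; split_ifs <;> ring
    simp only [h2] at h1
    rw [Finset.sum_add_distrib, ← Finset.mul_sum, ← Finset.mul_sum, hw, mul_zero, add_zero] at h1
    exact (mul_eq_zero.1 h1).resolve_left (sub_pos.2 (h _)).ne'
  have k0 := key 0
  have k1 := key 1
  have k2 := key 2
  simp [Fin.sum_univ_four] at k0 k1 k2 hw
  intro i
  fin_cases i <;> simp <;> linarith

theorem exists_sorting_perm (u : Fin 3 → ℝ) :
    ∃ σ : Equiv.Perm (Fin 3), u (σ 1) ≤ u (σ 0) ∧ u (σ 2) ≤ u (σ 1) := by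
  have h := Tuple.monotone_sort (fun i => -u i)
  refine ⟨Tuple.sort fun i => -u i, ?_, ?_⟩
  · have := h (show (0 : Fin 3) ≤ 1 by decide)
    simpa using this
  · have := h (show (1 : Fin 3) ≤ 2 by decide)
    simpa using this

theorem convex_box (a b : Fin 3 → ℝ) : Convex ℝ (box a b) := by
  intro x hx y hy α β hα hβ hαβ i
  obtain ⟨h1, h2⟩ := hx i
  obtain ⟨h3, h4⟩ := hy i
  obtain rfl : β = 1 - α := by linarith
  simp only [PiLp.add_apply, PiLp.smul_apply, smul_eq_mul]
  constructor <;> nlinarith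

/-- A box is the union of six tetrahedra. -/
theorem exists_tetrahedra_box {a b : Fin 3 → ℝ} (h : ∀ i, a i < b i) :
    ∃ 𝒯 : Set (Set E3), 𝒯.Finite ∧ (∀ T ∈ 𝒯, IsTetrahedron T) ∧ box a b = ⋃₀ 𝒯 := by
  refine ⟨range fun σ : Equiv.Perm (Fin 3) => convexHull ℝ (range (kuhnVertex a b σ)),
    finite_range _, ?_, subset_antisymm ?_ ?_⟩
  · rintro _ ⟨σ, rfl⟩
    exact ⟨_, kuhn_affineIndependent h σ, rfl⟩
  · intro q hq
    set u : Fin 3 → ℝ := fun l => (q l - a l) / (b l - a l) with hu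
    have hd : ∀ l, 0 < b l - a l := fun l => sub_pos.2 (h l)
    have hu0 : ∀ l, 0 ≤ u l := fun l => div_nonneg (by linarith [(hq l).1]) (hd l).le
    have hu1 : ∀ l, u l ≤ 1 := fun l => (div_le_one (hd l)).2 (by linarith [(hq l).2])
    have huq : ∀ l, q l = a l + u l * (b l - a l) := fun l => by
      simp only [hu]; rw [div_mul_cancel₀ _ (hd l).ne']; ring
    obtain ⟨σ, h1, h2⟩ := exists_sorting_perm u
    refine ⟨_, ⟨σ, rfl⟩, ?_⟩
    set w : Fin 4 → ℝ := ![1 - u (σ 0), u (σ 0) - u (σ 1), u (σ 1) - u (σ 2), u (σ 2)] with hw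
    have hsum : ∑ k, w k = 1 := by simp [hw, Fin.sum_univ_four]
    have hqw : q = ∑ k, w k • kuhnVertex a b σ k := by
      refine PiLp.ext fun l => ?_
      obtain ⟨m, rfl⟩ := σ.surjective l
      simp only [Fin.sum_univ_four, PiLp.add_apply, PiLp.smul_apply, smul_eq_mul, kuhnVertex,
        pt_apply, Equiv.symm_apply_apply]
      rw [huq (σ m)]
      fin_cases m <;> simp [hw] <;> ring
    rw [hqw]
    refine (convex_convexHull ℝ _).sum_mem (fun k _ => ?_) hsum
      fun k _ => subset_convexHull ℝ _ (mem_range_self k)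
    fin_cases k <;> simp [hw, hu0, hu1, h1, h2]
  · rintro q ⟨_, ⟨σ, rfl⟩, hq⟩
    refine convexHull_min ?_ (convex_box a b) hq
    rintro _ ⟨k, rfl⟩ i
    simp only [kuhnVertex, pt_apply]
    split_ifs <;> simp [(h i).le]

theorem isClosed_box (a b : Fin 3 → ℝ) : IsClosed (box a b) := by
  have : box a b = ⋂ i, {q : E3 | a i ≤ q i ∧ q i ≤ b i} := by
    ext; simp [box]
  rw [this]
  refine isClosed_iInter fun i => IsClosed.inter ?_ ?_
  · exact isClosed_le continuous_const (continuous_coord i)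
  · exact isClosed_le (continuous_coord i) continuous_const

theorem frontier_box {a b : Fin 3 → ℝ} {q : E3} (hq : q ∈ frontier (box a b)) :
    ∃ i, q i = a i ∨ q i = b i := by
  by_contra hcon
  push Not at hcon
  have hqb : q ∈ box a b := by rw [← (isClosed_box a b).closure_eq]; exact hq.1
  refine hq.2 (mem_interior_iff_mem_nhds.2 ?_)
  have : ∀ᶠ x : E3 in 𝓝 q, ∀ i, a i < x i ∧ x i < b i := by
    rw [eventually_all]
    intro i
    exact (((continuous_coord i).tendsto q).eventually_const_lt
        (lt_of_le_of_ne (hqb i).1 (hcon i).1.symm)).and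
      (((continuous_coord i).tendsto q).eventually_lt_const (lt_of_le_of_ne (hqb i).2 (hcon i).2))
  exact this.mono fun x hx i => ⟨(hx i).1.le, (hx i).2.le⟩

/-- `P` is a finite union of non-degenerate boxes. -/
def IsBoxUnion (P : Set E3) : Prop :=
  ∃ ℬ : Set ((Fin 3 → ℝ) × (Fin 3 → ℝ)), ℬ.Finite ∧ (∀ B ∈ ℬ, ∀ i, B.1 i < B.2 i) ∧
    P = ⋃ B ∈ ℬ, box B.1 B.2

theorem IsBoxUnion.isClosed {P : Set E3} (h : IsBoxUnion P) : IsClosed P := by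
  obtain ⟨ℬ, hfin, -, rfl⟩ := h
  exact hfin.isClosed_biUnion fun B _ => isClosed_box _ _

theorem IsBoxUnion.tetrahedra {P : Set E3} (h : IsBoxUnion P) :
    ∃ 𝒯 : Set (Set E3), 𝒯.Finite ∧ (∀ T ∈ 𝒯, IsTetrahedron T) ∧ P = ⋃₀ 𝒯 := by
  obtain ⟨ℬ, hfin, hlt, rfl⟩ := h
  choose! 𝒯 h1 h2 h3 using fun B hB => exists_tetrahedra_box (hlt B hB)
  refine ⟨⋃ B ∈ ℬ, 𝒯 B, hfin.biUnion h1, ?_, ?_⟩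
  · intro T hT
    simp only [mem_iUnion] at hT
    obtain ⟨B, hB, hT⟩ := hT
    exact h2 B hB T hT
  · rw [sUnion_iUnion]
    refine iUnion_congr fun B => ?_
    rw [sUnion_iUnion]
    exact iUnion_congr fun hB => h3 B hB

/-- Only coordinate planes have flat points on the boundary of a union of boxes. -/
theorem IsBoxUnion.exists_axis {P : Set E3} (h : IsBoxUnion P) {n : E3} (hn : n ≠ 0) {c : ℝ}
    {p : E3} (hp : p ∈ flatPart P n c) : ∃ i d, plane n c = plane (stdBasis i) d := by
  classical
  have hcl := h.isClosed
  obtain ⟨ℬ, hfin, hlt, rfl⟩ := h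
  set J : Finset (Fin 3 × ℝ) := hfin.toFinset.biUnion fun B =>
    Finset.univ.biUnion fun i => {(i, B.1 i), (i, B.2 i)} with hJ
  have hfr : ∀ q ∈ frontier (⋃ B ∈ ℬ, box B.1 B.2), ∃ j ∈ J, q ∈ plane (stdBasis j.1) j.2 := by
    intro q hq
    have hqP := hq.1
    rw [hcl.closure_eq] at hqP
    simp only [mem_iUnion] at hqP
    obtain ⟨B, hB, hqB⟩ := hqP
    have hsub : box B.1 B.2 ⊆ ⋃ B ∈ ℬ, box B.1 B.2 := subset_biUnion_of_mem
      (u := fun B : (Fin 3 → ℝ) × (Fin 3 → ℝ) => box B.1 B.2) hB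
    obtain ⟨i, hi⟩ := frontier_box (q := q)
      ⟨subset_closure hqB, fun hint => hq.2 (interior_mono hsub hint)⟩
    rcases hi with hi | hi
    · refine ⟨(i, B.1 i), ?_, mem_plane_std.2 hi⟩
      simp only [hJ, Finset.mem_biUnion, hfin.mem_toFinset]
      exact ⟨B, hB, i, Finset.mem_univ i, by simp⟩
    · refine ⟨(i, B.2 i), ?_, mem_plane_std.2 hi⟩
      simp only [hJ, Finset.mem_biUnion, hfin.mem_toFinset]
      exact ⟨B, hB, i, Finset.mem_univ i, by simp⟩
  obtain ⟨hpn, ε, hε, hball⟩ := hp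
  obtain ⟨j, -, V, hVU, hV, ⟨q, hqn, hqV⟩, hsub⟩ := exists_isOpen_subset_of_cover J
    (fun j => plane (stdBasis j.1) j.2) (fun j _ => isClosed_plane _ _) (plane n c) (ball p ε)
    isOpen_ball ⟨p, hpn, mem_ball_self hε⟩ (fun q hq => by
      obtain ⟨j, hj, hqj⟩ := hfr q (hball q hq.1 hq.2)
      simp only [mem_iUnion]
      exact ⟨j, hj, hqj⟩)
  obtain ⟨δ, hδ, hδV⟩ := Metric.isOpen_iff.1 hV q hqV
  exact ⟨j.1, j.2, plane_eq_of_local (p := q) hn (basis_ne_zero _ _)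
    ⟨hqn, δ, hδ, fun x hx hd => hsub ⟨hx, hδV hd⟩⟩⟩

theorem plane_std_injective {i j : Fin 3} {c d : ℝ}
    (h : plane (stdBasis i) c = plane (stdBasis j) d) : i = j ∧ c = d := by
  have key : ∀ x : E3, x i = c ↔ x j = d := fun x => by
    rw [← mem_plane_std, ← mem_plane_std, h]
  have hij : i = j := by
    by_contra hij
    have h1 := (key (pt fun l => if l = i then c else d + 1)).1 (by simp)
    simp [Ne.symm hij] at h1
  subst hij
  have h1 := (key (pt fun _ => c)).1 (by simp)
  exact ⟨rfl, by simpa using h1⟩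

/-- If every coordinate plane carries at most one face, the number of faces is the number of
coordinate planes that carry one. -/
theorem encard_faces_eq {P : Set E3} (h : IsBoxUnion P)
    (hconn : ∀ i c, IsPreconnected (flatPart P (stdBasis i) c)) :
    (faces P).encard = {j : Fin 3 × ℝ | (flatPart P (stdBasis j.1) j.2).Nonempty}.encard := by
  have himg : faces P = (fun j : Fin 3 × ℝ => closure (flatPart P (stdBasis j.1) j.2)) ''
      {j : Fin 3 × ℝ | (flatPart P (stdBasis j.1) j.2).Nonempty} := by
    ext F
    constructor
    · intro hF
      obtain ⟨n, hn, c, p, hp, rfl⟩ := exists_component_of_mem_faces hF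
      obtain ⟨i, d, hpl⟩ := h.exists_axis hn hp
      rw [flatPart_congr hpl P] at hp ⊢
      refine ⟨(i, d), ⟨p, hp⟩, ?_⟩
      rw [(hconn i d).connectedComponentIn hp]
    · rintro ⟨⟨i, d⟩, ⟨p, hp⟩, rfl⟩
      have := closure_component_mem_faces (basis_ne_zero stdBasis i) hp
      rwa [(hconn i d).connectedComponentIn hp] at this
  rw [himg]
  refine InjOn.encard_image ?_
  rintro ⟨i, c⟩ ⟨p, hp⟩ ⟨j, d⟩ - heq
  have hcl : closure (flatPart P (stdBasis i) c) ⊆ plane (stdBasis j) d := by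
    simp only at heq
    rw [heq]
    exact closure_minimal (flatPart_subset_plane _ _ _) (isClosed_plane _ _)
  have hpl : plane (stdBasis i) c = plane (stdBasis j) d := by
    refine plane_eq_of_local (p := p) (basis_ne_zero _ _) (basis_ne_zero _ _) ?_
    obtain ⟨hpn, ε, hε, hball⟩ := hp
    refine ⟨hpn, ε, hε, fun q hq hd => hcl (subset_closure ?_)⟩
    exact planeInterior_ball hball ⟨hd, hq⟩
  obtain ⟨rfl, rfl⟩ := plane_std_injective hpl
  rfl

theorem isOrthogonalPolyhedron_of_isBoxUnion {P : Set E3} (h : IsBoxUnion P)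
    (hconn : IsConnected P) (hmono : ∀ p ∈ frontier P, LocallyMonotoneAt P p) :
    IsOrthogonalPolyhedron P where
  isConnected := hconn
  tetrahedra := h.tetrahedra
  manifold := nonempty_chartedSpace h.isClosed hmono
  orthogonal := by
    refine ⟨stdBasis, fun F hF => ?_⟩
    obtain ⟨n, hn, c, p, hp, rfl⟩ := exists_component_of_mem_faces hF
    obtain ⟨i, d, hpl⟩ := h.exists_axis hn hp
    have hcl : closure (connectedComponentIn (flatPart P n c) p) ⊆ plane (stdBasis i) d := by
      rw [← hpl]
      exact closure_minimal ((connectedComponentIn_subset _ _).trans (flatPart_subset_plane _ _ _))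
        (isClosed_plane _ _)
    refine ⟨i, fun x hx y hy => ?_⟩
    have h1 := hcl hx
    have h2 := hcl hy
    rw [mem_plane] at h1 h2
    rw [inner_sub_right, h1, h2, sub_self]

/-! ### Staircase tubes -/

/-- The coordinates of a point after removal of the first segment of a tube: the inverse of
`shift`. -/
noncomputable def unshift (p : E3) : E3 := pt ![p 1, p 2, p 0 - 2]

/-- The rigid motion `(x, y, z) ↦ (2 + z, x, y)`, which carries a tube that starts at the origin in
direction `x` to one that starts at `(2, 0, 0)` in direction `y`. -/
noncomputable def shift (p : E3) : E3 := pt ![2 + p 2, p 0, p 1]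

@[simp] theorem unshift_zero (p : E3) : unshift p 0 = p 1 := rfl
@[simp] theorem unshift_one (p : E3) : unshift p 1 = p 2 := rfl
@[simp] theorem unshift_two (p : E3) : unshift p 2 = p 0 - 2 := rfl
@[simp] theorem shift_zero (p : E3) : shift p 0 = 2 + p 2 := rfl
@[simp] theorem shift_one (p : E3) : shift p 1 = p 0 := rfl
@[simp] theorem shift_two (p : E3) : shift p 2 = p 1 := rfl

@[simp] theorem unshift_shift (p : E3) : unshift (shift p) = p := by
  refine PiLp.ext fun i => ?_
  fin_cases i <;> simp

@[simp] theorem shift_unshift (p : E3) : shift (unshift p) = p := by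
  refine PiLp.ext fun i => ?_
  fin_cases i <;> simp

theorem continuous_shift : Continuous shift := by
  refine continuous_pt.comp (continuous_pi fun i => ?_)
  fin_cases i <;> simp <;> fun_prop

theorem continuous_unshift : Continuous unshift := by
  refine continuous_pt.comp (continuous_pi fun i => ?_)
  fin_cases i <;> simp <;> fun_prop

/-- Prepend to the tube `Q` a new first segment, in direction `x` and of height `h`. -/
def step (h : ℝ) (Q : Set E3) : Set E3 := {p | p ∈ box ![0, 0, 0] ![2, 1, h] ∨ unshift p ∈ Q}

/-- The tube with `n + 1` segments of square cross-section, in the directions `x`, `y`, `z`, `x`, …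
in turn. -/
def tube : ℕ → Set E3
  | 0 => box ![0, 0, 0] ![3, 1, 1]
  | n + 1 => step 1 (tube n)

theorem mem_box_iff {a₀ a₁ a₂ b₀ b₁ b₂ : ℝ} {p : E3} :
    p ∈ box ![a₀, a₁, a₂] ![b₀, b₁, b₂] ↔
      (a₀ ≤ p 0 ∧ p 0 ≤ b₀) ∧ (a₁ ≤ p 1 ∧ p 1 ≤ b₁) ∧ (a₂ ≤ p 2 ∧ p 2 ≤ b₂) := by
  simp [box, Fin.forall_fin_succ]

/-- The model of `step h Q` near its first segment. -/
def bend (h : ℝ) : Set E3 :=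
  {p | (0 ≤ p 0 ∧ p 0 ≤ 2 ∧ 0 ≤ p 1 ∧ p 1 ≤ 1 ∧ 0 ≤ p 2 ∧ p 2 ≤ h) ∨
    (2 ≤ p 0 ∧ p 0 ≤ 3 ∧ 0 ≤ p 1 ∧ 0 ≤ p 2 ∧ p 2 ≤ 1)}

theorem mem_bend {h : ℝ} {p : E3} : p ∈ bend h ↔
    (0 ≤ p 0 ∧ p 0 ≤ 2 ∧ 0 ≤ p 1 ∧ p 1 ≤ 1 ∧ 0 ≤ p 2 ∧ p 2 ≤ h) ∨
      (2 ≤ p 0 ∧ p 0 ≤ 3 ∧ 0 ≤ p 1 ∧ 0 ≤ p 2 ∧ p 2 ≤ 1) := Iff.rfl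

/-- Near its start, `Q` is a tube in direction `x` with cross-section the unit square. -/
def StandardStart (Q : Set E3) : Prop :=
  ∀ p : E3, p 0 < 2 → (p ∈ Q ↔ 0 ≤ p 0 ∧ 0 ≤ p 1 ∧ p 1 ≤ 1 ∧ 0 ≤ p 2 ∧ p 2 ≤ 1)

theorem mem_step {h : ℝ} {Q : Set E3} {p : E3} : p ∈ step h Q ↔
    ((0 ≤ p 0 ∧ p 0 ≤ 2) ∧ (0 ≤ p 1 ∧ p 1 ≤ 1) ∧ (0 ≤ p 2 ∧ p 2 ≤ h)) ∨ unshift p ∈ Q := by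
  rw [← mem_box_iff]; rfl

/-- Before `y = 2`, a prolonged tube does not depend on the tube. -/
theorem step_iff_bend {h : ℝ} {Q : Set E3} (hQ : StandardStart Q) {p : E3} (hp : p 1 < 2) :
    p ∈ step h Q ↔ p ∈ bend h := by
  rw [mem_step, mem_bend, hQ _ (by simpa using hp)]
  simp only [unshift_zero, unshift_one, unshift_two]
  grind

theorem step_iff_unshift {h : ℝ} {Q : Set E3} {p : E3} (hp : 1 < p 1) :
    p ∈ step h Q ↔ unshift p ∈ Q := by
  rw [mem_step]
  grind

theorem standardStart_step {Q : Set E3} (hnn : ∀ p ∈ Q, ∀ i, 0 ≤ p i) :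
    StandardStart (step 1 Q) := by
  intro p hp
  rw [mem_step]
  constructor
  · rintro (h | h)
    · grind
    · have := hnn _ h 2
      simp at this
      linarith
  · intro h
    left
    grind

theorem standardStart_tube_zero : StandardStart (tube 0) := by
  intro p hp
  rw [tube, mem_box_iff]
  grind

theorem nonneg_step {h : ℝ} {Q : Set E3} (hnn : ∀ p ∈ Q, ∀ i, 0 ≤ p i) :
    ∀ p ∈ step h Q, ∀ i, 0 ≤ p i := by
  intro p hp i
  rcases mem_step.1 hp with h | h
  · fin_cases i
    exacts [h.1.1, h.2.1.1, h.2.2.1]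
  · have h0 := hnn _ h 0
    have h1 := hnn _ h 1
    have h2 := hnn _ h 2
    simp at h0 h1 h2
    fin_cases i <;> simp <;> linarith

theorem isBoxUnion_box {a b : Fin 3 → ℝ} (h : ∀ i, a i < b i) : IsBoxUnion (box a b) :=
  ⟨{(a, b)}, finite_singleton _, by simpa using h, by simp⟩

theorem IsBoxUnion.step {h : ℝ} (hh : 0 < h) {Q : Set E3} (hQ : IsBoxUnion Q) :
    IsBoxUnion (step h Q) := by
  obtain ⟨ℬ, hfin, hlt, rfl⟩ := hQ
  set g : (Fin 3 → ℝ) × (Fin 3 → ℝ) → (Fin 3 → ℝ) × (Fin 3 → ℝ) := fun B =>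
    (![2 + B.1 2, B.1 0, B.1 1], ![2 + B.2 2, B.2 0, B.2 1]) with hg
  refine ⟨insert (![0, 0, 0], ![2, 1, h]) (g '' ℬ), (hfin.image g).insert _, ?_, ?_⟩
  · rintro B (rfl | ⟨B, hB, rfl⟩) i
    · fin_cases i <;> simp [hh]
    · fin_cases i <;> simp [hg, hlt B hB]
  · ext p
    simp only [FaceGuards.step, mem_ofPred_eq, mem_iUnion, biUnion_insert, mem_union, biUnion_image]
    refine or_congr Iff.rfl (exists_congr fun B => exists_congr fun _ => ?_)
    simp only [hg, box, mem_ofPred_eq, Fin.forall_fin_succ]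
    simp
    grind

theorem isConnected_step {h : ℝ} (hh : 0 ≤ h) {Q : Set E3} (hQ : IsConnected Q)
    (hst : StandardStart Q) : IsConnected (step h Q) := by
  have h1 : step h Q = box ![0, 0, 0] ![2, 1, h] ∪ shift '' Q := by
    ext p
    simp only [step, mem_ofPred_eq, mem_union, mem_image]
    refine or_congr Iff.rfl ⟨fun hp => ⟨_, hp, shift_unshift p⟩, ?_⟩
    rintro ⟨q, hq, rfl⟩
    rwa [unshift_shift]
  rw [h1]
  have hm1 : pt ![2, 0, 0] ∈ box ![0, 0, 0] ![2, 1, h] := by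
    rw [mem_box_iff]; simp [hh]
  have hm2 : pt ![2, 0, 0] ∈ shift '' Q := by
    refine ⟨pt ![0, 0, 0], (hst _ (by simp)).2 (by simp), PiLp.ext fun i => ?_⟩
    fin_cases i <;> simp
  exact IsConnected.union ⟨_, hm1, hm2⟩ ⟨⟨_, hm1⟩, (convex_box _ _).isPreconnected⟩
    (hQ.image _ continuous_shift.continuousOn)

/-! ### Local monotonicity of tubes -/

theorem LocallyMonotoneAt.congr {P Q : Set E3} {p : E3} (h : LocallyMonotoneAt Q p)
    (hPQ : ∀ᶠ q in 𝓝 p, (q ∈ P ↔ q ∈ Q)) : LocallyMonotoneAt P p := by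
  obtain ⟨σ, ρ, hρ, hmono⟩ := h
  obtain ⟨ε, hε, hPQ⟩ := eventually_nhds_iff_coord.1 hPQ
  refine ⟨σ, min ρ ε, lt_min hρ hε, fun q r hq hr hqP hqr => ?_⟩
  rw [hPQ r fun l => (hr l).trans_le (min_le_right _ _)]
  rw [hPQ q fun l => (hq l).trans_le (min_le_right _ _)] at hqP
  exact hmono q r (fun l => (hq l).trans_le (min_le_left _ _))
    (fun l => (hr l).trans_le (min_le_left _ _)) hqP hqr

theorem LocallyMonotoneAt.unshift {Q : Set E3} {p : E3} (h : LocallyMonotoneAt Q (unshift p)) :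
    LocallyMonotoneAt {q | FaceGuards.unshift q ∈ Q} p := by
  obtain ⟨σ, ρ, hρ, hmono⟩ := h
  refine ⟨![σ 2, σ 0, σ 1], ρ, hρ, fun q r hq hr hqP hqr => ?_⟩
  have hcoord : ∀ x : E3, (∀ l, |x l - p l| < ρ) →
      ∀ l, |FaceGuards.unshift x l - FaceGuards.unshift p l| < ρ := by
    intro x hx l
    fin_cases l
    · exact hx 1
    · exact hx 2
    · simpa using hx 0
  refine hmono _ _ (hcoord q hq) (hcoord r hr) hqP fun l => ?_
  fin_cases l
  · exact hqr 1
  · exact hqr 2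
  · simpa using hqr 0

/-- The meaning of monotonicity in the direction chosen by comparison of `x` with `c`. -/
theorem sgn_side {c x : ℝ} [Decidable (x < c)] {y z : ℝ}
    (h : 0 ≤ sgn (decide (x < c)) * (z - y)) :
    (x < c ∧ y ≤ z) ∨ (c ≤ x ∧ z ≤ y) := by
  by_cases hx : x < c
  · simp only [hx, decide_true, sgn_true] at h
    exact Or.inl ⟨hx, by linarith⟩
  · simp only [hx, decide_false, sgn_false] at h
    exact Or.inr ⟨not_lt.1 hx, by linarith⟩

theorem locallyMonotoneAt_box {a b : Fin 3 → ℝ} (h : ∀ i, a i < b i) (p : E3) :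
    LocallyMonotoneAt (box a b) p := by
  classical
  obtain ⟨ρ, hρ, hρab⟩ : ∃ ρ > 0, ∀ i, ρ ≤ (b i - a i) / 2 := by
    refine ⟨min ((b 0 - a 0) / 2) (min ((b 1 - a 1) / 2) ((b 2 - a 2) / 2)), ?_, fun i => ?_⟩
    · have h0 := h 0
      have h1 := h 1
      have h2 := h 2
      refine lt_min (by linarith) (lt_min (by linarith) (by linarith))
    · fin_cases i <;> simp
  -- towards the centre of the box
  refine ⟨fun l => decide (p l < (a l + b l) / 2), ρ, hρ, fun q r hq hr hqP hqr i => ?_⟩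
  obtain ⟨h1, h1'⟩ := hqP i
  obtain ⟨h2, h2'⟩ := abs_lt.1 (hr i)
  have h3 := hρab i
  rcases sgn_side (hqr i) with h4 | h4 <;> constructor <;> linarith

theorem locallyMonotoneAt_bend {h : ℝ} (h0 : 0 < h) (h1 : h ≤ 1) (p : E3) :
    LocallyMonotoneAt (bend h) p := by
  classical
  obtain ⟨ρ, hρ, hρh, hρ1, hρ2⟩ : ∃ ρ > 0, ρ ≤ h / 4 ∧ (p 0 < 2 → ρ ≤ 2 - p 0) ∧
      (2 < p 0 → ρ ≤ p 0 - 2) := by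
    rcases lt_trichotomy (p 0) 2 with h2 | h2 | h2
    · exact ⟨min (h / 4) (2 - p 0), lt_min (by linarith) (by linarith), min_le_left _ _,
        fun _ => min_le_right _ _, fun h3 => by linarith⟩
    · exact ⟨h / 4, by linarith, le_rfl, fun _ => by linarith, fun _ => by linarith⟩
    · exact ⟨min (h / 4) (p 0 - 2), lt_min (by linarith) (by linarith), min_le_left _ _,
        fun h3 => by linarith, fun _ => min_le_right _ _⟩
  -- towards the second segment and the interior of the cross-sections
  refine ⟨![decide (p 0 < 5 / 2), decide (p 1 < 1 / 2), decide (p 2 < h / 2)], ρ, hρ,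
    fun q r hq hr hqP hqr => ?_⟩
  have e0 := sgn_side (hqr 0)
  have e1 := sgn_side (hqr 1)
  have e2 := sgn_side (hqr 2)
  have q0 := abs_lt.1 (hq 0)
  have r0 := abs_lt.1 (hr 0)
  have r1 := abs_lt.1 (hr 1)
  have r2 := abs_lt.1 (hr 2)
  rw [mem_bend] at hqP ⊢
  have hy : 0 ≤ q 1 → 0 ≤ r 1 := fun hq1 => by rcases e1 with e | e <;> linarith
  have hy' : q 1 ≤ 1 → r 1 ≤ 1 := fun hq1 => by rcases e1 with e | e <;> linarith
  have hz : 0 ≤ q 2 → 0 ≤ r 2 := fun hq1 => by rcases e2 with e | e <;> linarith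
  have hz' : q 2 ≤ 1 → r 2 ≤ 1 := fun hq1 => by rcases e2 with e | e <;> linarith
  have hz'' : q 2 ≤ h → r 2 ≤ h := fun hq1 => by rcases e2 with e | e <;> linarith
  rcases hqP with ⟨a1, a2, a3, a4, a5, a6⟩ | ⟨a1, a2, a3, a4, a5⟩
  · have hp2 : p 0 ≤ 2 := by
      by_contra hcon
      push Not at hcon
      linarith [hρ2 hcon]
    have hx : q 0 ≤ r 0 := by rcases e0 with e | e <;> linarith
    rcases le_total (r 0) 2 with h3 | h3
    · exact Or.inl ⟨by linarith, h3, hy a3, hy' a4, hz a5, hz'' a6⟩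
    · exact Or.inr ⟨h3, by linarith, hy a3, hz a5, hz' (by linarith)⟩
  · have hp2 : 2 ≤ p 0 := by
      by_contra hcon
      push Not at hcon
      linarith [hρ1 hcon]
    refine Or.inr ⟨?_, ?_, hy a3, hz a4, hz' a5⟩
    · rcases e0 with e | e
      · linarith
      · linarith
    · rcases e0 with e | e <;> linarith

theorem locallyMonotoneAt_step {h : ℝ} (h0 : 0 < h) (h1 : h ≤ 1) {Q : Set E3}
    (hst : StandardStart Q) (hQ : ∀ p, LocallyMonotoneAt Q p) (p : E3) :
    LocallyMonotoneAt (step h Q) p := by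
  rcases lt_or_ge (p 1) 2 with hp | hp
  · refine (locallyMonotoneAt_bend h0 h1 p).congr ?_
    filter_upwards [((continuous_coord 1).tendsto p).eventually_lt_const hp] with q hq
    exact step_iff_bend hst hq
  · refine (LocallyMonotoneAt.unshift (hQ (FaceGuards.unshift p))).congr ?_
    filter_upwards [((continuous_coord 1).tendsto p).eventually_const_lt
      (show (1 : ℝ) < p 1 by linarith)] with q hq
    exact step_iff_unshift hq

/-! ### Bounds for tubes -/

/-- The bounds satisfied by a tube that passes monotonically through the corners with coordinates
`(2k + 2, 2k, 2k)`, `(2k + 2, 2k + 2, 2k)` and `(2k + 2, 2k + 2, 2k + 2)`. -/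
structure StaircaseBounds (P : Set E3) : Prop where
  x_lt : ∀ k : ℤ, ∀ p ∈ P, p 0 < 2 * k + 2 → p 1 ≤ 2 * k + 1 ∧ p 2 ≤ 2 * k + 1
  lt_x : ∀ k : ℤ, ∀ p ∈ P, 2 * k + 1 < p 0 → 2 * k ≤ p 1 ∧ 2 * k ≤ p 2
  y_lt : ∀ k : ℤ, ∀ p ∈ P, p 1 < 2 * k + 2 → p 0 ≤ 2 * k + 3 ∧ p 2 ≤ 2 * k + 1
  lt_y : ∀ k : ℤ, ∀ p ∈ P, 2 * k + 1 < p 1 → 2 * k + 2 ≤ p 0 ∧ 2 * k ≤ p 2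
  z_lt : ∀ k : ℤ, ∀ p ∈ P, p 2 < 2 * k + 2 → p 0 ≤ 2 * k + 3 ∧ p 1 ≤ 2 * k + 3
  lt_z : ∀ k : ℤ, ∀ p ∈ P, 2 * k + 1 < p 2 → 2 * k + 2 ≤ p 0 ∧ 2 * k + 2 ≤ p 1

theorem nonneg_of_lt {k : ℤ} {x : ℝ} (h0 : 0 ≤ x) (h : x < 2 * k + 2) : (0 : ℝ) ≤ k := by
  have : (-1 : ℝ) < k := by linarith
  have : (-1 : ℤ) < k := by exact_mod_cast this
  exact_mod_cast (by omega : (0 : ℤ) ≤ k)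

theorem neg_of_lt {k : ℤ} {x : ℝ} (h0 : x ≤ 1) (h : 2 * k + 1 < x) : (k : ℝ) ≤ -1 := by
  have : (k : ℝ) < 0 := by linarith
  have : k < (0 : ℤ) := by exact_mod_cast this
  exact_mod_cast (by omega : k ≤ -1)

theorem staircaseBounds_box {a h : ℝ} (ha : a ≤ 3) (h1 : h ≤ 1) :
    StaircaseBounds (box ![0, 0, 0] ![a, 1, h]) := by
  constructor <;> intro k p hp hk <;> rw [mem_box_iff] at hp <;>
    obtain ⟨⟨x0, x1⟩, ⟨y0, y1⟩, z0, z1⟩ := hp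
  · have := nonneg_of_lt x0 hk
    constructor <;> linarith
  · have : (k : ℝ) < 1 := by linarith
    have : k < (1 : ℤ) := by exact_mod_cast this
    have : (k : ℝ) ≤ 0 := by exact_mod_cast (by omega : k ≤ 0)
    constructor <;> linarith
  · have := nonneg_of_lt y0 hk
    constructor <;> linarith
  · have := neg_of_lt y1 hk
    constructor <;> linarith
  · have := nonneg_of_lt z0 hk
    constructor <;> linarith
  · have := neg_of_lt (z1.trans h1) hk
    constructor <;> linarith

theorem StaircaseBounds.step {h : ℝ} (h1 : h ≤ 1) {Q : Set E3} (hQ : StaircaseBounds Q) :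
    StaircaseBounds (step h Q) := by
  have hB := staircaseBounds_box (a := 2) (by norm_num) h1
  constructor <;> intro k p hp hk <;> rcases hp with hp | hp
  · exact hB.x_lt k p hp hk
  · have := hQ.z_lt (k - 1) _ hp (by push_cast; simp; linarith)
    push_cast at this; simp at this
    constructor <;> linarith [this.1, this.2]
  · exact hB.lt_x k p hp hk
  · have := hQ.lt_z (k - 1) _ hp (by push_cast; simp; linarith)
    push_cast at this; simp at this
    constructor <;> linarith [this.1, this.2]
  · exact hB.y_lt k p hp hk
  · have := hQ.x_lt k _ hp (by simpa using hk)
    simp at this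
    constructor <;> linarith [this.1, this.2]
  · exact hB.lt_y k p hp hk
  · have := hQ.lt_x k _ hp (by simpa using hk)
    simp at this
    constructor <;> linarith [this.1, this.2]
  · exact hB.z_lt k p hp hk
  · have := hQ.y_lt k _ hp (by simpa using hk)
    simp at this
    constructor <;> linarith [this.1, this.2]
  · exact hB.lt_z k p hp hk
  · have := hQ.lt_y k _ hp (by simpa using hk)
    simp at this
    constructor <;> linarith [this.1, this.2]

/-! ### Flat points of staircase tubes -/

/-- Near `p`, the set `P` is the half-space on the side of sign `s` of the plane through `p`
orthogonal to the `i`-th coordinate axis. -/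
def FlatAt (P : Set E3) (i : Fin 3) (s : ℝ) (p : E3) : Prop :=
  (s = 1 ∨ s = -1) ∧ ∀ᶠ q : E3 in 𝓝 p, (q ∈ P ↔ 0 ≤ s * (q i - p i))

theorem FlatAt.mem {P : Set E3} {i : Fin 3} {s : ℝ} {p : E3} (h : FlatAt P i s p) : p ∈ P :=
  h.2.self_of_nhds.2 (by simp)

theorem FlatAt.congr {P Q : Set E3} {i : Fin 3} {s : ℝ} {p : E3}
    (hPQ : ∀ᶠ q in 𝓝 p, (q ∈ P ↔ q ∈ Q)) : FlatAt P i s p ↔ FlatAt Q i s p := by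
  refine and_congr_right fun _ => ⟨fun h => ?_, fun h => ?_⟩
  · filter_upwards [h, hPQ] with q h1 h2
    rw [← h2, h1]
  · filter_upwards [h, hPQ] with q h1 h2
    rw [h2, h1]

/-- For a closed locally monotone set, the flat parts in coordinate planes consist of points where
the set is a half-space. -/
theorem mem_flatPart_iff {P : Set E3} (hc : IsClosed P) (hmono : ∀ p, LocallyMonotoneAt P p)
    {i : Fin 3} {c : ℝ} {p : E3} :
    p ∈ flatPart P (stdBasis i) c ↔ p i = c ∧ ∃ s, FlatAt P i s p := by
  constructor
  · intro hp
    obtain ⟨s, hs, h⟩ := (hmono p).halfSpaceAt hc hp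
    have hpc : p i = c := mem_plane_std.1 hp.1
    subst hpc
    exact ⟨rfl, s, hs, halfSpaceAt_std.1 h⟩
  · rintro ⟨rfl, s, hs, h⟩
    exact HalfSpaceAt.mem_flatPart hs (halfSpaceAt_std.2 h) (stdBasis_repr p i)

theorem eventually_coord_lt {p : E3} {i : Fin 3} {c : ℝ} (h : p i < c) :
    ∀ᶠ q : E3 in 𝓝 p, q i < c :=
  ((continuous_coord i).tendsto p).eventually_lt_const h

theorem eventually_lt_coord {p : E3} {i : Fin 3} {c : ℝ} (h : c < p i) :
    ∀ᶠ q : E3 in 𝓝 p, c < q i :=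
  ((continuous_coord i).tendsto p).eventually_const_lt h

theorem flatAt_one {P : Set E3} {i : Fin 3} {p : E3} (h : ∀ᶠ q : E3 in 𝓝 p, (q ∈ P ↔ p i ≤ q i)) :
    FlatAt P i 1 p := ⟨Or.inl rfl, by simpa using h⟩

theorem flatAt_neg_one {P : Set E3} {i : Fin 3} {p : E3}
    (h : ∀ᶠ q : E3 in 𝓝 p, (q ∈ P ↔ q i ≤ p i)) : FlatAt P i (-1) p :=
  ⟨Or.inr rfl, by simpa using h⟩

/-- Near a flat point, the points in the interiors of the eight octants lie in `P` or not according
to the side. The `δ` is so small that moving by `δ` crosses none of the values in `C`. -/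
theorem FlatAt.octant {P : Set E3} {i : Fin 3} {s : ℝ} {p : E3} (h : FlatAt P i s p)
    (C : Finset ℝ) : ∃ δ : ℝ,
      (∀ j, ∀ c ∈ C, ∀ a, (c ≤ p j + sgn a * δ ↔ if a then c ≤ p j else c < p j) ∧
        (p j + sgn a * δ ≤ c ↔ if a then p j < c else p j ≤ c)) ∧
      ∀ σ : Fin 3 → Bool, (pt fun l => p l + sgn (σ l) * δ) ∈ P ↔ sgn (σ i) = s := by
  obtain ⟨hs, h⟩ := h
  obtain ⟨ε, hε, h⟩ := eventually_nhds_iff_coord.1 h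
  obtain ⟨η, hη, hgap⟩ := exists_gaps C p
  obtain ⟨δ, hδ, hδε, hδη⟩ : ∃ δ > 0, δ < ε ∧ δ < η := by
    obtain ⟨δ, h1, h2⟩ := exists_between (lt_min hε hη)
    exact ⟨δ, h1, h2.trans_le (min_le_left _ _), h2.trans_le (min_le_right _ _)⟩
  refine ⟨δ, fun j c hc a => ?_, fun σ => ?_⟩
  · have hlt : p j < c → p j + δ < c := fun hlt => by
      by_contra hcon
      refine hgap j c ?_ hlt.ne' hc
      rw [abs_lt]; constructor <;> linarith
    have hgt : c < p j → c < p j - δ := fun hlt => by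
      by_contra hcon
      refine hgap j c ?_ hlt.ne hc
      rw [abs_lt]; constructor <;> linarith
    rcases lt_trichotomy (p j) c with h3 | h3 | h3
    · specialize hlt h3
      cases a <;> simp only [sgn_true, sgn_false, if_true, Bool.false_eq_true, if_false] <;>
        constructor <;> constructor <;> intro h4 <;> linarith
    · cases a <;> simp only [sgn_true, sgn_false, if_true, Bool.false_eq_true, if_false] <;>
        constructor <;> constructor <;> intro h4 <;> linarith
    · specialize hgt h3
      cases a <;> simp only [sgn_true, sgn_false, if_true, Bool.false_eq_true, if_false] <;>
        constructor <;> constructor <;> intro h4 <;> linarith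
  · rw [h _ fun j => ?_]
    · simp only [pt_apply, add_sub_cancel_left]
      rcases hs with rfl | rfl <;> cases σ i <;> norm_num [hδ, hδ.le]
    · simp only [pt_apply, add_sub_cancel_left]
      rw [abs_lt]
      cases σ j <;> simp only [sgn_true, sgn_false] <;> constructor <;> linarith

/-- `FlatAt.octant` for the bend. Strict and weak inequalities account for the octant of the
neighbouring point, so that no `δ` remains in the statement. -/
theorem FlatAt.bend_octant {h : ℝ} {i : Fin 3} {s : ℝ} {p : E3} (H : FlatAt (bend h) i s p)
    (σ : Fin 3 → Bool) : sgn (σ i) = s ↔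
      ((if σ 0 then 0 ≤ p 0 ∧ p 0 < 2 else 0 < p 0 ∧ p 0 ≤ 2) ∧
        (if σ 1 then 0 ≤ p 1 ∧ p 1 < 1 else 0 < p 1 ∧ p 1 ≤ 1) ∧
        (if σ 2 then 0 ≤ p 2 ∧ p 2 < h else 0 < p 2 ∧ p 2 ≤ h)) ∨
      ((if σ 0 then 2 ≤ p 0 ∧ p 0 < 3 else 2 < p 0 ∧ p 0 ≤ 3) ∧
        (if σ 1 then 0 ≤ p 1 else 0 < p 1) ∧
        (if σ 2 then 0 ≤ p 2 ∧ p 2 < 1 else 0 < p 2 ∧ p 2 ≤ 1)) := by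
  obtain ⟨δ, key, hoct⟩ := H.octant {0, 1, 2, 3, h}
  rw [← hoct, mem_bend]
  simp only [pt_apply]
  have k0 := fun j => key j 0 (by simp)
  have k1 := fun j => key j 1 (by simp)
  have k2 := fun j => key j 2 (by simp)
  have k3 := fun j => key j 3 (by simp)
  have kh := fun j => key j h (by simp)
  simp only [k0, k1, k2, k3, kh]
  cases σ 0 <;> cases σ 1 <;> cases σ 2 <;> simp [and_assoc]

theorem flatAt_box {i : Fin 3} {s : ℝ} {p : E3} {a b : Fin 3 → ℝ} (hab : ∀ l, a l < b l) :
    FlatAt (box a b) i s p ↔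
      ((p i = a i ∧ s = 1) ∨ (p i = b i ∧ s = -1)) ∧ ∀ j, j ≠ i → a j < p j ∧ p j < b j := by
  classical
  constructor
  · intro H
    obtain ⟨δ, key, hoct⟩ := H.octant (Finset.univ.image a ∪ Finset.univ.image b)
    have ka := fun j => key j (a j) (by simp)
    have kb := fun j => key j (b j) (by simp)
    have h1 : ∀ σ : Fin 3 → Bool, sgn (σ i) = s ↔
        ∀ l, (if σ l then a l ≤ p l else a l < p l) ∧ (if σ l then p l < b l else p l ≤ b l) := by
      intro σ
      rw [← hoct]
      exact forall_congr' fun l => and_congr (ka l _).1 (kb l _).2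
    have h2 : ∀ x y : Bool, sgn x = s ↔
        ((if x then a i ≤ p i else a i < p i) ∧ (if x then p i < b i else p i ≤ b i)) ∧ ∀ l, l ≠ i →
          ((if y then a l ≤ p l else a l < p l) ∧ (if y then p l < b l else p l ≤ b l)) := by
      intro x y
      have := h1 fun l => if l = i then x else y
      simp only [if_true] at this
      rw [this]
      constructor
      · intro h
        refine ⟨by simpa using h i, fun l hl => by simpa [hl] using h l⟩
      · rintro ⟨h3, h4⟩ l
        by_cases hl : l = i
        · subst hl; simpa using h3
        · simpa [hl] using h4 l hl
    have e1 := h2 true true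
    have e2 := h2 true false
    have e3 := h2 false true
    have e4 := h2 false false
    have := hab i
    simp at e1 e2 e3 e4
    rcases H.1 with rfl | rfl <;> norm_num at e1 e2 e3 e4 ⊢ <;> grind
  · rintro ⟨⟨e, rfl⟩ | ⟨e, rfl⟩, h⟩
    · refine flatAt_one ?_
      have h1 : ∀ᶠ q : E3 in 𝓝 p, ∀ j, j ≠ i → a j < q j ∧ q j < b j := by
        rw [eventually_all]
        intro j
        by_cases hj : j = i
        · simp [hj]
        · filter_upwards [eventually_lt_coord (h j hj).1,
            eventually_coord_lt (h j hj).2] with q x y _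
          exact ⟨x, y⟩
      filter_upwards [h1, eventually_coord_lt (show p i < b i by linarith [hab i])] with q hq hqi
      rw [e]
      refine ⟨fun hq => (hq i).1, fun hqa j => ?_⟩
      by_cases hj : j = i
      · subst hj; exact ⟨hqa, hqi.le⟩
      · exact ⟨(hq j hj).1.le, (hq j hj).2.le⟩
    · refine flatAt_neg_one ?_
      have h1 : ∀ᶠ q : E3 in 𝓝 p, ∀ j, j ≠ i → a j < q j ∧ q j < b j := by
        rw [eventually_all]
        intro j
        by_cases hj : j = i
        · simp [hj]
        · filter_upwards [eventually_lt_coord (h j hj).1,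
            eventually_coord_lt (h j hj).2] with q x y _
          exact ⟨x, y⟩
      filter_upwards [h1, eventually_lt_coord (show a i < p i by linarith [hab i])] with q hq hqi
      rw [e]
      refine ⟨fun hq => (hq i).2, fun hqa j => ?_⟩
      by_cases hj : j = i
      · subst hj; exact ⟨hqi.le, hqa⟩
      · exact ⟨(hq j hj).1.le, (hq j hj).2.le⟩

/-- The flat points of the bend orthogonal to the `x`-axis. -/
theorem flatAt_bend_zero {h : ℝ} (h0 : 0 < h) (h1 : h ≤ 1) {s : ℝ} {p : E3} :
    FlatAt (bend h) 0 s p ↔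
      (p 0 = 0 ∧ s = 1 ∧ 0 < p 1 ∧ p 1 < 1 ∧ 0 < p 2 ∧ p 2 < h) ∨
      (p 0 = 2 ∧ s = 1 ∧ 0 < p 1 ∧ 0 < p 2 ∧ p 2 < 1 ∧ (1 < p 1 ∨ h < p 2)) ∨
      (p 0 = 3 ∧ s = -1 ∧ 0 < p 1 ∧ 0 < p 2 ∧ p 2 < 1) := by
  constructor
  · intro H
    have o1 := H.bend_octant ![true, true, true]
    have o2 := H.bend_octant ![true, true, false]
    have o3 := H.bend_octant ![true, false, true]
    have o4 := H.bend_octant ![true, false, false]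
    have o5 := H.bend_octant ![false, true, true]
    have o6 := H.bend_octant ![false, true, false]
    have o7 := H.bend_octant ![false, false, true]
    have o8 := H.bend_octant ![false, false, false]
    simp at o1 o2 o3 o4 o5 o6 o7 o8
    rcases H.1 with rfl | rfl <;> norm_num at o1 o2 o3 o4 o5 o6 o7 o8 ⊢ <;> grind
  · rintro (⟨e, rfl, a, b, c, d⟩ | ⟨e, rfl, a, b, c, d | d⟩ | ⟨e, rfl, a, b, c⟩)
    · refine flatAt_one ?_
      filter_upwards [eventually_coord_lt (show p 0 < 2 by linarith), eventually_lt_coord a,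
        eventually_coord_lt b, eventually_lt_coord c, eventually_coord_lt d] with q h1 h2 h3 h4 h5
      rw [mem_bend, e]
      grind
    · refine flatAt_one ?_
      filter_upwards [eventually_coord_lt (show p 0 < 3 by linarith), eventually_lt_coord a,
        eventually_lt_coord b, eventually_coord_lt c, eventually_lt_coord d] with q h1 h2 h3 h4 h5
      rw [mem_bend, e]
      grind
    · refine flatAt_one ?_
      filter_upwards [eventually_coord_lt (show p 0 < 3 by linarith), eventually_lt_coord a,
        eventually_lt_coord b, eventually_coord_lt c, eventually_lt_coord d] with q h1 h2 h3 h4 h5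
      rw [mem_bend, e]
      grind
    · refine flatAt_neg_one ?_
      filter_upwards [eventually_lt_coord (show 2 < p 0 by linarith), eventually_lt_coord a,
        eventually_lt_coord b, eventually_coord_lt c] with q h1 h2 h3 h4
      rw [mem_bend, e]
      grind

/-- The flat points of the bend orthogonal to the `y`-axis. -/
theorem flatAt_bend_one {h : ℝ} (h0 : 0 < h) (h1 : h ≤ 1) {s : ℝ} {p : E3} :
    FlatAt (bend h) 1 s p ↔
      (p 1 = 0 ∧ s = 1 ∧ 0 < p 0 ∧ p 0 < 3 ∧ 0 < p 2 ∧ p 2 < 1 ∧ (2 < p 0 ∨ p 2 < h)) ∨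
      (p 1 = 1 ∧ s = -1 ∧ 0 < p 0 ∧ p 0 < 2 ∧ 0 < p 2 ∧ p 2 < h) := by
  constructor
  · intro H
    have o1 := H.bend_octant ![true, true, true]
    have o2 := H.bend_octant ![true, true, false]
    have o3 := H.bend_octant ![true, false, true]
    have o4 := H.bend_octant ![true, false, false]
    have o5 := H.bend_octant ![false, true, true]
    have o6 := H.bend_octant ![false, true, false]
    have o7 := H.bend_octant ![false, false, true]
    have o8 := H.bend_octant ![false, false, false]
    simp at o1 o2 o3 o4 o5 o6 o7 o8
    rcases H.1 with rfl | rfl <;> norm_num at o1 o2 o3 o4 o5 o6 o7 o8 ⊢ <;> grind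
  · rintro (⟨e, rfl, a, b, c, d, f | f⟩ | ⟨e, rfl, a, b, c, d⟩)
    · refine flatAt_one ?_
      filter_upwards [eventually_lt_coord f, eventually_coord_lt b, eventually_lt_coord c,
        eventually_coord_lt d] with q h1 h2 h3 h4
      rw [mem_bend, e]
      grind
    · refine flatAt_one ?_
      filter_upwards [eventually_lt_coord a, eventually_coord_lt b, eventually_lt_coord c,
        eventually_coord_lt f, eventually_coord_lt (show p 1 < 1 by linarith)] with q h1 h2 h3 h4 h5
      rw [mem_bend, e]
      grind
    · refine flatAt_neg_one ?_
      filter_upwards [eventually_lt_coord a, eventually_coord_lt b, eventually_lt_coord c,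
        eventually_coord_lt d, eventually_lt_coord (show 0 < p 1 by linarith)] with q h1 h2 h3 h4 h5
      rw [mem_bend, e]
      grind

/-- The flat points of the bend orthogonal to the `z`-axis. The planes `z = h` and `z = 1` carry
different faces if `h < 1`; for `h = 1` the top of the first segment belongs to `z = 1`. -/
theorem flatAt_bend_two {h : ℝ} (h0 : 0 < h) (h1 : h ≤ 1) {s : ℝ} {p : E3} :
    FlatAt (bend h) 2 s p ↔
      (p 2 = 0 ∧ s = 1 ∧ 0 < p 0 ∧ p 0 < 3 ∧ 0 < p 1 ∧ (2 < p 0 ∨ p 1 < 1)) ∨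
      (p 2 = h ∧ h < 1 ∧ s = -1 ∧ 0 < p 0 ∧ p 0 < 2 ∧ 0 < p 1 ∧ p 1 < 1) ∨
      (p 2 = 1 ∧ s = -1 ∧ 0 < p 0 ∧ p 0 < 3 ∧ 0 < p 1 ∧ (2 < p 0 ∨ (h = 1 ∧ p 1 < 1))) := by
  constructor
  · intro H
    have o1 := H.bend_octant ![true, true, true]
    have o2 := H.bend_octant ![true, true, false]
    have o3 := H.bend_octant ![true, false, true]
    have o4 := H.bend_octant ![true, false, false]
    have o5 := H.bend_octant ![false, true, true]
    have o6 := H.bend_octant ![false, true, false]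
    have o7 := H.bend_octant ![false, false, true]
    have o8 := H.bend_octant ![false, false, false]
    simp at o1 o2 o3 o4 o5 o6 o7 o8
    rcases H.1 with rfl | rfl <;> norm_num at o1 o2 o3 o4 o5 o6 o7 o8 ⊢ <;> grind
  · rintro (⟨e, rfl, a, b, c, f | f⟩ | ⟨e, d, rfl, a, b, c, f⟩ | ⟨e, rfl, a, b, c, f | ⟨rfl, f⟩⟩)
    · refine flatAt_one ?_
      filter_upwards [eventually_lt_coord f, eventually_coord_lt b, eventually_lt_coord c,
        eventually_coord_lt (show p 2 < 1 by linarith)] with q h1 h2 h3 h4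
      rw [mem_bend, e]
      grind
    · refine flatAt_one ?_
      filter_upwards [eventually_lt_coord a, eventually_coord_lt b, eventually_lt_coord c,
        eventually_coord_lt f, eventually_coord_lt (show p 2 < h by linarith)] with q h1 h2 h3 h4 h5
      rw [mem_bend, e]
      grind
    · refine flatAt_neg_one ?_
      filter_upwards [eventually_lt_coord a, eventually_coord_lt b, eventually_lt_coord c,
        eventually_coord_lt f, eventually_lt_coord (show 0 < p 2 by linarith)] with q h1 h2 h3 h4 h5
      rw [mem_bend, e]
      grind
    · refine flatAt_neg_one ?_
      filter_upwards [eventually_lt_coord f, eventually_coord_lt b, eventually_lt_coord c,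
        eventually_lt_coord (show 0 < p 2 by linarith)] with q h1 h2 h3 h4
      rw [mem_bend, e]
      grind
    · refine flatAt_neg_one ?_
      filter_upwards [eventually_lt_coord a, eventually_coord_lt b, eventually_lt_coord c,
        eventually_coord_lt f, eventually_lt_coord (show 0 < p 2 by linarith)] with q h1 h2 h3 h4 h5
      rw [mem_bend, e]
      grind

/-! ### The faces of staircase tubes -/

/-- The points beyond `x = t` near which the boundary of `P` is the plane where the `i`-th
coordinate equals `c`. -/
def flatFrom (t : ℝ) (P : Set E3) (i : Fin 3) (c : ℝ) : Set E3 :=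
  {p | t < p 0 ∧ p i = c ∧ ∃ s, FlatAt P i s p}

/-- The coordinate planes that carry a face of `P` with a relative interior point beyond
`x = t`. -/
def planes (t : ℝ) (P : Set E3) : Set (Fin 3 × ℝ) := {j | (flatFrom t P j.1 j.2).Nonempty}

/-- The image of a coordinate plane under `shift`. -/
def next (j : Fin 3 × ℝ) : Fin 3 × ℝ := (j.1 + 1, j.2 + if j.1 = 2 then 2 else 0)

/-- The image of a coordinate plane under `unshift`. -/
def prev (j : Fin 3 × ℝ) : Fin 3 × ℝ := (j.1 + 2, j.2 - if j.1 = 0 then 2 else 0)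

theorem prev_next (j : Fin 3 × ℝ) : prev (next j) = j := by
  obtain ⟨i, c⟩ := j
  fin_cases i <;> simp [prev, next]

theorem next_prev (j : Fin 3 × ℝ) : next (prev j) = j := by
  obtain ⟨i, c⟩ := j
  fin_cases i <;> simp [prev, next]

theorem unshift_coord (p : E3) (i : Fin 3) :
    unshift p (i + 2) = p i - if i = 0 then 2 else 0 := by
  fin_cases i <;> simp

/-- A set that contains, with each of its points, the box spanned by this point and `u` is
connected. -/
theorem isPreconnected_of_between {S : Set E3} {u : E3}
    (h : ∀ p ∈ S, ∀ q : E3, (∀ j, q j ∈ uIcc (p j) (u j)) → q ∈ S) : IsPreconnected S := by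
  refine isPreconnected_of_forall u fun p hp => ⟨segment ℝ p u, ?_, right_mem_segment _ _ _,
    left_mem_segment _ _ _, (convex_segment _ _).isPreconnected⟩
  rintro q ⟨a, b, ha, hb, hab, rfl⟩
  exact h p hp _ fun j =>
    convex_uIcc (p j) (u j) left_mem_uIcc right_mem_uIcc ha hb hab

/-- The planes that carry a face of `step h Q`, with flat points beyond `x = t`, on its first
segment only. -/
def firstPlanes (t h : ℝ) : Set (Fin 3 × ℝ) :=
  {j | (j.1 = 0 ∧ j.2 = 0 ∧ t < 0) ∨ (j.1 = 1 ∧ j.2 = 0) ∨ (j.1 = 1 ∧ j.2 = 1) ∨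
    (j.1 = 2 ∧ j.2 = h ∧ h < 1)}

theorem exists_flatAt_bend_zero {h : ℝ} (h0 : 0 < h) (h1 : h ≤ 1) {p : E3} :
    (∃ s, FlatAt (bend h) 0 s p) ↔
      (p 0 = 0 ∧ 0 < p 1 ∧ p 1 < 1 ∧ 0 < p 2 ∧ p 2 < h) ∨
      (p 0 = 2 ∧ 0 < p 1 ∧ 0 < p 2 ∧ p 2 < 1 ∧ (1 < p 1 ∨ h < p 2)) ∨
      (p 0 = 3 ∧ 0 < p 1 ∧ 0 < p 2 ∧ p 2 < 1) := by
  simp only [flatAt_bend_zero h0 h1, exists_or, exists_and_left, exists_eq_left]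

theorem exists_flatAt_bend_one {h : ℝ} (h0 : 0 < h) (h1 : h ≤ 1) {p : E3} :
    (∃ s, FlatAt (bend h) 1 s p) ↔
      (p 1 = 0 ∧ 0 < p 0 ∧ p 0 < 3 ∧ 0 < p 2 ∧ p 2 < 1 ∧ (2 < p 0 ∨ p 2 < h)) ∨
      (p 1 = 1 ∧ 0 < p 0 ∧ p 0 < 2 ∧ 0 < p 2 ∧ p 2 < h) := by
  simp only [flatAt_bend_one h0 h1, exists_or, exists_and_left, exists_eq_left]

theorem exists_flatAt_bend_two {h : ℝ} (h0 : 0 < h) (h1 : h ≤ 1) {p : E3} :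
    (∃ s, FlatAt (bend h) 2 s p) ↔
      (p 2 = 0 ∧ 0 < p 0 ∧ p 0 < 3 ∧ 0 < p 1 ∧ (2 < p 0 ∨ p 1 < 1)) ∨
      (p 2 = h ∧ h < 1 ∧ 0 < p 0 ∧ p 0 < 2 ∧ 0 < p 1 ∧ p 1 < 1) ∨
      (p 2 = 1 ∧ 0 < p 0 ∧ p 0 < 3 ∧ 0 < p 1 ∧ (2 < p 0 ∨ (h = 1 ∧ p 1 < 1))) := by
  simp only [flatAt_bend_two h0 h1, exists_or, exists_and_left, exists_eq_left]

/-- The flat points of the bend in a coordinate plane form a set that is star-shaped with respect to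
boxes, and that extends beyond `y = 1` unless the plane is one of the first planes. -/
def IsStarPlane (t h : ℝ) (i : Fin 3) (c : ℝ) : Prop :=
  ∃ u ∈ flatFrom t (bend h) i c, u 1 < 2 ∧
    (∀ p ∈ flatFrom t (bend h) i c, ∀ q : E3, (∀ j, q j ∈ uIcc (p j) (u j)) →
      q ∈ flatFrom t (bend h) i c) ∧
    ((i, c) ∈ firstPlanes t h ∨ ∃ v ∈ flatFrom t (bend h) i c, 1 < v 1 ∧ v 1 < 2)

theorem isStarPlane_zero {t h : ℝ} (h0 : 0 < h) (h1 : h ≤ 1) (ht : t ≤ 1) {p : E3}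
    (hp : p ∈ flatFrom t (bend h) 0 (p 0)) (hp1 : p 1 < 2) : IsStarPlane t h 0 (p 0) := by
  obtain ⟨k, hk0, hk⟩ := exists_between h0
  -- the face in `x = 2` is L-shaped if `h < 1`, with corner at `y = 1`, `z = h`
  obtain ⟨z, hz0, hz1, hz⟩ : ∃ z, 0 < z ∧ z < 1 ∧ (h < z ∨ h = 1) := by
    rcases h1.lt_or_eq with h2 | h2
    · obtain ⟨z, hz, hz1⟩ := exists_between h2
      exact ⟨z, h0.trans hz, hz1, Or.inl hz⟩
    · exact ⟨1 / 2, by norm_num, by norm_num, Or.inr h2⟩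
  simp only [IsStarPlane, flatFrom, mem_ofPred_eq, exists_flatAt_bend_zero h0 h1, mem_uIcc,
    Fin.forall_fin_succ, firstPlanes, true_and] at hp ⊢
  obtain ⟨hpt, hp⟩ := hp
  rcases hp with hp | hp | hp
  · refine ⟨pt ![0, 1 / 2, k], ?_, ?_, ?_, Or.inl ?_⟩ <;> simp <;>
      beta_reduce at * <;> grind (splits := 40)
  · refine ⟨pt ![2, 3 / 2, z], ?_, ?_, ?_, Or.inr ⟨pt ![2, 3 / 2, z], ?_, ?_⟩⟩ <;> simp <;>
      beta_reduce at * <;> grind (splits := 40)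
  · refine ⟨pt ![3, 3 / 2, 1 / 2], ?_, ?_, ?_, Or.inr ⟨pt ![3, 3 / 2, 1 / 2], ?_, ?_⟩⟩ <;> simp <;>
      beta_reduce at * <;> grind (splits := 40)

theorem isStarPlane_one {t h : ℝ} (h0 : 0 < h) (h1 : h ≤ 1) (ht : t ≤ 1) {p : E3}
    (hp : p ∈ flatFrom t (bend h) 1 (p 1)) (hp1 : p 1 < 2) : IsStarPlane t h 1 (p 1) := by
  obtain ⟨k, hk0, hk⟩ := exists_between h0
  simp only [IsStarPlane, flatFrom, mem_ofPred_eq, exists_flatAt_bend_one h0 h1, mem_uIcc,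
    Fin.forall_fin_succ, firstPlanes, true_and] at hp ⊢
  obtain ⟨hpt, hp⟩ := hp
  rcases hp with hp | hp
  · refine ⟨pt ![5 / 2, 0, k], ?_, ?_, ?_, Or.inl ?_⟩ <;> simp <;>
      beta_reduce at * <;> grind (splits := 40)
  · refine ⟨pt ![3 / 2, 1, k], ?_, ?_, ?_, Or.inl ?_⟩ <;> simp <;>
      beta_reduce at * <;> grind (splits := 40)

theorem isStarPlane_two {t h : ℝ} (h0 : 0 < h) (h1 : h ≤ 1) (ht : t ≤ 1) {p : E3}
    (hp : p ∈ flatFrom t (bend h) 2 (p 2)) (hp1 : p 1 < 2) : IsStarPlane t h 2 (p 2) := by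
  simp only [IsStarPlane, flatFrom, mem_ofPred_eq, exists_flatAt_bend_two h0 h1, mem_uIcc,
    Fin.forall_fin_succ, firstPlanes, true_and] at hp ⊢
  obtain ⟨hpt, hp⟩ := hp
  rcases hp with hp | hp | hp
  · refine ⟨pt ![5 / 2, 1 / 2, 0], ?_, ?_, ?_, Or.inr ⟨pt ![5 / 2, 3 / 2, 0], ?_, ?_⟩⟩ <;> simp <;>
      beta_reduce at * <;> grind (splits := 40)
  · refine ⟨pt ![3 / 2, 1 / 2, h], ?_, ?_, ?_, Or.inl ?_⟩ <;> simp <;>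
      beta_reduce at * <;> grind (splits := 40)
  · refine ⟨pt ![5 / 2, 1 / 2, 1], ?_, ?_, ?_, Or.inr ⟨pt ![5 / 2, 3 / 2, 1], ?_, ?_⟩⟩ <;> simp <;>
      beta_reduce at * <;> grind (splits := 40)

theorem isStarPlane_of_mem {t h : ℝ} (h0 : 0 < h) (h1 : h ≤ 1) (ht : t ≤ 1) {i : Fin 3}
    {c : ℝ} {p : E3} (hp : p ∈ flatFrom t (bend h) i c) (hp1 : p 1 < 2) : IsStarPlane t h i c := by
  obtain rfl : p i = c := hp.2.1
  fin_cases i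
  exacts [isStarPlane_zero h0 h1 ht hp hp1, isStarPlane_one h0 h1 ht hp hp1,
    isStarPlane_two h0 h1 ht hp hp1]

/-! ### Faces of a prolonged tube -/

theorem flatAt_step_near {h : ℝ} {Q : Set E3} (hst : StandardStart Q) {i : Fin 3} {s : ℝ} {p : E3}
    (hp : p 1 < 2) : FlatAt (step h Q) i s p ↔ FlatAt (bend h) i s p :=
  FlatAt.congr ((eventually_coord_lt hp).mono fun _ hq => step_iff_bend hst hq)

theorem flatAt_step_far {h : ℝ} {Q : Set E3} {i : Fin 3} {s : ℝ} {p : E3}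
    (hp : 1 < p 1) : FlatAt (step h Q) i s p ↔ FlatAt Q (i + 2) s (unshift p) := by
  rw [FlatAt.congr (P := step h Q) (Q := {q | unshift q ∈ Q})
    ((eventually_lt_coord hp).mono fun _ hq => step_iff_unshift hq)]
  refine and_congr_right fun _ => ⟨fun H => ?_, fun H => ?_⟩
  · have h1 : Tendsto shift (𝓝 (unshift p)) (𝓝 p) := by
      simpa using continuous_shift.tendsto (unshift p)
    filter_upwards [h1.eventually H] with q hq
    have h2 := unshift_coord (shift q) i
    have h3 := unshift_coord p i
    rw [unshift_shift] at h2
    simp only [unshift_shift] at hq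
    rw [hq, h2, h3, sub_sub_sub_cancel_right]
  · filter_upwards [(continuous_unshift.tendsto p).eventually H] with q hq
    rw [unshift_coord, unshift_coord, sub_sub_sub_cancel_right] at hq
    exact hq

/-- The properties of a staircase tube by which it can be prolonged at its start. -/
structure IsStaircase (Q : Set E3) : Prop where
  isBoxUnion : IsBoxUnion Q
  isConnected : IsConnected Q
  standardStart : StandardStart Q
  nonneg : ∀ p ∈ Q, ∀ i, 0 ≤ p i
  locallyMonotoneAt : ∀ p, LocallyMonotoneAt Q p
  bounds : StaircaseBounds Q
  side : ∀ i s p, FlatAt Q i s p →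
    ∃ k : ℤ, (s = 1 ∧ p i = 2 * k) ∨ (s = -1 ∧ p i = 2 * k + 1)
  isPreconnected : ∀ i c, IsPreconnected (flatFrom 1 Q i c)

theorem IsStaircase.flatAt_step {h : ℝ} (h0 : 0 < h) (h1 : h ≤ 1) {Q : Set E3} (hQ : IsStaircase Q)
    {i : Fin 3} {s : ℝ} {p : E3} (H : FlatAt (step h Q) i s p) :
    (∃ k : ℤ, (s = 1 ∧ p i = 2 * k) ∨ (s = -1 ∧ p i = 2 * k + 1)) ∨
      (i = 2 ∧ h < 1 ∧ s = -1 ∧ p i = h) := by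
  rcases lt_or_ge (p 1) 2 with hp | hp
  · rw [flatAt_step_near hQ.standardStart hp] at H
    fin_cases i
    · rcases (flatAt_bend_zero h0 h1).1 H with H | H | H
      · exact Or.inl ⟨0, Or.inl ⟨H.2.1, by simpa using H.1⟩⟩
      · exact Or.inl ⟨1, Or.inl ⟨H.2.1, by simpa using H.1⟩⟩
      · refine Or.inl ⟨1, Or.inr ⟨H.2.1, ?_⟩⟩
        simp only [Fin.zero_eta, H.1]; norm_num
    · rcases (flatAt_bend_one h0 h1).1 H with H | H
      · exact Or.inl ⟨0, Or.inl ⟨H.2.1, by simpa using H.1⟩⟩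
      · exact Or.inl ⟨0, Or.inr ⟨H.2.1, by simpa using H.1⟩⟩
    · rcases (flatAt_bend_two h0 h1).1 H with H | H | H
      · exact Or.inl ⟨0, Or.inl ⟨H.2.1, by simpa using H.1⟩⟩
      · exact Or.inr ⟨rfl, H.2.1, H.2.2.1, H.1⟩
      · exact Or.inl ⟨0, Or.inr ⟨H.2.1, by simpa using H.1⟩⟩
  · rw [flatAt_step_far (by linarith)] at H
    obtain ⟨k, hk⟩ := hQ.side _ _ _ H
    rw [unshift_coord] at hk
    by_cases hi : i = 0
    · simp only [hi, if_true] at hk ⊢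
      refine Or.inl ⟨k + 1, ?_⟩
      push_cast
      rcases hk with hk | hk
      · exact Or.inl ⟨hk.1, by linarith⟩
      · exact Or.inr ⟨hk.1, by linarith⟩
    · simp only [hi, if_false, sub_zero] at hk
      exact Or.inl ⟨k, hk⟩

theorem IsStaircase.flatFrom_step_far {h t : ℝ} (ht : t ≤ 1) {Q : Set E3} (hQ : IsStaircase Q)
    (j : Fin 3 × ℝ) : flatFrom t (step h Q) j.1 j.2 ∩ {p | 1 < p 1} =
      shift '' flatFrom 1 Q (prev j).1 (prev j).2 := by
  ext p
  constructor
  · rintro ⟨⟨-, hpc, s, H⟩, hp1⟩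
    rw [flatAt_step_far hp1] at H
    refine ⟨unshift p, ⟨hp1, ?_, s, H⟩, shift_unshift p⟩
    simp only [prev]
    rw [← hpc]
    exact unshift_coord p j.1
  · rintro ⟨q, ⟨hq1, hqc, s, H⟩, rfl⟩
    have h1 : 1 < shift q 1 := by simpa using hq1
    refine ⟨⟨?_, ?_, s, ?_⟩, h1⟩
    · have := hQ.nonneg q H.mem 2
      simp
      linarith
    · have := unshift_coord (shift q) j.1
      rw [unshift_shift] at this
      simp only [prev] at hqc
      linarith
    · rw [flatAt_step_far h1, unshift_shift]
      exact H

/-- The first planes carry no face of the prolonged tube `Q`. -/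
theorem IsStaircase.le_one_of_firstPlanes {h t : ℝ} (h0 : 0 < h) {Q : Set E3} (hQ : IsStaircase Q)
    {j : Fin 3 × ℝ} (hj : j ∈ firstPlanes t h) {p : E3} (hp : p ∈ flatFrom t (step h Q) j.1 j.2) :
    p 1 ≤ 1 := by
  obtain ⟨i, c⟩ := j
  by_contra! hcon
  obtain ⟨-, hpc, s, H⟩ := hp
  rw [flatAt_step_far hcon] at H
  simp only [firstPlanes, mem_ofPred_eq] at hj hpc
  rcases hj with ⟨rfl, rfl, -⟩ | ⟨rfl, rfl⟩ | ⟨rfl, rfl⟩ | ⟨rfl, rfl, hc⟩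
  · have := hQ.nonneg _ H.mem 2
    simp at this
    linarith
  · linarith
  · linarith
  · obtain ⟨k, hk⟩ := hQ.side _ _ _ H
    rw [unshift_coord] at hk
    rw [if_neg (show ¬(2 : Fin 3) = 0 by decide), sub_zero, hpc] at hk
    rcases hk with ⟨-, hk⟩ | ⟨-, hk⟩
    · have h1 : (0 : ℝ) < k := by linarith
      have h2 : (k : ℝ) < 1 := by linarith
      norm_cast at h1 h2
      omega
    · have h1 : (-1 : ℝ) < k := by linarith
      have h2 : (k : ℝ) < 0 := by linarith
      norm_cast at h1 h2
      omega

theorem flatFrom_step_near {h t : ℝ} {Q : Set E3} (hst : StandardStart Q) {i : Fin 3} {c : ℝ}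
    {p : E3} (hp : p 1 < 2) : p ∈ flatFrom t (step h Q) i c ↔ p ∈ flatFrom t (bend h) i c := by
  simp only [flatFrom, mem_ofPred_eq, flatAt_step_near hst hp]

/-- No coordinate plane carries two faces of a prolonged tube: the part of its flat points before
`y = 2` is star-shaped, the part beyond `y = 1` comes from the given tube, and they overlap or
one of them is empty. -/
theorem IsStaircase.isPreconnected_flatFrom_step {h t : ℝ} (h0 : 0 < h) (h1 : h ≤ 1) (ht : t ≤ 1)
    {Q : Set E3} (hQ : IsStaircase Q) (i : Fin 3) (c : ℝ) :
    IsPreconnected (flatFrom t (step h Q) i c) := by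
  set F := flatFrom t (step h Q) i c with hF
  have hnear : ∀ {p : E3}, p 1 < 2 → (p ∈ F ↔ p ∈ flatFrom t (bend h) i c) := fun hp =>
    flatFrom_step_near hQ.standardStart hp
  have hfar : IsPreconnected (F ∩ {p | 1 < p 1}) := by
    rw [hF, hQ.flatFrom_step_far ht (i, c)]
    exact (hQ.isPreconnected _ _).image _ continuous_shift.continuousOn
  by_cases hN : ∃ p ∈ F, p 1 < 2
  · obtain ⟨p, hp, hp1⟩ := hN
    obtain ⟨u, hu, hu1, hbet, hor⟩ := isStarPlane_of_mem h0 h1 ht ((hnear hp1).1 hp) hp1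
    have hW : IsPreconnected (F ∩ {p | p 1 < 2}) := by
      refine isPreconnected_of_between (u := u) ?_
      rintro p ⟨hp, hp1⟩ q hq
      have hq1 : q 1 < 2 := by
        rcases mem_uIcc.1 (hq 1) with h | h
        exacts [h.2.trans_lt hu1, h.2.trans_lt hp1]
      exact ⟨(hnear hq1).2 (hbet p ((hnear hp1).1 hp) q hq), hq1⟩
    rcases hor with hfirst | ⟨v, hv, hv1, hv2⟩
    · have : F = F ∩ {p | p 1 < 2} := by
        refine (inter_eq_left.2 fun p hp => ?_).symm
        have := hQ.le_one_of_firstPlanes h0 hfirst hp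
        simp only [mem_ofPred_eq]
        linarith
      rw [this]; exact hW
    · have : F = (F ∩ {p | p 1 < 2}) ∪ (F ∩ {p | 1 < p 1}) := by
        rw [← inter_union_distrib_left]
        refine (inter_eq_left.2 fun p _ => ?_).symm
        rcases lt_or_ge (p 1) 2 with h | h
        · exact Or.inl h
        · exact Or.inr (show 1 < p 1 by linarith)
      rw [this]
      exact hW.union v ⟨(hnear hv2).2 hv, hv2⟩ ⟨(hnear hv2).2 hv, hv1⟩ hfar
  · push Not at hN
    have : F = F ∩ {p | 1 < p 1} := by
      refine (inter_eq_left.2 fun p hp => ?_).symm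
      have := hN p hp
      simp only [mem_ofPred_eq]
      linarith
    rw [this]; exact hfar

theorem IsStaircase.step {Q : Set E3} (hQ : IsStaircase Q) : IsStaircase (step 1 Q) where
  isBoxUnion := hQ.isBoxUnion.step one_pos
  isConnected := isConnected_step zero_le_one hQ.isConnected hQ.standardStart
  standardStart := standardStart_step hQ.nonneg
  nonneg := nonneg_step hQ.nonneg
  locallyMonotoneAt := locallyMonotoneAt_step one_pos le_rfl hQ.standardStart hQ.locallyMonotoneAt
  bounds := hQ.bounds.step le_rfl
  side i s p H := by
    rcases hQ.flatAt_step one_pos le_rfl H with H | H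
    · exact H
    · exact absurd H.2.1 (lt_irrefl _)
  isPreconnected := hQ.isPreconnected_flatFrom_step one_pos le_rfl le_rfl

theorem nonempty_flatFrom_of_firstPlanes {h t : ℝ} (h0 : 0 < h) (h1 : h ≤ 1) (ht : t ≤ 1)
    {j : Fin 3 × ℝ} (hj : j ∈ firstPlanes t h) : ∃ p ∈ flatFrom t (bend h) j.1 j.2, p 1 < 2 := by
  obtain ⟨i, c⟩ := j
  simp only [firstPlanes, mem_ofPred_eq] at hj
  rcases hj with ⟨rfl, rfl, hlt⟩ | ⟨rfl, rfl⟩ | ⟨rfl, rfl⟩ | ⟨rfl, rfl, hc⟩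
  · refine ⟨pt ![0, 1 / 2, h / 2], ⟨by simpa using hlt, by simp,
      (exists_flatAt_bend_zero h0 h1).2 (Or.inl ?_)⟩, ?_⟩ <;> simp <;> grind
  · refine ⟨pt ![3 / 2, 0, h / 2], ⟨?_, by simp,
      (exists_flatAt_bend_one h0 h1).2 (Or.inl ?_)⟩, ?_⟩ <;> simp <;> grind
  · refine ⟨pt ![3 / 2, 1, h / 2], ⟨?_, by simp,
      (exists_flatAt_bend_one h0 h1).2 (Or.inr ?_)⟩, ?_⟩ <;> simp <;> grind
  · refine ⟨pt ![3 / 2, 1 / 2, c], ⟨?_, by simp,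
      (exists_flatAt_bend_two h0 h1).2 (Or.inr (Or.inl ?_))⟩, ?_⟩ <;> simp <;> grind

/-- A prolonged tube has faces in the first planes and in the planes of the given tube. Only planes
with flat points beyond `x = 1` count for the latter, since its start has become interior. -/
theorem IsStaircase.planes_step {h t : ℝ} (h0 : 0 < h) (h1 : h ≤ 1) (ht : t ≤ 1)
    {Q : Set E3} (hQ : IsStaircase Q) :
    planes t (FaceGuards.step h Q) = firstPlanes t h ∪ next '' planes 1 Q := by
  have hfar : ∀ j p, p ∈ flatFrom t (FaceGuards.step h Q) j.1 j.2 → 1 < p 1 →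
      j ∈ next '' planes 1 Q := by
    intro j p hp hp1
    have : p ∈ flatFrom t (FaceGuards.step h Q) j.1 j.2 ∩ {p | 1 < p 1} := ⟨hp, hp1⟩
    rw [hQ.flatFrom_step_far ht] at this
    obtain ⟨q, hq, -⟩ := this
    exact ⟨prev j, ⟨q, hq⟩, next_prev j⟩
  ext j
  constructor
  · rintro ⟨p, hp⟩
    rcases lt_or_ge (p 1) 2 with hp1 | hp1
    · have hb := (flatFrom_step_near hQ.standardStart hp1).1 hp
      obtain ⟨-, -, -, -, hfirst | ⟨v, hv, hv1, hv2⟩⟩ := isStarPlane_of_mem h0 h1 ht hb hp1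
      · exact Or.inl hfirst
      · exact Or.inr (hfar j v ((flatFrom_step_near hQ.standardStart hv2).2 hv) hv1)
    · exact Or.inr (hfar j p hp (by linarith))
  · rintro (hj | ⟨j, ⟨q, hq⟩, rfl⟩)
    · obtain ⟨p, hp, hp1⟩ := nonempty_flatFrom_of_firstPlanes h0 h1 ht hj
      exact ⟨p, (flatFrom_step_near hQ.standardStart hp1).2 hp⟩
    · have : shift q ∈ shift '' flatFrom 1 Q (prev (next j)).1 (prev (next j)).2 := by
        rw [prev_next]; exact mem_image_of_mem _ hq
      rw [← hQ.flatFrom_step_far (h := h) ht] at this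
      exact ⟨_, this.1⟩

theorem IsStaircase.encard_planes_step {h t : ℝ} (h0 : 0 < h) (h1 : h ≤ 1) (ht : t ≤ 1)
    {Q : Set E3} (hQ : IsStaircase Q) :
    (planes t (FaceGuards.step h Q)).encard = (firstPlanes t h).encard + (planes 1 Q).encard := by
  rw [hQ.planes_step h0 h1 ht, encard_union_eq,
    (Function.LeftInverse.injective prev_next).encard_image]
  rw [disjoint_left]
  rintro _ hj ⟨j, ⟨q, hq⟩, rfl⟩
  have : shift q ∈ shift '' flatFrom 1 Q (prev (next j)).1 (prev (next j)).2 := by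
    rw [prev_next]; exact mem_image_of_mem _ hq
  rw [← hQ.flatFrom_step_far (h := h) ht] at this
  have h2 := hQ.le_one_of_firstPlanes h0 hj this.1
  have h3 : 1 < shift q 1 := this.2
  linarith

/-! ### The number of faces of a tube -/

theorem nonneg_tube_zero : ∀ p ∈ tube 0, ∀ i, 0 ≤ p i := by
  intro p hp i
  rw [tube, mem_box_iff] at hp
  fin_cases i
  exacts [hp.1.1, hp.2.1.1, hp.2.2.1]

theorem tube_zero_lt (l : Fin 3) : (![0, 0, 0] : Fin 3 → ℝ) l < (![3, 1, 1] : Fin 3 → ℝ) l := by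
  fin_cases l <;> simp

theorem isPreconnected_flatFrom_tube_zero (t : ℝ) (i : Fin 3) (c : ℝ) :
    IsPreconnected (flatFrom t (tube 0) i c) := by
  rcases (flatFrom t (tube 0) i c).eq_empty_or_nonempty with h | ⟨u, hut, huc, s, hu⟩
  · rw [h]; exact isPreconnected_empty
  · rw [tube, flatAt_box tube_zero_lt] at hu
    refine isPreconnected_of_between (u := u) ?_
    rintro p ⟨hpt, hpc, s', hp⟩ q hq
    rw [tube, flatAt_box tube_zero_lt] at hp
    have hqc : q i = c := by
      have := hq i
      rwa [hpc, huc, uIcc_self, mem_singleton_iff] at this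
    refine ⟨?_, hqc, s, ?_⟩
    · rcases mem_uIcc.1 (hq 0) with h | h
      exacts [hpt.trans_le h.1, hut.trans_le h.1]
    · rw [tube, flatAt_box tube_zero_lt, hqc, ← huc]
      refine ⟨hu.1, fun j hj => ?_⟩
      obtain ⟨h1, h2⟩ := hp.2 j hj
      obtain ⟨h3, h4⟩ := hu.2 j hj
      rcases mem_uIcc.1 (hq j) with h | h
      exacts [⟨h1.trans_le h.1, h.2.trans_lt h4⟩, ⟨h3.trans_le h.1, h.2.trans_lt h2⟩]

theorem isStaircase_tube_zero : IsStaircase (tube 0) where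
  isBoxUnion := isBoxUnion_box tube_zero_lt
  isConnected := ⟨⟨pt ![0, 0, 0], by rw [tube, mem_box_iff]; simp⟩,
    (convex_box _ _).isPreconnected⟩
  standardStart := standardStart_tube_zero
  nonneg := nonneg_tube_zero
  locallyMonotoneAt := locallyMonotoneAt_box tube_zero_lt
  bounds := staircaseBounds_box le_rfl le_rfl
  side i s p H := by
    rw [tube, flatAt_box tube_zero_lt] at H
    rcases H.1 with ⟨h, hs⟩ | ⟨h, hs⟩
    · refine ⟨0, Or.inl ⟨hs, ?_⟩⟩
      rw [h]
      fin_cases i <;> simp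
    · fin_cases i
      · exact ⟨1, Or.inr ⟨hs, by rw [h]; norm_num⟩⟩
      · exact ⟨0, Or.inr ⟨hs, by rw [h]; norm_num⟩⟩
      · exact ⟨0, Or.inr ⟨hs, by rw [h]; norm_num⟩⟩
  isPreconnected := isPreconnected_flatFrom_tube_zero 1

theorem isStaircase_tube : ∀ n, IsStaircase (tube n)
  | 0 => isStaircase_tube_zero
  | n + 1 => (isStaircase_tube n).step

theorem mem_planes_tube_zero {t : ℝ} (ht : t ≤ 1) {i : Fin 3} {c : ℝ} :
    (i, c) ∈ planes t (tube 0) ↔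
      (i = 0 ∧ ((c = 0 ∧ t < 0) ∨ c = 3)) ∨ (i ≠ 0 ∧ (c = 0 ∨ c = 1)) := by
  have key : ∀ p : E3, (∃ s, FlatAt (tube 0) i s p) ↔
      ((p i = (![0, 0, 0] : Fin 3 → ℝ) i) ∨ (p i = (![3, 1, 1] : Fin 3 → ℝ) i)) ∧
        ∀ j, j ≠ i → (![0, 0, 0] : Fin 3 → ℝ) j < p j ∧ p j < (![3, 1, 1] : Fin 3 → ℝ) j := by
    intro p
    simp only [tube, flatAt_box tube_zero_lt, exists_and_right, exists_or, exists_and_left,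
      exists_eq, and_true]
  simp only [planes, flatFrom, mem_ofPred_eq, Set.Nonempty, key]
  constructor
  · rintro ⟨p, h1, rfl, h2, h3⟩
    fin_cases i
    · simp at h2 ⊢
      rcases h2 with h2 | h2
      · rw [h2] at h1; exact Or.inl ⟨h2, h1⟩
      · exact Or.inr h2
    · simpa using h2
    · simpa using h2
  · rintro (⟨rfl, ⟨rfl, h⟩ | rfl⟩ | ⟨hi, hc⟩)
    · refine ⟨pt ![0, 1 / 2, 1 / 2], ?_⟩
      simp [Fin.forall_fin_succ, h]; norm_num
    · refine ⟨pt ![3, 1 / 2, 1 / 2], ?_⟩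
      simp [Fin.forall_fin_succ]; norm_num; linarith
    · fin_cases i
      · simp at hi
      · refine ⟨pt ![3 / 2, c, 1 / 2], ?_⟩
        simp [Fin.forall_fin_succ]
        exact ⟨by linarith, hc, by norm_num⟩
      · refine ⟨pt ![3 / 2, 1 / 2, c], ?_⟩
        simp [Fin.forall_fin_succ]
        exact ⟨by linarith, hc, by norm_num⟩

theorem encard_planes_one_tube_zero : (planes 1 (tube 0)).encard = 5 := by
  have : planes 1 (tube 0) = {(0, 3), (1, 0), (1, 1), (2, 0), (2, 1)} := by
    ext ⟨i, c⟩
    rw [mem_planes_tube_zero le_rfl]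
    fin_cases i <;> simp
  rw [this, encard_insert_of_notMem (by simp), encard_insert_of_notMem (by simp),
    encard_insert_of_notMem (by simp), encard_insert_of_notMem (by simp), encard_singleton]
  norm_num

theorem encard_planes_tube_zero : (planes (-1) (tube 0)).encard = 6 := by
  have : planes (-1) (tube 0) = {(0, 0), (0, 3), (1, 0), (1, 1), (2, 0), (2, 1)} := by
    ext ⟨i, c⟩
    rw [mem_planes_tube_zero (by norm_num)]
    fin_cases i <;> simp
  rw [this, encard_insert_of_notMem (by simp), encard_insert_of_notMem (by simp),
    encard_insert_of_notMem (by simp), encard_insert_of_notMem (by simp),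
    encard_insert_of_notMem (by simp), encard_singleton]
  norm_num

theorem encard_firstPlanes_one_one : (firstPlanes 1 1).encard = 2 := by
  have : firstPlanes 1 1 = {(1, 0), (1, 1)} := by
    ext ⟨i, c⟩
    fin_cases i <;> simp [firstPlanes]
  rw [this, encard_insert_of_notMem (by simp), encard_singleton]
  norm_num

theorem encard_firstPlanes_neg_one : (firstPlanes (-1) 1).encard = 3 := by
  have : firstPlanes (-1) 1 = {(0, 0), (1, 0), (1, 1)} := by
    ext ⟨i, c⟩
    fin_cases i <;> simp [firstPlanes]
  rw [this, encard_insert_of_notMem (by simp), encard_insert_of_notMem (by simp), encard_singleton]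
  norm_num

theorem encard_firstPlanes_half : (firstPlanes (-1) (1 / 2)).encard = 4 := by
  have : firstPlanes (-1) (1 / 2) = {(0, 0), (1, 0), (1, 1), (2, 1 / 2)} := by
    ext ⟨i, c⟩
    fin_cases i <;> simp [firstPlanes]
    norm_num
  rw [this, encard_insert_of_notMem (by simp), encard_insert_of_notMem (by simp),
    encard_insert_of_notMem (by simp), encard_singleton]
  norm_num

theorem encard_planes_one_tube (n : ℕ) : (planes 1 (tube n)).encard = (5 + 2 * n : ℕ) := by
  induction n with
  | zero => exact encard_planes_one_tube_zero
  | succ n ih =>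
    rw [tube, (isStaircase_tube n).encard_planes_step one_pos le_rfl le_rfl,
      encard_firstPlanes_one_one, ih]
    norm_cast
    ring

theorem encard_planes_tube (n : ℕ) : (planes (-1) (tube n)).encard = (6 + 2 * n : ℕ) := by
  cases n with
  | zero => exact encard_planes_tube_zero
  | succ n =>
    rw [tube, (isStaircase_tube n).encard_planes_step one_pos le_rfl (by norm_num),
      encard_firstPlanes_neg_one, encard_planes_one_tube]
    norm_cast
    ring

theorem encard_planes_step_half_tube (n : ℕ) :
    (planes (-1) (step (1 / 2) (tube n))).encard = (9 + 2 * n : ℕ) := by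
  rw [(isStaircase_tube n).encard_planes_step (by norm_num) (by norm_num) (by norm_num),
    encard_firstPlanes_half, encard_planes_one_tube]
  norm_cast
  ring

/-- The common properties of the extremal polyhedra: tubes, possibly with a first segment of
height `h < 1`. -/
structure IsStaircaseSolid (h : ℝ) (P : Set E3) : Prop where
  isBoxUnion : IsBoxUnion P
  isConnected : IsConnected P
  nonneg : ∀ p ∈ P, ∀ i, 0 ≤ p i
  locallyMonotoneAt : ∀ p, LocallyMonotoneAt P p
  bounds : StaircaseBounds P
  side : ∀ i s p, FlatAt P i s p →
    (∃ k : ℤ, (s = 1 ∧ p i = 2 * k) ∨ (s = -1 ∧ p i = 2 * k + 1)) ∨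
      (i = 2 ∧ h < 1 ∧ s = -1 ∧ p i = h)
  isPreconnected : ∀ i c, IsPreconnected (flatFrom (-1) P i c)

theorem IsStaircase.solid_step {h : ℝ} (h0 : 0 < h) (h1 : h ≤ 1) {Q : Set E3} (hQ : IsStaircase Q) :
    IsStaircaseSolid h (FaceGuards.step h Q) where
  isBoxUnion := hQ.isBoxUnion.step h0
  isConnected := isConnected_step h0.le hQ.isConnected hQ.standardStart
  nonneg := nonneg_step hQ.nonneg
  locallyMonotoneAt := locallyMonotoneAt_step h0 h1 hQ.standardStart hQ.locallyMonotoneAt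
  bounds := hQ.bounds.step h1
  side _ _ _ H := hQ.flatAt_step h0 h1 H
  isPreconnected := hQ.isPreconnected_flatFrom_step h0 h1 (by norm_num)

theorem isStaircaseSolid_tube (n : ℕ) : IsStaircaseSolid 1 (tube n) := by
  cases n with
  | zero =>
    have h := isStaircase_tube_zero
    exact ⟨h.isBoxUnion, h.isConnected, h.nonneg, h.locallyMonotoneAt, h.bounds,
      fun i s p H => Or.inl (h.side i s p H), isPreconnected_flatFrom_tube_zero (-1)⟩
  | succ n => exact (isStaircase_tube n).solid_step one_pos le_rfl

theorem IsStaircaseSolid.isOrthogonalPolyhedron {h : ℝ} {P : Set E3} (hP : IsStaircaseSolid h P) :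
    IsOrthogonalPolyhedron P :=
  isOrthogonalPolyhedron_of_isBoxUnion hP.isBoxUnion hP.isConnected
    fun p _ => hP.locallyMonotoneAt p

/-- The faces correspond to the coordinate planes that carry flat points. By non-negativity, all of
them lie beyond `x = -1`. -/
theorem IsStaircaseSolid.encard_faces {h : ℝ} {P : Set E3} (hP : IsStaircaseSolid h P) :
    (faces P).encard = (planes (-1) P).encard := by
  have key : ∀ i c, flatPart P (stdBasis i) c = flatFrom (-1) P i c := by
    intro i c
    ext p
    rw [mem_flatPart_iff hP.isBoxUnion.isClosed hP.locallyMonotoneAt]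
    refine ⟨fun ⟨hc, s, H⟩ => ⟨?_, hc, s, H⟩, fun ⟨_, hc, H⟩ => ⟨hc, H⟩⟩
    linarith [hP.nonneg p H.mem 0]
  rw [encard_faces_eq hP.isBoxUnion fun i c => by rw [key]; exact hP.isPreconnected i c]
  simp only [key]
  rfl

/-! ### Necessity -/

/-- Points no two of which can be guarded by the same open face of a tube. -/
noncomputable def witness (k : ℕ) : E3 := pt ![2 * k + 3 / 2, 2 * k + 1 / 2, 2 * k + 1 / 4]

theorem witness_zero_mem_step {h : ℝ} (hh : 1 / 4 ≤ h) (Q : Set E3) : witness 0 ∈ step h Q := by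
  rw [mem_step]
  left
  simp [witness]
  norm_num
  linarith

theorem unshift_three_witness (k : ℕ) :
    unshift (unshift (unshift (witness (k + 1)))) = witness k := by
  refine PiLp.ext fun i => ?_
  fin_cases i <;> simp [witness] <;> ring

theorem witness_mem_tube : ∀ {k n : ℕ}, 3 * k ≤ n → witness k ∈ tube n := by
  intro k
  induction k with
  | zero =>
    intro n _
    cases n with
    | zero => rw [tube, mem_box_iff]; simp [witness]; norm_num
    | succ n => exact witness_zero_mem_step (by norm_num) _
  | succ k ih =>
    intro n hn
    obtain ⟨m, rfl⟩ : ∃ m, n = m + 1 + 1 + 1 := ⟨n - 3, by omega⟩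
    refine Or.inr (Or.inr (Or.inr ?_))
    rw [unshift_three_witness]
    exact ih (by omega)

theorem witness_mem_step_tube {h : ℝ} (hh : 1 / 4 ≤ h) {k n : ℕ} (hk : 3 * k ≤ n + 1) :
    witness k ∈ step h (tube n) := by
  cases k with
  | zero => exact witness_zero_mem_step hh _
  | succ k =>
    obtain ⟨m, rfl⟩ : ∃ m, n = m + 1 + 1 := ⟨n - 2, by omega⟩
    refine Or.inr (Or.inr (Or.inr ?_))
    rw [unshift_three_witness]
    exact witness_mem_tube (by omega)

/-- The region in which the points that see a witness lie. -/
theorem StaircaseBounds.visible {P : Set E3} (hP : StaircaseBounds P) {k : ℕ} {p : E3}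
    (hseg : segment ℝ p (witness k) ⊆ P) :
    (2 * k ≤ p 0 ∧ p 0 ≤ 2 * k + 3) ∧ (2 * k ≤ p 1 ∧ p 1 < 2 * k + 5 / 2) ∧
      (2 * k - 1 < p 2 ∧ p 2 < 2 * k + 2) := by
  have hp : p ∈ P := hseg (left_mem_segment _ _ _)
  have H : ∀ t : ℝ, 0 ≤ t → t ≤ 1 →
      pt ![2 * k + 3 / 2 + t * (p 0 - (2 * k + 3 / 2)), 2 * k + 1 / 2 + t * (p 1 - (2 * k + 1 / 2)),
        2 * k + 1 / 4 + t * (p 2 - (2 * k + 1 / 4))] ∈ P := by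
    intro t ht0 ht1
    refine hseg ⟨t, 1 - t, ht0, by linarith, by ring, PiLp.ext fun i => ?_⟩
    fin_cases i <;> simp [witness] <;> ring
  -- a line to `z ≤ 2 k - 1` would need `x ≤ 2 k + 1` where `z = 2 k - 1 / 10` and `x ≥ 2 k` where
  -- `z = 2 k - 9 / 10`
  have hz : 2 * k - 1 < p 2 := by
    by_contra! hcon
    obtain ⟨m, hm⟩ : ∃ m, m = 2 * k + 1 / 4 - p 2 := ⟨_, rfl⟩
    have hm0 : 5 / 4 ≤ m := by linarith
    have e1 : 7 / 20 / m * (p 2 - (2 * k + 1 / 4)) = -(7 / 20) := by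
      rw [show p 2 - (2 * k + 1 / 4) = -m by linarith]; field_simp
    have e2 : 23 / 20 / m * (p 2 - (2 * k + 1 / 4)) = -(23 / 20) := by
      rw [show p 2 - (2 * k + 1 / 4) = -m by linarith]; field_simp
    have e3 : 23 / 20 / m * (p 0 - (2 * k + 3 / 2)) =
        23 / 7 * (7 / 20 / m * (p 0 - (2 * k + 3 / 2))) := by ring
    have a1 := hP.z_lt (k - 1) _ (H (7 / 20 / m) (by positivity) (by rw [div_le_one] <;> linarith))
      (by simp [-one_div]; linarith)
    have a2 := hP.lt_z (k - 1) _ (H (23 / 20 / m) (by positivity) (by rw [div_le_one] <;> linarith))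
      (by simp [-one_div]; linarith)
    simp [-one_div] at a1 a2
    linarith [a1.1, a2.1]
  have hlow := hP.lt_z (k - 1) p hp (by push_cast; linarith)
  push_cast at hlow
  -- a line to `y ≥ 2 k + 5 / 2` would need `x ≥ 2 k + 2` where `y = 2 k + 11 / 10`, `z ≤ 2 k + 1`
  -- where `y = 2 k + 19 / 10`, and hence `z < 2 k + 2` but `x > 2 k + 3` where `y = 2 k + 5 / 2`
  have hy : p 1 < 2 * k + 5 / 2 ∧ (2 * k + 2 ≤ p 1 → p 2 < 2 * k + 2) := by
    by_cases hc : p 1 < 2 * k + 2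
    · exact ⟨by linarith, fun h => by linarith⟩
    push Not at hc
    obtain ⟨m, hm⟩ : ∃ m, m = p 1 - (2 * k + 1 / 2) := ⟨_, rfl⟩
    have hm0 : 3 / 2 ≤ m := by linarith
    have e1 : ∀ a : ℝ, a / m * (p 1 - (2 * k + 1 / 2)) = a := fun a => by
      rw [← hm]; field_simp
    have a1 := hP.lt_y k _ (H (3 / 5 / m) (by positivity) (by rw [div_le_one] <;> linarith))
      (by simp [-one_div, e1]; linarith)
    have a2 := hP.y_lt k _ (H (7 / 5 / m) (by positivity) (by rw [div_le_one] <;> linarith))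
      (by simp [-one_div, e1]; linarith)
    simp [-one_div] at a1 a2
    obtain ⟨X, hX⟩ : ∃ X, X = (p 0 - (2 * k + 3 / 2)) / m := ⟨_, rfl⟩
    obtain ⟨Z, hZ⟩ : ∃ Z, Z = (p 2 - (2 * k + 1 / 4)) / m := ⟨_, rfl⟩
    have eX : ∀ a : ℝ, a / m * (p 0 - (2 * k + 3 / 2)) = a * X := fun a => by rw [hX]; ring
    have eZ : ∀ a : ℝ, a / m * (p 2 - (2 * k + 1 / 4)) = a * Z := fun a => by rw [hZ]; ring
    rw [eX, eZ] at a1 a2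
    have h5 : p 1 < 2 * k + 5 / 2 := by
      by_contra! hcon
      have a3 := hP.z_lt k _ (H (2 / m) (by positivity) (by rw [div_le_one] <;> linarith))
        (by simp [-one_div, eZ]; linarith [a2.2])
      simp [-one_div] at a3
      rw [eX] at a3
      linarith [a1.1, a3.1]
    refine ⟨h5, fun _ => ?_⟩
    have h6 : p 2 = 2 * k + 1 / 4 + m * Z := by rw [hZ]; field_simp; ring
    rw [h6]
    have : Z ≤ 15 / 28 := by linarith [a2.2]
    nlinarith
  have hz2 : p 2 < 2 * k + 2 := by
    by_contra! hcon
    have := hP.lt_z k p hp (by push_cast; linarith)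
    push_cast at this
    linarith [hy.2 this.2]
  have hup := hP.z_lt k p hp (by push_cast; linarith)
  push_cast at hup
  exact ⟨⟨by linarith [hlow.1], by linarith [hup.1]⟩, ⟨by linarith [hlow.2], hy.1⟩, hz, hz2⟩

/-- A flat point that sees a point lies on the right side of it. -/
theorem FlatAt.side_of_visible {P : Set E3} {i : Fin 3} {s : ℝ} {p w : E3} (H : FlatAt P i s p)
    (hseg : segment ℝ p w ⊆ P) : 0 ≤ s * (w i - p i) := by
  have hline : Tendsto (fun t : ℝ => p + t • (w - p)) (𝓝[>] 0) (𝓝 p) := by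
    have : Continuous fun t : ℝ => p + t • (w - p) := by fun_prop
    simpa using (this.tendsto 0).mono_left nhdsWithin_le_nhds
  have h1 : ∀ᶠ t : ℝ in 𝓝[>] 0, t < 1 := nhdsWithin_le_nhds (eventually_lt_nhds one_pos)
  obtain ⟨t, ht, ht1, ht0⟩ := ((hline.eventually H.2).and (h1.and self_mem_nhdsWithin)).exists
  have ht0' : (0 : ℝ) < t := ht0
  have h2 : p + t • (w - p) ∈ P := hseg (by
    rw [segment_eq_image']
    exact ⟨t, ⟨ht0'.le, ht1.le⟩, rfl⟩)
  have h3 := ht.1 h2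
  simp at h3
  by_contra! hcon
  nlinarith

/-- The planes of the faces visible from a witness: on the side of the witness in the region
of `StaircaseBounds.visible`, with an even coordinate for lower faces and an odd one for upper
faces. -/
theorem IsStaircaseSolid.plane_of_visible {h : ℝ} (h0 : 0 < h) {P : Set E3}
    (hP : IsStaircaseSolid h P) {i : Fin 3} {s : ℝ} {p : E3} (H : FlatAt P i s p) {k : ℕ}
    (hseg : segment ℝ p (witness k) ⊆ P) :
    (i = 0 ∧ (p i = 2 * k ∨ p i = 2 * k + 3)) ∨ (i ≠ 0 ∧ (p i = 2 * k ∨ p i = 2 * k + 1)) ∨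
      (i = 2 ∧ h < 1 ∧ p i = h ∧ k = 0) := by
  obtain ⟨⟨x0, x1⟩, ⟨y0, y1⟩, z0, z1⟩ := hP.bounds.visible hseg
  have hs := H.side_of_visible hseg
  have hint : ∀ a b : ℤ, (a : ℝ) < b + 1 → (b : ℝ) < a + 1 → a = b := fun a b h1 h2 => by
    have h3 : a < b + 1 := by exact_mod_cast h1
    have h4 : b < a + 1 := by exact_mod_cast h2
    omega
  rcases hP.side i s p H with ⟨l, ⟨rfl, hl⟩ | ⟨rfl, hl⟩⟩ | ⟨rfl, hh, rfl, hl⟩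
  · have hlk : l = k := by
      fin_cases i <;> simp [witness] at hs hl <;>
        refine hint _ _ ?_ ?_ <;> push_cast <;> linarith
    subst hlk
    by_cases hi : i = 0
    · exact Or.inl ⟨hi, Or.inl (by exact_mod_cast hl)⟩
    · exact Or.inr (Or.inl ⟨hi, Or.inl (by exact_mod_cast hl)⟩)
  · by_cases hi : i = 0
    · subst hi
      simp [witness] at hs
      have hlk : l = k + 1 := hint _ _ (by push_cast; linarith) (by push_cast; linarith)
      subst hlk
      push_cast at hl
      exact Or.inl ⟨rfl, Or.inr (by linarith)⟩
    · have hlk : l = k := by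
        fin_cases i
        · exact absurd rfl hi
        all_goals
          simp [witness] at hs hl
          refine hint _ _ ?_ ?_ <;> push_cast <;> linarith
      subst hlk
      exact Or.inr (Or.inl ⟨hi, Or.inr (by exact_mod_cast hl)⟩)
  · refine Or.inr (Or.inr ⟨rfl, hh, hl, ?_⟩)
    simp [witness] at hs
    have : (k : ℝ) < 1 := by linarith
    have : k < 1 := by exact_mod_cast this
    omega

/-- Two witnesses that see flat points in one coordinate plane coincide. -/
theorem IsStaircaseSolid.witness_unique {h : ℝ} (h0 : 0 < h) {P : Set E3}
    (hP : IsStaircaseSolid h P) {i : Fin 3} {c : ℝ} {p q : E3} (hp : p ∈ flatPart P (stdBasis i) c)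
    (hq : q ∈ flatPart P (stdBasis i) c) {k l : ℕ}
    (hpk : segment ℝ p (witness k) ⊆ P) (hql : segment ℝ q (witness l) ⊆ P) : k = l := by
  rw [mem_flatPart_iff hP.isBoxUnion.isClosed hP.locallyMonotoneAt] at hp hq
  obtain ⟨hpc, s, Hp⟩ := hp
  obtain ⟨hqc, s', Hq⟩ := hq
  have h1 := hP.plane_of_visible h0 Hp hpk
  have h2 := hP.plane_of_visible h0 Hq hql
  rw [hpc] at h1
  rw [hqc] at h2
  have hnat : ∀ a : ℕ, h < 1 → h ≠ a := by
    rintro a hlt rfl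
    have h3 : 0 < a := by exact_mod_cast h0
    have h4 : a < 1 := by exact_mod_cast hlt
    omega
  have hpar : ∀ a b : ℕ, (a : ℝ) = b → a = b := fun a b hab => by exact_mod_cast hab
  rcases h1 with ⟨hi, h1 | h1⟩ | ⟨hi, h1 | h1⟩ | ⟨hi, hh, h1, rfl⟩ <;>
    rcases h2 with ⟨hi', h2 | h2⟩ | ⟨hi', h2 | h2⟩ | ⟨hi', hh', h2, rfl⟩
  · have := hpar (2 * k) (2 * l) (by push_cast; linarith)
    omega
  · have := hpar (2 * k) (2 * l + 3) (by push_cast; linarith)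
    omega
  · exact absurd hi hi'
  · exact absurd hi hi'
  · rw [hi] at hi'; exact absurd hi' (by decide)
  · have := hpar (2 * k + 3) (2 * l) (by push_cast; linarith)
    omega
  · have := hpar (2 * k + 3) (2 * l + 3) (by push_cast; linarith)
    omega
  · exact absurd hi hi'
  · exact absurd hi hi'
  · rw [hi] at hi'; exact absurd hi' (by decide)
  · exact absurd hi' hi
  · exact absurd hi' hi
  · have := hpar (2 * k) (2 * l) (by push_cast; linarith)
    omega
  · have := hpar (2 * k) (2 * l + 1) (by push_cast; linarith)
    omega
  · exact absurd (show h = (2 * k : ℕ) by push_cast; linarith) (hnat _ hh')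
  · exact absurd hi' hi
  · exact absurd hi' hi
  · have := hpar (2 * k + 1) (2 * l) (by push_cast; linarith)
    omega
  · have := hpar (2 * k + 1) (2 * l + 1) (by push_cast; linarith)
    omega
  · exact absurd (show h = (2 * k + 1 : ℕ) by push_cast; linarith) (hnat _ hh')
  · rw [hi] at hi'; exact absurd hi' (by decide)
  · rw [hi] at hi'; exact absurd hi' (by decide)
  · exact absurd (show h = (2 * l : ℕ) by push_cast; linarith) (hnat _ hh)
  · exact absurd (show h = (2 * l + 1 : ℕ) by push_cast; linarith) (hnat _ hh)
  · rfl

/-- The relative interior of a face of a box union consists of flat points in one coordinate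
plane. -/
theorem IsBoxUnion.exists_flatPart {P : Set E3} (h : IsBoxUnion P) {F : Set E3} (hF : F ∈ faces P) :
    ∃ i c, intrinsicInterior ℝ F ⊆ flatPart P (stdBasis i) c := by
  obtain ⟨n, hn, c, p, hp, rfl⟩ := exists_component_of_mem_faces hF
  obtain ⟨i, d, hpl⟩ := h.exists_axis hn hp
  refine ⟨i, d, ?_⟩
  rw [(isPlanarPiece_closure_component hn hp).1, ← flatPart_congr hpl P]
  exact connectedComponentIn_subset _ _

theorem IsStaircaseSolid.le_card {h : ℝ} (h0 : 0 < h) {P : Set E3} (hP : IsStaircaseSolid h P)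
    {m : ℕ} (hw : ∀ k < m, witness k ∈ P) {𝒢 : Finset (Set E3)} (h𝒢 : IsOpenFaceGuarding P 𝒢) :
    m ≤ 𝒢.card := by
  have key : ∀ k < m, ∃ F ∈ 𝒢, ∃ x ∈ intrinsicInterior ℝ F, segment ℝ x (witness k) ⊆ P := by
    intro k hk
    have h1 := hw k hk
    rw [← h𝒢.guards] at h1
    obtain ⟨x, hx, hseg⟩ := h1
    simp only [mem_iUnion] at hx
    obtain ⟨F, hF, hxF⟩ := hx
    exact ⟨F, hF, x, hxF, hseg⟩
  choose! F hF x hx hseg using key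
  rw [← Finset.card_range m]
  refine Finset.card_le_card_of_injOn F (fun k hk => hF k (Finset.mem_range.1 hk)) ?_
  intro k hk l hl hkl
  have hk' := Finset.mem_range.1 hk
  have hl' := Finset.mem_range.1 hl
  obtain ⟨i, c, hflat⟩ := hP.isBoxUnion.exists_flatPart (h𝒢.subset_faces (hF k hk'))
  refine hP.witness_unique h0 (hflat (hx k hk')) (hflat ?_) (hseg k hk') (hseg l hl')
  rw [hkl]
  exact hx l hl'

/-- Even numbers of faces are attained by tubes, odd ones by tubes with a first segment of height
`1 / 2`. -/
theorem exists_isOrthogonalPolyhedron_le_card (f : ℕ) (hf : f = 6 ∨ 8 ≤ f) :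
    ∃ P : Set E3, IsOrthogonalPolyhedron P ∧ (faces P).encard = f ∧
      ∀ 𝒢 : Finset (Set E3), IsOpenFaceGuarding P 𝒢 → f / 6 ≤ 𝒢.card := by
  rcases Nat.even_or_odd' f with ⟨n, rfl | rfl⟩
  · obtain ⟨m, rfl⟩ : ∃ m, n = m + 3 := ⟨n - 3, by omega⟩
    have hP := isStaircaseSolid_tube m
    refine ⟨tube m, hP.isOrthogonalPolyhedron, ?_, fun 𝒢 h𝒢 => ?_⟩
    · rw [hP.encard_faces, encard_planes_tube]
      congr 1
      ring
    · exact hP.le_card one_pos (fun k hk => witness_mem_tube (by omega)) h𝒢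
  · obtain ⟨m, rfl⟩ : ∃ m, n = m + 4 := ⟨n - 4, by omega⟩
    have hP := (isStaircase_tube m).solid_step (h := 1 / 2) (by norm_num) (by norm_num)
    refine ⟨_, hP.isOrthogonalPolyhedron, ?_, fun 𝒢 h𝒢 => ?_⟩
    · rw [hP.encard_faces, encard_planes_step_half_tube]
      congr 1
      ring
    · exact hP.le_card (by norm_num)
        (fun k hk => witness_mem_step_tube (by norm_num) (by omega)) h𝒢

end FaceGuards

theorem theorem2 :
    (∀ (f : ℕ) (P : Set FaceGuards.E3),
      FaceGuards.IsOrthogonalPolyhedron P → (FaceGuards.faces P).encard = f →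
        ∃ 𝒢 : Finset (Set FaceGuards.E3),
          FaceGuards.IsOpenFaceGuarding P 𝒢 ∧ 𝒢.card ≤ f / 6) ∧
    (∀ f : ℕ, f = 6 ∨ 8 ≤ f →
      ∃ P : Set FaceGuards.E3,
        FaceGuards.IsOrthogonalPolyhedron P ∧ (FaceGuards.faces P).encard = f ∧
          ∀ 𝒢 : Finset (Set FaceGuards.E3),
            FaceGuards.IsOpenFaceGuarding P 𝒢 → f / 6 ≤ 𝒢.card) :=
  ⟨fun _ _ hP hf => FaceGuards.exists_guarding_card_le hP hf, FaceGuards.exists_isOrthogonalPolyhedron_le_card⟩
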